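/- Notation. Let $\Lambda$ be the ring of symmetric functions over $\mathbb C$ in variables $\tilde x_1,\tilde x_2,\dots$, with power sums $p_n=\sum_k\tilde x_k^n$. For a Young diagram $\lambda$ let $\mathcal T^\lambda$ be the set of semistandard tableaux of shape $\lambda$ with positive integer entries, $\tilde x^T$ the monomial of a tableau $T$, and $S_\lambda=\sum_{T\in\mathcal T^\lambda}\tilde x^T$ the Schur function. Let $\langle\cdot,\cdot\rangle$ be the bilinear form on $\Lambda$ for which the Schur functions are orthonormal, extended to a pairing of $\Lambda$ with formal infinite sums of homogeneous symmetric functions. For such a sum $g$ let $g^\perp$ be the operator on $\Lambda$ dual to multiplication by $g$, $\langle g^\perp f,h\rangle=\langle f,gh\rangle$, that is $g^\perp f=\sum_\mu\langle f,gS_\mu\rangle S_\mu$. For a Young diagram $\pi\neq\emptyset$ put $L_\pi=\prod_{T\in\mathcal T^\pi}(1-\tilde x^T)$; put $L_\emptyset=1$. The $\pi$-type symmetric function is $S^\pi_\lambda=L_\pi^\perp S_\lambda$. A Maya diagram $|\mathbf u\rangle$ is given by half-integers $u_1<u_2<\cdots$ (positions of black stones) with $u_{j+1}=u_j+1$ for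 all large $j$; $|\mathrm{vac}\rangle=|1/2,3/2,5/2,\dots\rangle$. The Fock space has the Maya diagrams as a basis, and $\langle\mathrm{vac}|$ is the linear form that takes the coefficient of $|\mathrm{vac}\rangle$. For $j\in\mathbb Z+\tfrac12$, $$\psi_j|\mathbf u\rangle=(-1)^{i-1}|\dots,u_{i-1},u_{i+1},\dots\rangle\ \text{ if } u_i=-j \text{ for some } i,\ \text{ and } 0 \text{ otherwise},$$ $$\psi^*_j|\mathbf u\rangle=(-1)^{i}|\dots,u_i,j,u_{i+1},\dots\rangle\ \text{ if } u_i<j<u_{i+1} \text{ for some } i\ge 0 \ (u_0=-\infty),\ \text{ and } 0 \text{ otherwise}.$$ Let $H_n=\sum_{j\in\mathbb Z+1/2}:\!\psi_{-j}\psi^*_{j+n}\!:$ and $H(x)=\sum_{n\ge1}x_nH_n$. To a Young diagram $\lambda$ corresponds the Maya diagram $|\mathbf u_\lambda\rangle$ of charge zero with $u_j=j-\tfrac12-\lambda'_j$, $\lambda'$ being the conjugate of $\lambda$; let $|\lambda\rangle=(-1)^{|\lambda|}|\mathbf u_\lambda\rangle$. Equivalently, if $\lambda=(-n_1-\tfrac12,\dots,-n_l-\tfrac12\,|\,-m_1-\tfrac12,\dots,-m_l-\tfrac12)$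 in Frobenius notation with $n_1<\dots<n_l<0$ and $m_1<\dots<m_l<0$, then $$|\lambda\rangle=(-1)^{\sum_i(m_i+1/2)+l(l-1)/2}\,\psi_{n_1}\cdots\psi_{n_l}\psi^*_{m_1}\cdots\psi^*_{m_l}|\mathrm{vac}\rangle .$$ Define polynomials by $\exp(\sum_{m\ge1}x_mk^m)=\sum_{n\ge0}P_{(n)}k^n$, $P_{(i)}=0$ for $i<0$, and $P_\pi(x)=\det(P_{(\pi_i-i+j)})_{1\le i,j\le\ell}$, where $\ell$ is the number of rows of $\pi$. Let $P_\pi(H_n)$ be the operator obtained from $P_\pi(x)$ by replacing each $x_i$ with $\frac1iH_{in}$. On the Fock space let $$L_\pi^\perp=\exp\Bigl(-\sum_{n\ge1}\tfrac1nP_\pi(H_n)\Bigr)\ \text{ for } \pi\neq\emptyset,\qquad L^\perp_\emptyset=1 .$$ Proposition. For all Young diagrams $\pi$ and $\lambda$, $$S^\pi_\lambda(x)=\langle\mathrm{vac}|e^{H(x)}L^\perp_\pi|\lambda\rangle ,$$ where the right-hand side is a polynomial in $x_1,x_2,\dots$ and is identified with an element of $\Lambda$ by $x_n=p_n/n$.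 -/

import Mathlib

/-!
Half-integers: throughout, the integer `k` stands for the half-integer `k + 1/2`.
Thus the half-integer `-(k + 1/2)` is represented by `-1 - k`.
Variables: in `MvPolynomial ℕ+ ℂ = ℂ[x₁, x₂, …]` the variable `X n` is `x_n`.  Symmetric functions
are elements of `MvPowerSeries ℕ ℂ`, the alphabet being indexed by `ℕ`.
-/

noncomputable section

namespace PiSym

/-! ### Maya diagrams and Fermions -/

/-- A Maya diagram, given by its set of black stones: all positions far to the left are white and
all positions far to the right are black. (Listing the black stones in increasing order gives the
sequences `u₁ < u₂ < ⋯` with `u_{j+1} = u_j + 1` for large `j`.) -/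
@[ext]
structure Maya where
  black : Set ℤ
  left_white : ∃ a, ∀ k < a, k ∉ black
  right_black : ∃ b, ∀ k, b ≤ k → k ∈ black

namespace Maya

/-- The vacuum: black stones at `1/2, 3/2, 5/2, …`. -/
def vac : Maya where
  black := {k | 0 ≤ k}
  left_white := ⟨0, fun _ hk h => absurd hk (not_lt.mpr h)⟩
  right_black := ⟨0, fun _ hk => hk⟩

/-- Remove the stone at position `p`. -/
def erase (u : Maya) (p : ℤ) : Maya where
  black := u.black \ {p}
  left_white := by
    obtain ⟨a, ha⟩ := u.left_white
    exact ⟨a, fun k hk h => ha k hk h.1⟩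
  right_black := by
    obtain ⟨b, hb⟩ := u.right_black
    refine ⟨max b (p + 1), fun k hk => ⟨hb k (le_trans (le_max_left _ _) hk), ?_⟩⟩
    have := le_trans (le_max_right b (p + 1)) hk
    simp only [Set.mem_singleton_iff]
    omega

/-- Put a black stone at position `p`. -/
def insert (u : Maya) (p : ℤ) : Maya where
  black := u.black ∪ {p}
  left_white := by
    obtain ⟨a, ha⟩ := u.left_white
    refine ⟨min a p, fun k hk h => ?_⟩
    have h1 := lt_of_lt_of_le hk (min_le_left a p)
    have h2 := lt_of_lt_of_le hk (min_le_right a p)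
    rcases h with h | h
    · exact ha k h1 h
    · simp only [Set.mem_singleton_iff] at h
      omega
  right_black := by
    obtain ⟨b, hb⟩ := u.right_black
    exact ⟨b, fun k hk => Or.inl (hb k hk)⟩

/-- The number of black stones strictly to the left of position `p` (a finite number). -/
def countLeft (u : Maya) (p : ℤ) : ℕ := Set.ncard {k | k ∈ u.black ∧ k < p}

/-- The charge zero Maya diagram of a Young diagram `lam`: the black stones are
`u_j = j - 1/2 - lam'_j` (`j ≥ 1`), with `lam'` the conjugate diagram. Equivalently, starting from
the vacuum, for each diagonal box the stone at `a + 1/2` is moved to `-(b + 1/2)`, where `a`, `b`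
are the arm and leg lengths of that box. -/
def ofYoung (lam : YoungDiagram) : Maya where
  black := Set.range fun j : ℕ => (j : ℤ) - lam.colLen j
  left_white := by
    refine ⟨-(lam.colLen 0 : ℤ), ?_⟩
    rintro k hk ⟨j, rfl⟩
    have := lam.colLen_anti 0 j (Nat.zero_le j)
    simp only at hk
    omega
  right_black := by
    refine ⟨lam.rowLen 0, fun k hk => ⟨k.toNat, ?_⟩⟩
    have h0 : lam.colLen k.toNat = 0 := by
      by_contra h
      have h1 : (0, k.toNat) ∈ lam := YoungDiagram.mem_iff_lt_colLen.mpr (Nat.pos_of_ne_zero h)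
      have h2 := YoungDiagram.mem_iff_lt_rowLen.mp h1
      omega
    simp only [h0]
    omega

end Maya

/-- The Fermionic Fock space with coefficients in `R`, based by the set of Maya diagrams. -/
abbrev Fock (R : Type) [CommRing R] : Type := Maya →₀ R

section Operators

variable (R : Type) [CommRing R]

/-- The basis vector `|u⟩`. -/
def Maya.ket (u : Maya) : Fock R := Finsupp.single u 1

/-- `⟨vac|`, the linear form with `⟨vac|vac⟩ = 1` and `⟨vac|u⟩ = 0` for Maya diagrams
`u ≠ vac`. -/
def braVac : Fock R →ₗ[R] R := Finsupp.lapply Maya.vac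

open Classical in
/-- The Fermion `ψ_j`, `j = k + 1/2`: if `u_i = -j` then
`ψ_j |u⟩ = (-1)^(i-1) |…, u_{i-1}, u_{i+1}, …⟩`, otherwise `ψ_j |u⟩ = 0`. -/
def psi (k : ℤ) : Module.End R (Fock R) :=
  Finsupp.linearCombination R fun u : Maya =>
    if -1 - k ∈ u.black then (-1 : R) ^ u.countLeft (-1 - k) • (u.erase (-1 - k)).ket R else 0

open Classical in
/-- The Fermion `ψ*_j`, `j = k + 1/2`: if `u_i < j < u_{i+1}` then
`ψ*_j |u⟩ = (-1)^i |…, u_i, j, u_{i+1}, …⟩`, otherwise (`j` is black) `ψ*_j |u⟩ = 0`. -/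
def psiStar (k : ℤ) : Module.End R (Fock R) :=
  Finsupp.linearCombination R fun u : Maya =>
    if k ∈ u.black then 0 else (-1 : R) ^ u.countLeft k • (u.insert k).ket R

/-- The normally ordered product `:ψ_a ψ*_b: = ψ_a ψ*_b - ⟨vac|ψ_a ψ*_b|vac⟩`. -/
def normalOrdered (a b : ℤ) : Module.End R (Fock R) :=
  psi R a * psiStar R b - braVac R ((psi R a * psiStar R b) (Maya.vac.ket R)) • 1

variable {R} in
/-- The sum of a family of operators which is locally finite, i.e. for which every basis vector is
killed by all but finitely many members of the family. -/
def locSum {ι : Type} (A : ι → Module.End R (Fock R)) : Module.End R (Fock R) :=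
  Finsupp.linearCombination R fun u : Maya => ∑ᶠ i, A i (u.ket R)

/-- `H_n = ∑_{j ∈ ℤ + 1/2} :ψ_{-j} ψ*_{j+n}:`. It is used only for `n ≥ 1`. -/
def H (n : ℤ) : Module.End R (Fock R) :=
  locSum fun j : ℤ => normalOrdered R (-1 - j) (j + n)

variable {R} in
/-- The exponential `∑_k A^k / k!` of a locally nilpotent operator `A`. -/
def locExp [Algebra ℂ R] (A : Module.End R (Fock R)) : Module.End R (Fock R) :=
  locSum fun k : ℕ => ((Nat.factorial k : ℂ)⁻¹) • A ^ k

end Operators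

/-! ### The operators `L^⊥_π` on Fock space -/

/-- `P_(n)(x)`, defined by `exp(∑_{m ≥ 1} x_m k^m) = ∑_n P_(n) k^n`. -/
def completeP (n : ℕ) : MvPolynomial ℕ+ ℂ :=
  PowerSeries.coeff n <|
    (PowerSeries.exp ℂ).subst
      (PowerSeries.mk fun m : ℕ =>
        if h : 0 < m then (MvPolynomial.X ⟨m, h⟩ : MvPolynomial ℕ+ ℂ) else 0)

/-- `P_(i)(x)` for `i ∈ ℤ`, with `P_(i) = 0` for `i < 0`. -/
def completePInt (i : ℤ) : MvPolynomial ℕ+ ℂ := if i < 0 then 0 else completeP i.toNat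

/-- `P_lam(x) = det (P_(lam_i - i + j))_{1 ≤ i, j ≤ l}`, with `l` the number of rows of `lam`. -/
def polyP (lam : YoungDiagram) : MvPolynomial ℕ+ ℂ :=
  Matrix.det (Matrix.of fun i j : Fin (lam.colLen 0) =>
    completePInt ((lam.rowLen i : ℤ) - (i : ℤ) + (j : ℤ)))

section Operators

variable (R : Type) [CommRing R] [Algebra ℂ R]

/-- `P(H_n)`: the operator obtained from the polynomial `P(x)` by replacing each `x_i` with
`(1/i) H_{in}`. (In each monomial the factors are multiplied in increasing order of `i`; the
operators `H_m` with `m > 0` commute.) -/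
def evalH (P : MvPolynomial ℕ+ ℂ) (n : ℕ+) : Module.End R (Fock R) :=
  ∑ d ∈ P.support, P.coeff d •
    ((d.support.sort (· ≤ ·)).map fun i : ℕ+ =>
      (((i : ℕ) : ℂ)⁻¹ • H R ((i * n : ℕ+) : ℕ)) ^ d i).prod

open Classical in
/-- `L^⊥_π = exp(-∑_{n ≥ 1} (1/n) P_π(H_n))`, with the convention `L^⊥_∅ = 1`. -/
def lPerpOp (π : YoungDiagram) : Module.End R (Fock R) :=
  if π = ⊥ then 1
  else locExp (-locSum fun n : ℕ+ => ((n : ℕ) : ℂ)⁻¹ • evalH R (polyP π) n)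

end Operators

/-- `H(x) = ∑_{n ≥ 1} x_n H_n`, acting on the Fock space with coefficients in `ℂ[x₁, x₂, …]`. -/
def Hx : Module.End (MvPolynomial ℕ+ ℂ) (Fock (MvPolynomial ℕ+ ℂ)) :=
  locSum fun n : ℕ+ => (MvPolynomial.X n : MvPolynomial ℕ+ ℂ) • H (MvPolynomial ℕ+ ℂ) (n : ℕ)

/-- The vector `|lam⟩`: the Maya diagram of `lam`, normalised by the sign `(-1)^|lam|` so that it
corresponds to the Schur function `S_lam` (and not to `-S_lam`) under the Boson-Fermion
correspondence. By `ketYoung_eq_frobenius` below this is the usual normalisation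
`(-1)^(∑ (m_i + 1/2) + l (l - 1) / 2) ψ_{n_1} ⋯ ψ_{n_l} ψ*_{m_1} ⋯ ψ*_{m_l} |vac⟩`. -/
def ketYoung (R : Type) [CommRing R] (lam : YoungDiagram) : Fock R :=
  (-1 : R) ^ lam.card • (Maya.ofYoung lam).ket R

section Frobenius

variable (R : Type) [CommRing R]

theorem psiStar_ket (k : ℤ) (u : Maya) (h : k ∉ u.black) :
    psiStar R k (u.ket R) = (-1 : R) ^ u.countLeft k • (u.insert k).ket R := by
  simp [psiStar, Maya.ket, h]

theorem psi_ket (k : ℤ) (u : Maya) (h : -1 - k ∈ u.black) :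
    psi R k (u.ket R) =
      (-1 : R) ^ u.countLeft (-1 - k) • (u.erase (-1 - k)).ket R := by
  simp [psi, Maya.ket, h]

variable (lam : YoungDiagram) (l : ℕ)

theorem prod_psiStar (hl : ∀ i, (i, i) ∈ lam ↔ i < l) : ∀ t r : ℕ, r + t = l →
    ∃ u : Maya, (∀ k, k ∈ u.black ↔
        (0 ≤ k ∨ ∃ i : ℕ, r ≤ i ∧ i < l ∧ k = (i : ℤ) - lam.colLen i)) ∧
      ((List.range' r t).map fun i : ℕ => psiStar R ((i : ℤ) - lam.colLen i)).prod
        (Maya.vac.ket R) = u.ket R := by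
  intro t
  induction t with
  | zero =>
    intro r hr
    refine ⟨Maya.vac, fun k => ?_, by simp⟩
    constructor
    · exact fun h => Or.inl h
    · rintro (h | ⟨i, h1, h2, _⟩)
      · exact h
      · omega
  | succ t ih =>
    intro r hr
    obtain ⟨u, hu, hprod⟩ := ih (r + 1) (by omega)
    have hcr : r < lam.colLen r := YoungDiagram.mem_iff_lt_colLen.mp ((hl r).mpr (by omega))
    have hmin : ∀ k ∈ u.black, (r : ℤ) - lam.colLen r < k := by
      intro k hk
      rcases (hu k).mp hk with h | ⟨i, h1, h2, h3⟩
      · omega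
      · have := lam.colLen_anti r i (by omega)
        omega
    have hn : (r : ℤ) - lam.colLen r ∉ u.black := fun h => lt_irrefl _ (hmin _ h)
    have hc : u.countLeft ((r : ℤ) - lam.colLen r) = 0 := by
      have : {k | k ∈ u.black ∧ k < (r : ℤ) - lam.colLen r} = ∅ := by
        ext k
        simp only [Set.mem_ofPred_eq, Set.mem_empty_iff_false, iff_false, not_and, not_lt]
        exact fun hk => (hmin k hk).le
      rw [Maya.countLeft, this, Set.ncard_empty]
    refine ⟨u.insert ((r : ℤ) - lam.colLen r), fun k => ?_, ?_⟩
    · change (k ∈ u.black ∨ k = _) ↔ _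
      rw [hu]
      constructor
      · rintro ((h | ⟨i, h1, h2, h3⟩) | h)
        · exact Or.inl h
        · exact Or.inr ⟨i, by omega, h2, h3⟩
        · exact Or.inr ⟨r, le_rfl, by omega, h⟩
      · rintro (h | ⟨i, h1, h2, h3⟩)
        · exact Or.inl (Or.inl h)
        · rcases Nat.eq_or_lt_of_le h1 with rfl | h4
          · exact Or.inr h3
          · exact Or.inl (Or.inr ⟨i, h4, h2, h3⟩)
    · rw [List.range'_succ, List.map_cons, List.prod_cons, Module.End.mul_apply, hprod,
        psiStar_ket R _ _ hn, hc, pow_zero, one_smul]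

theorem prod_psi (hl : ∀ i, (i, i) ∈ lam ↔ i < l) (u0 : Maya)
    (hu0 : ∀ k, k ∈ u0.black ↔ (0 ≤ k ∨ ∃ i : ℕ, 0 ≤ i ∧ i < l ∧ k = (i : ℤ) - lam.colLen i)) :
    ∀ t r : ℕ, r + t = l →
    ∃ u : Maya, (∀ k, k ∈ u.black ↔
        ((0 ≤ k ∧ ∀ i : ℕ, r ≤ i → i < l → k ≠ (lam.rowLen i : ℤ) - i - 1) ∨
          ∃ i : ℕ, i < l ∧ k = (i : ℤ) - lam.colLen i)) ∧
      ((List.range' r t).map fun i : ℕ => psi R ((i : ℤ) - lam.rowLen i)).prod (u0.ket R) =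
        (-1 : R) ^ (∑ i ∈ Finset.Ico r l, lam.rowLen i) • u.ket R := by
  have hrow : ∀ i < l, i < lam.rowLen i := fun i hi =>
    YoungDiagram.mem_iff_lt_rowLen.mp ((hl i).mpr hi)
  have hcol : ∀ i < l, i < lam.colLen i := fun i hi =>
    YoungDiagram.mem_iff_lt_colLen.mp ((hl i).mpr hi)
  intro t
  induction t with
  | zero =>
    intro r hr
    refine ⟨u0, fun k => ?_, by simp [show r = l by omega]⟩
    rw [hu0]
    constructor
    · rintro (h | ⟨i, _, h2, h3⟩)
      · exact Or.inl ⟨h, fun i h1 h2 => by omega⟩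
      · exact Or.inr ⟨i, h2, h3⟩
    · rintro (h | ⟨i, h2, h3⟩)
      · exact Or.inl h.1
      · exact Or.inr ⟨i, Nat.zero_le i, h2, h3⟩
  | succ t ih =>
    intro r hr
    obtain ⟨u, hu, hprod⟩ := ih (r + 1) (by omega)
    have hrl : r < l := by omega
    have hr1 := hrow r hrl
    have hp : -1 - ((r : ℤ) - lam.rowLen r) = (lam.rowLen r : ℤ) - r - 1 := by ring
    have hanti : ∀ i j : ℕ, i < j → j < l →
        (lam.rowLen j : ℤ) - j - 1 < (lam.rowLen i : ℤ) - i - 1 := by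
      intro i j hij _
      have := lam.rowLen_anti i j hij.le
      omega
    have hmem : (lam.rowLen r : ℤ) - r - 1 ∈ u.black := by
      refine (hu _).mpr (Or.inl ⟨by omega, fun i h1 h2 h3 => ?_⟩)
      have := hanti r i (by omega) h2
      omega
    have hcount : u.countLeft ((lam.rowLen r : ℤ) - r - 1) = lam.rowLen r := by
      let a : ℕ → ℤ := fun i => (lam.rowLen i : ℤ) - i - 1
      let m : ℕ → ℤ := fun i => (i : ℤ) - lam.colLen i
      let A : Finset ℤ := (Finset.range l).image m
      let C : Finset ℤ := (Finset.Ico (r + 1) l).image a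
      have hA : A.card = l := by
        rw [Finset.card_image_of_injOn, Finset.card_range]
        intro i _ j _ hij
        simp only [m] at hij
        rcases lt_trichotomy i j with h | h | h
        · have := lam.colLen_anti i j h.le
          omega
        · exact h
        · have := lam.colLen_anti j i h.le
          omega
      have hC : C.card = l - (r + 1) := by
        rw [Finset.card_image_of_injOn, Nat.card_Ico]
        intro i hi j hj hij
        simp only [Finset.coe_Ico, Set.mem_Ico] at hi hj
        rcases lt_trichotomy i j with h | h | h
        · have := hanti i j h hj.2
          simp only [a] at hij
          omega
        · exact h
        · have := hanti j i h hi.2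
          simp only [a] at hij
          omega
      have hCsub : C ⊆ Finset.Ico 0 (a r) := by
        intro k hk
        obtain ⟨i, hi, rfl⟩ := Finset.mem_image.mp hk
        rw [Finset.mem_Ico] at hi ⊢
        have h1 := hanti r i (by omega) hi.2
        have h2 := hrow i hi.2
        exact ⟨by simp only [a]; omega, h1⟩
      have hdisj : Disjoint A (Finset.Ico 0 (a r) \ C) := by
        rw [Finset.disjoint_left]
        intro k hk hk'
        obtain ⟨i, hi, rfl⟩ := Finset.mem_image.mp hk
        have h1 := hcol i (Finset.mem_range.mp hi)
        have h2 := (Finset.mem_Ico.mp (Finset.mem_sdiff.mp hk').1).1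
        simp only [m] at h2
        omega
      have hset : {k | k ∈ u.black ∧ k < (lam.rowLen r : ℤ) - r - 1} =
          ((A ∪ (Finset.Ico 0 (a r) \ C) : Finset ℤ) : Set ℤ) := by
        ext k
        rw [Set.mem_ofPred_eq, hu, Finset.mem_coe, Finset.mem_union, Finset.mem_sdiff,
          Finset.mem_Ico, Finset.mem_image, Finset.mem_image]
        constructor
        · rintro ⟨⟨h1, h2⟩ | ⟨i, h1, h2⟩, h3⟩
          · refine Or.inr ⟨⟨h1, h3⟩, ?_⟩
            rintro ⟨i, hi, rfl⟩
            rw [Finset.mem_Ico] at hi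
            exact h2 i hi.1 hi.2 rfl
          · exact Or.inl ⟨i, Finset.mem_range.mpr h1, h2.symm⟩
        · rintro (⟨i, hi, rfl⟩ | ⟨⟨h1, h2⟩, h3⟩)
          · have h1 := hcol i (Finset.mem_range.mp hi)
            refine ⟨Or.inr ⟨i, Finset.mem_range.mp hi, rfl⟩, ?_⟩
            simp only [m]
            omega
          · refine ⟨Or.inl ⟨h1, fun i hi1 hi2 h => h3 ⟨i, ?_, h.symm⟩⟩, h2⟩
            exact Finset.mem_Ico.mpr ⟨hi1, hi2⟩
      have hle := Finset.card_le_card hCsub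
      rw [Maya.countLeft, hset, Set.ncard_coe_finset, Finset.card_union_of_disjoint hdisj,
        Finset.card_sdiff_of_subset hCsub, hA, hC]
      rw [hC] at hle
      simp only [Int.card_Ico, a] at hle ⊢
      omega
    refine ⟨u.erase ((lam.rowLen r : ℤ) - r - 1), fun k => ?_, ?_⟩
    · change (k ∈ u.black ∧ ¬ k = _) ↔ _
      rw [hu]
      constructor
      · rintro ⟨⟨h1, h2⟩ | ⟨i, h1, h2⟩, h3⟩
        · refine Or.inl ⟨h1, fun i hi1 hi2 => ?_⟩
          rcases Nat.eq_or_lt_of_le hi1 with rfl | h4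
          · exact h3
          · exact h2 i h4 hi2
        · exact Or.inr ⟨i, h1, h2⟩
      · rintro (⟨h1, h2⟩ | ⟨i, h1, h2⟩)
        · exact ⟨Or.inl ⟨h1, fun i hi1 hi2 => h2 i (by omega) hi2⟩, h2 r le_rfl hrl⟩
        · have := hcol i h1
          exact ⟨Or.inr ⟨i, h1, h2⟩, by omega⟩
    · rw [List.range'_succ, List.map_cons, List.prod_cons, Module.End.mul_apply, hprod, map_smul,
        psi_ket R _ _ (by rw [hp]; exact hmem), hp, hcount, smul_smul, ← pow_add,
        ← Finset.add_sum_Ioo_eq_sum_Ico hrl, add_comm]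
      congr 3

theorem black_ofYoung (hl : ∀ i, (i, i) ∈ lam ↔ i < l) (k : ℤ) :
    k ∈ (Maya.ofYoung lam).black ↔
      ((0 ≤ k ∧ ∀ i : ℕ, 0 ≤ i → i < l → k ≠ (lam.rowLen i : ℤ) - i - 1) ∨
        ∃ i : ℕ, i < l ∧ k = (i : ℤ) - lam.colLen i) := by
  have hmem : ∀ i j : ℕ, j < lam.rowLen i ↔ i < lam.colLen j := fun i j => by
    rw [← YoungDiagram.mem_iff_lt_rowLen, ← YoungDiagram.mem_iff_lt_colLen]
  have hd : ∀ i, i < lam.colLen i ↔ i < l := fun i => by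
    rw [← YoungDiagram.mem_iff_lt_colLen, hl]
  constructor
  · rintro ⟨j, rfl⟩
    by_cases hj : j < l
    · exact Or.inr ⟨j, hj, rfl⟩
    · have h1 := (hd j).not.mpr hj
      refine Or.inl ⟨by simp only; omega, fun i _ hi h => ?_⟩
      have h2 := hmem i j
      simp only at h
      omega
  · rintro (⟨h0, h1⟩ | ⟨i, h1, rfl⟩)
    · have hex : ∃ j : ℕ, k ≤ (j : ℤ) - lam.colLen j := by
        refine ⟨k.toNat + lam.colLen 0, ?_⟩
        have := lam.colLen_anti 0 (k.toNat + lam.colLen 0) (Nat.zero_le _)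
        push_cast
        omega
      classical
      have hj := Nat.find_spec hex
      have hj' := fun i => Nat.find_min hex (m := i)
      set j := Nat.find hex
      refine ⟨j, ?_⟩
      by_contra hne
      simp only at hne
      have hgt : k < (j : ℤ) - lam.colLen j := by omega
      have hjpos : 0 < j := by omega
      have hprev := hj' (j - 1) (by omega)
      have h2 := hmem (j - 1 - k.toNat) j
      have h3 := hmem (j - 1 - k.toNat) (j - 1)
      have h4 : lam.rowLen (j - 1 - k.toNat) = j := by omega
      refine h1 (j - 1 - k.toNat) (Nat.zero_le _) ?_ ?_
      · rw [← hl, YoungDiagram.mem_iff_lt_rowLen, h4]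
        omega
      · rw [h4]
        omega
    · exact ⟨i, rfl⟩

theorem card_eq_sum_hooks (hl : ∀ i, (i, i) ∈ lam ↔ i < l) :
    lam.card = ∑ i ∈ Finset.range l, ((lam.rowLen i - i - 1) + (lam.colLen i - i - 1) + 1) := by
  have hrow : ∀ i < l, i < lam.rowLen i := fun i hi =>
    YoungDiagram.mem_iff_lt_rowLen.mp ((hl i).mpr hi)
  have hcol : ∀ i < l, i < lam.colLen i := fun i hi =>
    YoungDiagram.mem_iff_lt_colLen.mp ((hl i).mpr hi)
  unfold YoungDiagram.card
  rw [Finset.card_eq_sum_card_fiberwise (f := fun c => min c.1 c.2) (t := Finset.range l)]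
  · refine Finset.sum_congr rfl fun r hr => ?_
    rw [Finset.mem_range] at hr
    have e : (lam.cells.filter fun c => min c.1 c.2 = r) =
        (Finset.Ico r (lam.rowLen r)).image (fun j => (r, j)) ∪
          (Finset.Ico (r + 1) (lam.colLen r)).image (fun i => (i, r)) := by
      ext ⟨i, j⟩
      simp only [Finset.mem_filter, YoungDiagram.mem_cells, Finset.mem_union, Finset.mem_image,
        Finset.mem_Ico, Prod.mk.injEq]
      constructor
      · rintro ⟨h1, h2⟩
        by_cases hij : i ≤ j
        · have hi : i = r := by omega
          subst hi
          exact Or.inl ⟨j, ⟨hij, YoungDiagram.mem_iff_lt_rowLen.mp h1⟩, rfl, rfl⟩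
        · have hj : j = r := by omega
          subst hj
          exact Or.inr ⟨i, ⟨by omega, YoungDiagram.mem_iff_lt_colLen.mp h1⟩, rfl, rfl⟩
      · rintro (⟨j', h, rfl, rfl⟩ | ⟨i', h, rfl, rfl⟩)
        · exact ⟨YoungDiagram.mem_iff_lt_rowLen.mpr h.2, by omega⟩
        · exact ⟨YoungDiagram.mem_iff_lt_colLen.mpr h.2, by omega⟩
    rw [e, Finset.card_union_of_disjoint, Finset.card_image_of_injective,
      Finset.card_image_of_injective, Nat.card_Ico, Nat.card_Ico]
    · have := hrow r hr
      have := hcol r hr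
      omega
    · intro a b h
      simpa using h
    · intro a b h
      simpa using h
    · rw [Finset.disjoint_left]
      intro c h1 h2
      simp only [Finset.mem_image, Finset.mem_Ico] at h1 h2
      obtain ⟨j, _, rfl⟩ := h1
      obtain ⟨i, hi, h⟩ := h2
      simp only [Prod.mk.injEq] at h
      omega
  · rintro ⟨i, j⟩ hc
    simp only [Finset.mem_coe, YoungDiagram.mem_cells] at hc
    simp only [Finset.coe_range, Set.mem_Iio]
    exact (hl _).mp (lam.up_left_mem (min_le_left i j) (min_le_right i j) hc)

/-- Let `l` be the number of diagonal boxes of `lam`, and let `n_1 < ⋯ < n_l < 0`,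
`m_1 < ⋯ < m_l < 0` be the half-integers with
`lam = (-n_1 - 1/2, …, -n_l - 1/2 | -m_1 - 1/2, …, -m_l - 1/2)` in Frobenius notation. Then
`|lam⟩ = (-1)^(∑ (m_i + 1/2) + l (l - 1) / 2) ψ_{n_1} ⋯ ψ_{n_l} ψ*_{m_1} ⋯ ψ*_{m_l} |vac⟩`. -/
theorem ketYoung_eq_frobenius (hl : ∀ i, (i, i) ∈ lam ↔ i < l) :
    ketYoung R lam =
      (-1 : R) ^ (∑ i ∈ Finset.range l, (lam.colLen i - i - 1) + l * (l - 1) / 2) •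
        ((((List.range l).map fun i : ℕ => psi R ((i : ℤ) - lam.rowLen i)).prod *
          ((List.range l).map fun i : ℕ => psiStar R ((i : ℤ) - lam.colLen i)).prod)
          (Maya.vac.ket R)) := by
  obtain ⟨u, hu, h1⟩ := prod_psiStar R lam l hl l 0 (by omega)
  obtain ⟨v, hv, h2⟩ := prod_psi R lam l hl u hu l 0 (by omega)
  have hvl : v = Maya.ofYoung lam := by
    ext k
    rw [hv, black_ofYoung lam l hl]
  rw [Module.End.mul_apply, List.range_eq_range', h1, h2, hvl, smul_smul, ← pow_add, ketYoung]
  congr 1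
  have hrow : ∀ i < l, i < lam.rowLen i := fun i hi =>
    YoungDiagram.mem_iff_lt_rowLen.mp ((hl i).mpr hi)
  rw [card_eq_sum_hooks lam l hl, ← Finset.sum_range_id, Finset.range_eq_Ico,
    ← Finset.sum_add_distrib, ← Finset.sum_add_distrib]
  rw [← Finset.prod_pow_eq_pow_sum, ← Finset.prod_pow_eq_pow_sum]
  refine Finset.prod_congr rfl fun i hi => ?_
  have := hrow i (Finset.mem_Ico.mp hi).2
  have e : lam.colLen i - i - 1 + i + lam.rowLen i =
      (lam.rowLen i - i - 1 + (lam.colLen i - i - 1) + 1) + 2 * i := by omega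
  rw [e, pow_add _ _ (2 * i), pow_mul, neg_one_sq, one_pow, mul_one]

end Frobenius

/-- The matrix element `⟨vac| e^{H(x)} L^⊥_π |lam⟩ ∈ ℂ[x₁, x₂, …]`. -/
def matrixElement (π lam : YoungDiagram) : MvPolynomial ℕ+ ℂ :=
  braVac (MvPolynomial ℕ+ ℂ)
    (locExp Hx (lPerpOp (MvPolynomial ℕ+ ℂ) π (ketYoung (MvPolynomial ℕ+ ℂ) lam)))

/-! ### Symmetric functions -/

/-- The exponent of the monomial `x^T`: for each `k` the number of entries `k` of `T`. -/
def content {mu : YoungDiagram} (T : SemistandardYoungTableau mu) : ℕ →₀ ℕ :=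
  ∑ c ∈ mu.cells, Finsupp.single (T c.1 c.2) 1

/-- The Schur function `S_mu = ∑_T x^T`, the sum over all semistandard tableaux of shape `mu`. -/
def schur (mu : YoungDiagram) : MvPowerSeries ℕ ℂ :=
  fun d => (Nat.card {T : SemistandardYoungTableau mu // content T = d} : ℂ)

open Classical in
/-- The power sum `p_n = ∑_k x_k^n`, for `n ≥ 1`. -/
def powerSum (n : ℕ+) : MvPowerSeries ℕ ℂ :=
  fun d => if ∃ k : ℕ, d = Finsupp.single k (n : ℕ) then 1 else 0

/-- `G = ∑_mu c_mu S_mu`, coefficient by coefficient. (Only the finitely many diagrams `mu` with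
`|mu|` equal to the degree of `d` contribute to the coefficient of `x^d`.) -/
def IsSchurExpansion (G : MvPowerSeries ℕ ℂ) (c : YoungDiagram → ℂ) : Prop :=
  ∀ d : ℕ →₀ ℕ, MvPowerSeries.coeff d G = ∑ᶠ mu, c mu * MvPowerSeries.coeff d (schur mu)

theorem degree_content {mu : YoungDiagram} (T : SemistandardYoungTableau mu) :
    (content T).degree = mu.card := by
  unfold content
  rw [map_sum]
  simp [Finsupp.degree_single, YoungDiagram.card]

theorem le_entry {mu : YoungDiagram} (T : SemistandardYoungTableau mu) {i j : ℕ}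
    (h : (i, j) ∈ mu) : i ≤ T i j := by
  induction i with
  | zero => exact Nat.zero_le _
  | succ i ih =>
    have h1 : (i, j) ∈ mu := mu.up_left_mem (Nat.le_succ i) le_rfl h
    have h2 : T i j < T (i + 1) j := T.col_strict (Nat.lt_succ_self i) h
    have := ih h1
    omega

theorem content_apply {mu : YoungDiagram} (T : SemistandardYoungTableau mu) (k : ℕ) :
    content T k = (mu.cells.filter fun c => T c.1 c.2 = k).card := by
  unfold content
  rw [Finsupp.finsetSum_apply, Finset.card_filter]
  refine Finset.sum_congr rfl fun c _ => ?_
  rw [Finsupp.single_apply]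

theorem finite_young (n : ℕ) : {mu : YoungDiagram | mu.card = n}.Finite := by
  have hinj : Function.Injective (fun mu : YoungDiagram => mu.cells) := fun a b h =>
    YoungDiagram.ext h
  refine Set.Finite.of_finite_image (f := fun mu : YoungDiagram => mu.cells) ?_ hinj.injOn
  refine (Finset.finite_toSet (Finset.range n ×ˢ Finset.range n).powerset).subset ?_
  rintro _ ⟨mu, hmu, rfl⟩
  simp only [Finset.coe_powerset, Set.mem_preimage, Set.mem_powerset_iff, Finset.coe_subset]
  rintro ⟨i, j⟩ hc
  simp only [Set.mem_ofPred_eq] at hmu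
  have hrow : j < mu.rowLen i := YoungDiagram.mem_iff_lt_rowLen.mp hc
  have hcol : i < mu.colLen j := YoungDiagram.mem_iff_lt_colLen.mp hc
  have h1 : mu.rowLen i ≤ mu.card := by
    rw [YoungDiagram.rowLen_eq_card]
    exact Finset.card_le_card (Finset.filter_subset _ _)
  have h2 : mu.colLen j ≤ mu.card := by
    rw [YoungDiagram.colLen_eq_card]
    exact Finset.card_le_card (Finset.filter_subset _ _)
  simp only [Finset.mem_product, Finset.mem_range]
  omega

theorem finite_tableaux (mu : YoungDiagram) (d : ℕ →₀ ℕ) :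
    Finite {T : SemistandardYoungTableau mu // content T = d} := by
  let f : {T : SemistandardYoungTableau mu // content T = d} → (mu.cells → d.support) :=
    fun T c => ⟨T.1 c.1.1 c.1.2, by
      refine (Finset.ext_iff.mp (congrArg Finsupp.support T.2) _).mp ?_
      rw [Finsupp.mem_support_iff, content_apply]
      exact (Finset.card_pos.mpr ⟨c.1, by simp⟩).ne'⟩
  refine Finite.of_injective f fun T T' h => Subtype.ext ?_
  ext i j
  by_cases hc : (i, j) ∈ mu
  · have := congrArg Subtype.val (congrFun h ⟨(i, j), (YoungDiagram.mem_cells _).mpr hc⟩)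
    simpa [f] using this
  · rw [T.1.zeros hc, T'.1.zeros hc]

theorem coeff_schur (mu : YoungDiagram) (d : ℕ →₀ ℕ) : MvPowerSeries.coeff d (schur mu) =
    (Nat.card {T : SemistandardYoungTableau mu // content T = d} : ℂ) := rfl

theorem exists_of_coeff_schur_ne_zero {mu : YoungDiagram} {d : ℕ →₀ ℕ}
    (h : MvPowerSeries.coeff d (schur mu) ≠ 0) :
    ∃ T : SemistandardYoungTableau mu, content T = d := by
  by_contra hne
  push Not at hne
  refine h ?_
  rw [coeff_schur]
  have : IsEmpty {T : SemistandardYoungTableau mu // content T = d} := ⟨fun T => hne T.1 T.2⟩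
  simp

/-- The number of boxes in the first `k` rows. -/
def topBoxes (mu : YoungDiagram) (k : ℕ) : ℕ := (mu.cells.filter fun c => c.1 < k).card

theorem topBoxes_succ (mu : YoungDiagram) (k : ℕ) :
    topBoxes mu (k + 1) = topBoxes mu k + mu.rowLen k := by
  unfold topBoxes
  rw [YoungDiagram.rowLen_eq_card, ← Finset.card_union_of_disjoint]
  · congr 1
    ext c
    simp only [Finset.mem_filter, Finset.mem_union, YoungDiagram.row]
    constructor
    · rintro ⟨h, h'⟩
      rcases Nat.lt_succ_iff_lt_or_eq.mp h' with h1 | h1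
      · exact Or.inl ⟨h, h1⟩
      · exact Or.inr ⟨h, h1⟩
    · rintro (⟨h, h'⟩ | ⟨h, h'⟩)
      · exact ⟨h, by omega⟩
      · exact ⟨h, by omega⟩
  · rw [Finset.disjoint_left]
    intro c h1 h2
    simp only [Finset.mem_filter, YoungDiagram.row] at h1 h2
    omega

theorem eq_of_topBoxes {mu nu : YoungDiagram} (h : ∀ k, topBoxes mu k = topBoxes nu k) :
    mu = nu := by
  ext ⟨i, j⟩
  have h1 := topBoxes_succ mu i
  have h2 := topBoxes_succ nu i
  rw [h, h] at h1
  rw [YoungDiagram.mem_cells, YoungDiagram.mem_cells, YoungDiagram.mem_iff_lt_rowLen,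
    YoungDiagram.mem_iff_lt_rowLen]
  omega

theorem topBoxes_le_of_content {mu nu : YoungDiagram} (T : SemistandardYoungTableau nu)
    (h : content T = content (SemistandardYoungTableau.highestWeight mu)) (k : ℕ) :
    topBoxes mu k ≤ topBoxes nu k := by
  have key : ∀ {la : YoungDiagram} (T : SemistandardYoungTableau la),
      ∑ i ∈ Finset.range k, content T i = (la.cells.filter fun c => T c.1 c.2 < k).card := by
    intro la T
    rw [Finset.card_eq_sum_card_fiberwise (f := fun c => T c.1 c.2) (t := Finset.range k)]
    · refine Finset.sum_congr rfl fun i hi => ?_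
      rw [content_apply, Finset.filter_filter]
      congr 1
      ext c
      simp only [Finset.mem_filter, Finset.mem_range] at hi ⊢
      constructor
      · rintro ⟨a, b⟩
        exact ⟨a, by omega, b⟩
      · rintro ⟨a, _, b⟩
        exact ⟨a, b⟩
    · intro c hc
      simp only [Finset.coe_filter, Set.mem_ofPred_eq] at hc
      simpa using hc.2
  have e1 := key T
  have e2 := key (SemistandardYoungTableau.highestWeight mu)
  rw [h, e2] at e1
  have e3 : topBoxes mu k =
      (mu.cells.filter fun c => SemistandardYoungTableau.highestWeight mu c.1 c.2 < k).card := by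
    unfold topBoxes
    congr 1
    refine Finset.filter_congr fun c hc => ?_
    rw [SemistandardYoungTableau.highestWeight_apply, if_pos ((YoungDiagram.mem_cells _).mp hc)]
  rw [e3, e1]
  unfold topBoxes
  refine Finset.card_le_card fun c hc => ?_
  simp only [Finset.mem_filter] at hc ⊢
  exact ⟨hc.1, lt_of_le_of_lt (le_entry T ((YoungDiagram.mem_cells _).mp hc.1)) hc.2⟩

/-- The Schur functions are linearly independent: the coefficients of a Schur expansion are
unique, so that `schurCoeff` is well defined. -/
theorem IsSchurExpansion.unique {G : MvPowerSeries ℕ ℂ} {c c' : YoungDiagram → ℂ}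
    (h : IsSchurExpansion G c) (h' : IsSchurExpansion G c') : c = c' := by
  have hcard : ∀ {d : ℕ →₀ ℕ} {mu : YoungDiagram},
      MvPowerSeries.coeff d (schur mu) ≠ 0 → mu.card = d.degree := by
    intro d mu hmu
    obtain ⟨T, rfl⟩ := exists_of_coeff_schur_ne_zero hmu
    exact (degree_content T).symm
  have hfin : ∀ (b : YoungDiagram → ℂ) (d : ℕ →₀ ℕ),
      (Function.support fun mu => b mu * MvPowerSeries.coeff d (schur mu)).Finite := by
    intro b d
    refine (finite_young d.degree).subset fun mu hmu => ?_
    exact hcard (right_ne_zero_of_mul hmu)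
  have hsub : ∀ d : ℕ →₀ ℕ,
      ∑ᶠ mu, (c mu - c' mu) * MvPowerSeries.coeff d (schur mu) = 0 := by
    intro d
    simp only [sub_mul]
    rw [finsum_sub_distrib (hfin c d) (hfin c' d), ← h d, ← h' d, sub_self]
  have main : ∀ n s : ℕ, ∀ mu : YoungDiagram, mu.card = n →
      ∑ k ∈ Finset.range (n + 1), (n - topBoxes mu k) = s → c mu - c' mu = 0 := by
    intro n s
    induction s using Nat.strong_induction_on with
    | _ s ih =>
      intro mu hmu hs
      have h0 := hsub (content (SemistandardYoungTableau.highestWeight mu))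
      rw [finsum_eq_single _ mu] at h0
      · rcases mul_eq_zero.mp h0 with h1 | h1
        · exact h1
        · exfalso
          rw [coeff_schur, Nat.cast_eq_zero] at h1
          have := finite_tableaux mu (content (SemistandardYoungTableau.highestWeight mu))
          have hne : Nonempty {T : SemistandardYoungTableau mu //
              content T = content (SemistandardYoungTableau.highestWeight mu)} := ⟨⟨_, rfl⟩⟩
          exact (Nat.card_pos).ne' h1
      · intro nu hnu
        by_cases hz : MvPowerSeries.coeff
            (content (SemistandardYoungTableau.highestWeight mu)) (schur nu) = 0
        · rw [hz, mul_zero]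
        · have hnc : nu.card = n := by rw [hcard hz, degree_content, hmu]
          obtain ⟨T, hT⟩ := exists_of_coeff_schur_ne_zero hz
          have hle := topBoxes_le_of_content T hT
          have htop : ∀ (la : YoungDiagram) (k : ℕ), topBoxes la k ≤ la.card := fun la k =>
            Finset.card_le_card (Finset.filter_subset _ _)
          have hbig : ∀ (la : YoungDiagram) (k : ℕ), la.card ≤ k → topBoxes la k = la.card := by
            intro la k hk
            unfold topBoxes YoungDiagram.card
            congr 1
            refine Finset.filter_true_of_mem fun x hx => ?_
            have hcol : x.1 < la.colLen x.2 :=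
              YoungDiagram.mem_iff_lt_colLen.mp ((YoungDiagram.mem_cells _).mp hx)
            have h2 : la.colLen x.2 ≤ la.card := by
              rw [YoungDiagram.colLen_eq_card]
              exact Finset.card_le_card (Finset.filter_subset _ _)
            omega
          have hlt : ∃ k ∈ Finset.range (n + 1), topBoxes mu k < topBoxes nu k := by
            by_contra hcon
            push Not at hcon
            refine hnu (eq_of_topBoxes fun k => ?_)
            by_cases hk : k < n + 1
            · exact le_antisymm (hcon k (Finset.mem_range.mpr hk)) (hle k)
            · rw [hbig nu k (by omega), hbig mu k (by omega), hnc, hmu]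
          have hsum : ∑ k ∈ Finset.range (n + 1), (n - topBoxes nu k) < s := by
            rw [← hs]
            refine Finset.sum_lt_sum (fun k _ => Nat.sub_le_sub_left (hle k) n) ?_
            obtain ⟨k, hk, hk'⟩ := hlt
            have := htop nu k
            exact ⟨k, hk, by omega⟩
          rw [ih _ hsum nu hnc rfl, zero_mul]
  funext mu
  exact sub_eq_zero.mp (main mu.card _ mu rfl rfl)

open Classical in
/-- The coordinates of a symmetric function (or formal symmetric series) with respect to the basis
of Schur functions. -/
def schurCoeff (G : MvPowerSeries ℕ ℂ) : YoungDiagram → ℂ :=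
  if h : ∃ c, IsSchurExpansion G c then h.choose else 0

theorem schurCoeff_eq {G : MvPowerSeries ℕ ℂ} {c : YoungDiagram → ℂ} (h : IsSchurExpansion G c) :
    schurCoeff G = c := by
  have hex : ∃ c, IsSchurExpansion G c := ⟨c, h⟩
  rw [schurCoeff, dif_pos hex]
  exact hex.choose_spec.unique h

/-- The scalar product for which the Schur functions are orthonormal, as a pairing of symmetric
functions `f` with formal symmetric series `g`. -/
def hall (f g : MvPowerSeries ℕ ℂ) : ℂ := ∑ᶠ mu, schurCoeff f mu * schurCoeff g mu

/-- The skewing operator `g^⊥`, dual to multiplication by `g`: `⟨g^⊥ f, h⟩ = ⟨f, g h⟩`, that is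
`g^⊥ f = ∑_mu ⟨f, g S_mu⟩ S_mu`. -/
def skew (g f : MvPowerSeries ℕ ℂ) : MvPowerSeries ℕ ℂ :=
  fun d => ∑ᶠ mu, hall f (g * schur mu) * MvPowerSeries.coeff d (schur mu)

open Classical in
/-- `L_π = ∏_T (1 - x^T)`, the product over all semistandard tableaux `T` of shape `π`, in expanded
form: `∑_A (-1)^|A| ∏_{T ∈ A} x^T`, the sum over all finite sets `A` of such tableaux. By
convention `L_∅ = 1`. -/
def lSeries (π : YoungDiagram) : MvPowerSeries ℕ ℂ :=
  if π = ⊥ then 1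
  else fun d =>
    ∑ᶠ A : {A : Finset (SemistandardYoungTableau π) // ∑ T ∈ A, content T = d},
      (-1 : ℂ) ^ A.val.card

/-- The `π`-type symmetric function `S_lam^π = L_π^⊥ S_lam`. -/
def piSchur (π lam : YoungDiagram) : MvPowerSeries ℕ ℂ := skew (lSeries π) (schur lam)

/-- The identification of polynomials in `x₁, x₂, …` with symmetric functions, `x_n = p_n / n`. -/
def toSymm : MvPolynomial ℕ+ ℂ →ₐ[ℂ] MvPowerSeries ℕ ℂ :=
  MvPolynomial.aeval fun n : ℕ+ => ((n : ℕ) : ℂ)⁻¹ • powerSum n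

end PiSym

end

/-!
The map `v ↦ ⟨vac| e^{H(x)} v` is the Boson-Fermion correspondence. Three facts about it are needed.

* It maps `|lam⟩` to the Jacobi–Trudi determinant `P_lam` (`vev_ketYoung`). A family of polynomials
  indexed by Maya diagrams is `⟨vac| e^{H(x)} |u⟩` as soon as its derivative with respect to `x_n`
  is given by `H_n` and its constant terms are right (`eq_vev_of_pderiv`). Raising one index of a
  determinant by `n` and sorting the indices is the motion of a stone by `n`, with the sign that it
  has in `H_n`; hence both the determinant in the elementary symmetric functions (for the columns of
  `lam`) and the one in the complete symmetric functions (for the rows) satisfy this.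
* After the substitution `x_n = p_n / n` this determinant is the Schur function `S_lam`
  (`toSymm_polyP`): upon adding one variable to the alphabet, the column determinant and the set of
  semistandard tableaux both decompose according to the horizontal strips in `lam`.
* It turns `H_{-n}` into multiplication by `n x_n = p_n` (`vev_H_neg`), again by a computation with
  determinants.

The matrix of `H_{-n}` is the transpose of the matrix of `H_n` (`H_transpose`), so `H_n` is the
adjoint of multiplication by `p_n`, for the scalar product in which the `|lam⟩` are orthonormal
(`isSkew_H`). Being adjoint to multiplication by some symmetric function (`IsSkew`) is compatible
with sums and products. Therefore `P_π(H_n)` is adjoint to multiplication by the plethysm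
`S_π(x_1^n, x_2^n, …)`, and, since only finitely many terms matter in each degree, the operator
`L_π^⊥` is adjoint to multiplication by `exp(-∑_n (1/n) S_π(x_1^n, x_2^n, …))`. This series is
`L_π = ∏_T (1 - x^T)` (`expSeries_eq_lSeries`): both have constant term `1` and the same logarithmic
derivative `-|π| ∑_T x^T / (1 - x^T)` for the Euler derivation `x^d ↦ |d| x^d`, and the product can
be truncated to finitely many tableaux in each degree. So the matrix coefficients of `L_π^⊥` are
the scalar products `⟨S_lam, L_π S_mu⟩`, which define `L_π^⊥ S_lam`.
-/

noncomputable section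

namespace PiSym

open MvPolynomial

/-! ### Complete symmetric polynomials in the variables `x_m` -/

theorem completeP_eq (n : ℕ) : completeP n = PowerSeries.coeff n
    ((PowerSeries.exp (MvPolynomial ℕ+ ℂ)).subst
      (PowerSeries.mk fun m : ℕ =>
        if h : 0 < m then (X ⟨m, h⟩ : MvPolynomial ℕ+ ℂ) else 0)) := by
  have hs : PowerSeries.HasSubst (PowerSeries.mk fun m : ℕ =>
        if h : 0 < m then (X ⟨m, h⟩ : MvPolynomial ℕ+ ℂ) else 0) :=
    PowerSeries.HasSubst.of_constantCoeff_zero' (by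
      rw [← PowerSeries.coeff_zero_eq_constantCoeff_apply]; simp)
  rw [completeP, PowerSeries.coeff_subst' hs, PowerSeries.coeff_subst' hs]
  refine finsum_congr fun d => ?_
  rw [PowerSeries.coeff_exp, PowerSeries.coeff_exp, ← algebraMap_smul (MvPolynomial ℕ+ ℂ)]
  congr 1

theorem completeP_zero : completeP 0 = 1 := by
  have hc : PowerSeries.constantCoeff (PowerSeries.mk fun m : ℕ =>
        if h : 0 < m then (X ⟨m, h⟩ : MvPolynomial ℕ+ ℂ) else 0) = 0 := by
    rw [← PowerSeries.coeff_zero_eq_constantCoeff_apply]; simp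
  have hs := PowerSeries.HasSubst.of_constantCoeff_zero' hc
  rw [completeP_eq, PowerSeries.coeff_subst' hs, finsum_eq_single _ 0]
  · simp
  · intro d hd
    rw [PowerSeries.coeff_zero_eq_constantCoeff_apply, map_pow, hc, zero_pow hd, smul_zero]

/-- Newton's recursion, the logarithmic derivative of the generating function. -/
theorem completeP_succ (k : ℕ) : ((k : MvPolynomial ℕ+ ℂ) + 1) * completeP (k + 1) =
    ∑ m ∈ Finset.range (k + 1),
      ((m : MvPolynomial ℕ+ ℂ) + 1) * X m.succPNat * completeP (k - m) := by
  have hc : PowerSeries.constantCoeff (PowerSeries.mk fun m : ℕ =>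
        if h : 0 < m then (X ⟨m, h⟩ : MvPolynomial ℕ+ ℂ) else 0) = 0 := by
    rw [← PowerSeries.coeff_zero_eq_constantCoeff_apply]; simp
  have hs := PowerSeries.HasSubst.of_constantCoeff_zero' hc
  have h := congrArg (PowerSeries.coeff k)
    (PowerSeries.derivative_subst (f := PowerSeries.exp (MvPolynomial ℕ+ ℂ)) hs)
  rw [PowerSeries.coeff_derivative, ← completeP_eq, PowerSeries.derivative_exp, mul_comm] at h
  rw [h, mul_comm, PowerSeries.coeff_mul, Finset.Nat.sum_antidiagonal_eq_sum_range_succ_mk]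
  refine Finset.sum_congr rfl fun m _ => ?_
  simp only [PowerSeries.coeff_derivative, PowerSeries.coeff_mk, ← completeP_eq]
  rw [dif_pos (Nat.succ_pos m)]
  exact congrArg (· * _) (mul_comm _ _)

/-- Differentiating the generating function `exp(∑ x_m t^m)` with respect to `x_n` multiplies it by
`t^n`. On coefficients this follows from Newton's recursion by induction. -/
theorem pderiv_completeP (n : ℕ+) (k : ℕ) :
    pderiv n (completeP k) = completePInt ((k : ℤ) - (n : ℕ)) := by
  induction k using Nat.strong_induction_on with
  | _ k ih =>
    cases k with
    | zero =>
      have := n.pos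
      rw [completeP_zero, pderiv_one, completePInt, if_pos (by omega)]
    | succ k =>
      have hk : ((k : MvPolynomial ℕ+ ℂ) + 1) ≠ 0 := by
        exact_mod_cast Nat.succ_ne_zero k
      refine mul_left_cancel₀ hk ?_
      have h := congrArg (pderiv n) (completeP_succ k)
      have e0 : pderiv n ((k : MvPolynomial ℕ+ ℂ) + 1) = 0 := by
        rw [map_add, pderiv_one, add_zero]
        exact Derivation.map_natCast _ _
      rw [Derivation.leibniz, e0, smul_zero, add_zero, smul_eq_mul, map_sum] at h
      rw [h]
      have e1 : ∀ m ∈ Finset.range (k + 1),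
          pderiv n (((m : MvPolynomial ℕ+ ℂ) + 1) * X m.succPNat * completeP (k - m)) =
          (if m + 1 = (n : ℕ) then ((m : MvPolynomial ℕ+ ℂ) + 1) * completeP (k - m) else 0) +
          ((m : MvPolynomial ℕ+ ℂ) + 1) * X m.succPNat *
            completePInt (((k - m : ℕ) : ℤ) - (n : ℕ)) := by
        intro m hm
        have e0 : pderiv n ((m : MvPolynomial ℕ+ ℂ) + 1) = 0 := by
          rw [map_add, pderiv_one, add_zero]
          exact Derivation.map_natCast _ _
        rw [Derivation.leibniz, Derivation.leibniz, e0, ih (k - m) (by omega), pderiv_X]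
        have : (n = m.succPNat) ↔ m + 1 = (n : ℕ) := by
          rw [← PNat.coe_inj]
          simp [eq_comm]
        simp only [Pi.single_apply, eq_comm (a := m.succPNat), this, smul_eq_mul]
        split_ifs <;> ring
      rw [Finset.sum_congr rfl e1, Finset.sum_add_distrib]
      obtain ⟨n, hn⟩ := n
      obtain ⟨n, rfl⟩ : ∃ n', n = n' + 1 := ⟨n - 1, by omega⟩
      simp only [PNat.mk_coe, add_left_inj]
      rw [Finset.sum_ite_eq']
      by_cases hnk : n < k + 1
      · rw [if_pos (Finset.mem_range.mpr hnk)]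
        have e2 : completePInt (((k + 1 : ℕ) : ℤ) - ((n + 1 : ℕ) : ℤ)) = completeP (k - n) := by
          rw [completePInt, if_neg (by omega)]
          congr 1
          omega
        rw [e2]
        have e3 : ∑ m ∈ Finset.range (k + 1), ((m : MvPolynomial ℕ+ ℂ) + 1) * X m.succPNat *
            completePInt (((k - m : ℕ) : ℤ) - ((n + 1 : ℕ) : ℤ)) =
            ((k - n : ℕ) : MvPolynomial ℕ+ ℂ) * completeP (k - n) := by
          rcases Nat.eq_zero_or_pos (k - n) with h0 | h0
          · rw [h0, Nat.cast_zero, zero_mul]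
            refine Finset.sum_eq_zero fun m _ => ?_
            rw [completePInt, if_pos (by omega), mul_zero]
          · obtain ⟨r, hr⟩ : ∃ r, k - n = r + 1 := ⟨k - n - 1, by omega⟩
            rw [hr, show ((r + 1 : ℕ) : MvPolynomial ℕ+ ℂ) = r + 1 from Nat.cast_succ r,
              completeP_succ]
            symm
            refine Finset.sum_subset_zero_on_sdiff ?_ ?_ ?_
            · intro x hx
              simp only [Finset.mem_range] at hx ⊢
              omega
            · intro m hm
              simp only [Finset.mem_sdiff, Finset.mem_range] at hm
              rw [completePInt, if_pos (by omega), mul_zero]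
            · intro m hm
              rw [Finset.mem_range] at hm
              rw [completePInt, if_neg (by omega)]
              congr 2
              omega
        rw [e3]
        have : (k : MvPolynomial ℕ+ ℂ) = n + ((k - n : ℕ) : MvPolynomial ℕ+ ℂ) := by
          rw [← Nat.cast_add]
          congr 1
          omega
        rw [this]
        ring
      · rw [if_neg (by simpa using hnk)]
        have e2 : completePInt (((k + 1 : ℕ) : ℤ) - ((n + 1 : ℕ) : ℤ)) = 0 := by
          rw [completePInt, if_pos (by omega)]
        rw [e2, mul_zero, zero_add]
        refine Finset.sum_eq_zero fun m _ => ?_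
        rw [completePInt, if_pos (by omega), mul_zero]

theorem pderiv_completePInt (n : ℕ+) (i : ℤ) :
    pderiv n (completePInt i) = completePInt (i - (n : ℕ)) := by
  by_cases hi : i < 0
  · have := n.pos
    rw [completePInt, completePInt, if_pos hi, if_pos (by omega), map_zero]
  · obtain ⟨k, rfl⟩ := Int.eq_ofNat_of_zero_le (not_lt.mp hi)
    rw [← pderiv_completeP, completePInt, if_neg hi, Int.toNat_natCast]

theorem constantCoeff_completePInt (i : ℤ) :
    constantCoeff (completePInt i) = if i = 0 then 1 else 0 := by
  rcases lt_trichotomy i 0 with hi | rfl | hi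
  · rw [completePInt, if_pos hi, map_zero, if_neg hi.ne]
  · simp [completePInt, completeP_zero]
  · obtain ⟨k, rfl⟩ : ∃ k : ℕ, i = ((k + 1 : ℕ) : ℤ) := ⟨(i - 1).toNat, by omega⟩
    rw [completePInt, if_neg hi.not_gt, if_neg hi.ne', Int.toNat_natCast]
    have h := congrArg constantCoeff (completeP_succ k)
    have hk : ((k : ℂ) + 1) ≠ 0 := by exact_mod_cast Nat.succ_ne_zero k
    refine mul_left_cancel₀ hk ?_
    simpa using h

/-- The signed elementary symmetric polynomials: `exp(-∑ x_m t^m) = ∑ c_k t^k`, and `c_k = 0` for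
`k < 0`. -/
def signedE (i : ℤ) : MvPolynomial ℕ+ ℂ := aeval (fun m : ℕ+ => -X m) (completePInt i)

theorem pderiv_signedE (n : ℕ+) (i : ℤ) :
    pderiv n (signedE i) = -signedE (i - (n : ℕ)) := by
  have key : ∀ p : MvPolynomial ℕ+ ℂ,
      pderiv n (aeval (fun m : ℕ+ => (-X m : MvPolynomial ℕ+ ℂ)) p) =
      -aeval (fun m : ℕ+ => (-X m : MvPolynomial ℕ+ ℂ)) (pderiv n p) := by
    intro p
    induction p using MvPolynomial.induction_on with
    | C a => simp
    | add p q hp hq => rw [map_add, map_add, map_add, map_add, hp, hq, neg_add]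
    | mul_X p m hp =>
      simp only [map_mul, Derivation.leibniz, hp, aeval_X, map_neg, smul_eq_mul, map_add,
        pderiv_X]
      by_cases hm : m = n
      · subst hm
        simp
        ring
      · simp [hm]
  rw [signedE, key, pderiv_completePInt, signedE]

theorem constantCoeff_signedE (i : ℤ) :
    constantCoeff (signedE i) = if i = 0 then 1 else 0 := by
  rw [← constantCoeff_completePInt]
  have : ∀ p : MvPolynomial ℕ+ ℂ,
      constantCoeff (aeval (fun m : ℕ+ => (-X m : MvPolynomial ℕ+ ℂ)) p) =
      constantCoeff p := by
    intro p
    induction p using MvPolynomial.induction_on with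
    | C a => simp
    | add p q hp hq => rw [map_add, map_add, map_add, hp, hq]
    | mul_X p m hp => simp
  exact this _

theorem signedE_of_neg {i : ℤ} (hi : i < 0) : signedE i = 0 := by
  rw [signedE, completePInt, if_pos hi, map_zero]

theorem completePInt_of_neg {i : ℤ} (hi : i < 0) : completePInt i = 0 := if_pos hi

/-! ### Determinants of shifted sequences -/

theorem derivation_prod {A ι : Type*} [CommRing A] [Algebra ℂ A] [DecidableEq ι]
    (δ : Derivation ℂ A A) (s : Finset ι) (f : ι → A) :
    δ (∏ i ∈ s, f i) = ∑ k ∈ s, ∏ i ∈ s, Function.update f k (δ (f k)) i := by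
  induction s using Finset.induction_on with
  | empty => simp
  | insert a s ha ih =>
    rw [Finset.prod_insert ha, Derivation.leibniz, ih, Finset.sum_insert ha, Finset.prod_insert ha,
      Function.update_self, add_comm, smul_eq_mul, smul_eq_mul, mul_comm (∏ i ∈ s, f i),
      Finset.mul_sum]
    congr 1
    · congr 1
      refine Finset.prod_congr rfl fun i hi => ?_
      rw [Function.update_of_ne (by rintro rfl; exact ha hi)]
    · refine Finset.sum_congr rfl fun k hk => ?_
      rw [Finset.prod_insert ha, Function.update_of_ne (by rintro rfl; exact ha hk)]

theorem derivation_det {A ι : Type*} [CommRing A] [Algebra ℂ A] [DecidableEq ι] [Fintype ι]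
    (δ : Derivation ℂ A A) (M : Matrix ι ι A) :
    δ M.det = ∑ k, (M.updateRow k fun j => δ (M k j)).det := by
  simp only [← Matrix.det_transpose M, ← Matrix.det_transpose (Matrix.updateRow _ _ _)]
  simp only [Matrix.det_apply, map_sum, Matrix.transpose_apply]
  rw [Finset.sum_comm]
  refine Finset.sum_congr rfl fun σ _ => ?_
  rw [← Finset.smul_sum, Units.smul_def, Units.smul_def, map_zsmul, derivation_prod]
  congr 1
  refine Finset.sum_congr rfl fun k _ => ?_
  refine Finset.prod_congr rfl fun i _ => ?_
  by_cases h : i = k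
  · subst h
    simp
  · rw [Function.update_of_ne h, Matrix.updateRow_ne h]

section ShiftDet

variable {A : Type*} [CommRing A] (q : ℤ → A) {N : ℕ}

/-- The determinant `det (q_{j - a_i})`. For the sequences `q` of complete and of signed elementary
symmetric polynomials these are the Jacobi–Trudi determinants; they are alternating in `a`. -/
def shiftDet (a : Fin N → ℤ) : A :=
  Matrix.det (Matrix.of fun i j : Fin N => q ((j : ℤ) - a i))

theorem shiftDet_comp_perm (a : Fin N → ℤ) (σ : Equiv.Perm (Fin N)) :
    shiftDet q (a ∘ σ) = ((Equiv.Perm.sign σ : ℤ) : A) * shiftDet q a := by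
  have := Matrix.det_permute σ (Matrix.of fun i j : Fin N => q ((j : ℤ) - a i))
  exact this

theorem shiftDet_eq_zero {a : Fin N → ℤ} (ha : ¬ Function.Injective a) : shiftDet q a = 0 := by
  simp only [Function.Injective, not_forall] at ha
  obtain ⟨i, j, h, hij⟩ := ha
  refine Matrix.det_zero_of_row_eq hij ?_
  funext k
  simp [h]

theorem shiftDet_of_ge (hq : ∀ i < 0, q i = 0) {a : Fin N → ℤ} {i : Fin N} (hi : (N : ℤ) ≤ a i) :
    shiftDet q a = 0 := by
  refine Matrix.det_eq_zero_of_row_eq_zero i fun j => ?_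
  exact hq _ (by have := j.isLt; omega)

theorem derivation_shiftDet [Algebra ℂ A] (δ : Derivation ℂ A A) (n : ℤ) (ε : A)
    (hδ : ∀ k, δ (q k) = ε * q (k - n)) (a : Fin N → ℤ) :
    δ (shiftDet q a) = ε * ∑ i, shiftDet q (Function.update a i (a i + n)) := by
  rw [shiftDet, derivation_det, Finset.mul_sum]
  refine Finset.sum_congr rfl fun k _ => ?_
  have : (Matrix.updateRow (Matrix.of fun i j : Fin N => q ((j : ℤ) - a i)) k
      fun j => δ ((Matrix.of fun i j : Fin N => q ((j : ℤ) - a i)) k j)) =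
      Matrix.updateRow (Matrix.of fun i j : Fin N =>
        q ((j : ℤ) - Function.update a k (a k + n) i)) k
        (ε • (Matrix.of fun i j : Fin N => q ((j : ℤ) - Function.update a k (a k + n) i)) k) := by
    ext i j
    by_cases h : i = k
    · subst h
      simp only [Matrix.updateRow_self, Matrix.of_apply, Pi.smul_apply, Function.update_self, hδ,
        smul_eq_mul]
      congr 2
      ring
    · simp [h]
  rw [this, Matrix.det_updateRow_smul, Matrix.updateRow_eq_self]
  rfl

end ShiftDet

open Classical in
/-- The number of elements of `B` strictly between `s` and `t`. -/
def between (B : Set ℤ) (s t : ℤ) : ℕ :=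
  ((Finset.Ioo (min s t) (max s t)).filter (· ∈ B)).card

theorem between_comm (B : Set ℤ) (s t : ℤ) : between B s t = between B t s := by
  rw [between, between, min_comm, max_comm]

theorem between_congr {B C : Set ℤ} {s t : ℤ}
    (h : ∀ k, min s t < k → k < max s t → (k ∈ B ↔ k ∈ C)) : between B s t = between C s t := by
  classical
  unfold between
  congr 1
  refine Finset.filter_congr fun k hk => ?_
  rw [Finset.mem_Ioo] at hk
  exact h k hk.1 hk.2

theorem val_eq_card_lt {N : ℕ} {a : Fin N → ℤ} (ha : StrictMono a) (i : Fin N) :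
    (i : ℕ) = ((Finset.univ.image a).filter (· < a i)).card := by
  rw [Finset.filter_image, Finset.card_image_of_injective _ ha.injective]
  simp only [ha.lt_iff_lt, Finset.filter_gt_eq_Iio, Fin.card_Iio]

theorem shiftDet_insertNth {A : Type*} [CommRing A] (q : ℤ → A) {m : ℕ} (i : Fin (m + 1)) (t : ℤ)
    (v : Fin m → ℤ) :
    shiftDet q (i.insertNth t v : Fin (m + 1) → ℤ) =
      (-1) ^ (i : ℕ) * shiftDet q (Fin.cons t v : Fin (m + 1) → ℤ) := by
  rw [← Fin.cons_comp_cycleRange, shiftDet_comp_perm, Fin.sign_cycleRange]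
  simp

/-- Replacing one entry of an increasing sequence and sorting the result costs a sign, which counts
the entries passed on the way. -/
theorem shiftDet_update {A : Type*} [CommRing A] (q : ℤ → A) {N : ℕ} {a b : Fin N → ℤ}
    (ha : StrictMono a) (hb : StrictMono b) (i : Fin N) {t : ℤ} (ht : t ∉ Set.range a)
    (hab : ∀ k, k ∈ Set.range b ↔ k = t ∨ (k ∈ Set.range a ∧ k ≠ a i)) :
    shiftDet q (Function.update a i t) =
      (-1) ^ between (Set.range a) (a i) t * shiftDet q b := by
  classical
  obtain _ | m := N
  · exact i.elim0
  obtain ⟨i', hi'⟩ := (hab t).mpr (Or.inl rfl)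
  have hv : b ∘ i'.succAbove = a ∘ i.succAbove := by
    refine (StrictMono.range_inj (hb.comp (Fin.strictMono_succAbove i'))
      (ha.comp (Fin.strictMono_succAbove i))).mp ?_
    rw [Set.range_comp, Set.range_comp, Fin.range_succAbove, Fin.range_succAbove]
    ext k
    simp only [Set.mem_image, Set.mem_compl_iff, Set.mem_singleton_iff]
    constructor
    · rintro ⟨j, hj, rfl⟩
      rcases (hab (b j)).mp ⟨j, rfl⟩ with h | ⟨⟨j', h⟩, h'⟩
      · exact absurd (hb.injective (h.trans hi'.symm)) hj
      · exact ⟨j', fun h2 => h' (by rw [← h, h2]), h⟩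
    · rintro ⟨j, hj, rfl⟩
      obtain ⟨j', h⟩ := (hab (a j)).mpr (Or.inr ⟨⟨j, rfl⟩, fun h => hj (ha.injective h)⟩)
      refine ⟨j', fun h2 => ht ⟨j, ?_⟩, h⟩
      rw [← h, h2, hi']
  have e1 : Function.update a i t = i.insertNth t (a ∘ i.succAbove) :=
    (Fin.insertNth_removeNth i t a).symm
  have e2 : b = i'.insertNth t (a ∘ i.succAbove) := by
    rw [← hv, ← hi']
    exact (Fin.insertNth_self_removeNth i' b).symm
  have hsgn : (-1 : A) ^ (i : ℕ) = (-1) ^ between (Set.range a) (a i) t * (-1) ^ (i' : ℕ) := by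
    rw [val_eq_card_lt ha i, val_eq_card_lt hb i', hi']
    have hti : t ≠ a i := fun h => ht ⟨i, h.symm⟩
    have hm : ∀ x, x ∈ Finset.univ.image a ↔ x ∈ Set.range a := by simp
    have hm' : ∀ x, x ∈ Finset.univ.image b ↔ x ∈ Set.range b := by simp
    have hbt : ((Finset.Ioo (min (a i) t) (max (a i) t)).filter (· ∈ Set.range a)).card =
        between (Set.range a) (a i) t := by
      unfold between
      congr!
    rcases lt_or_gt_of_ne hti with h | h
    · have : (Finset.univ.image a).filter (· < a i) =
          ((Finset.Ioo (min (a i) t) (max (a i) t)).filter (· ∈ Set.range a)) ∪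
            (Finset.univ.image b).filter (· < t) := by
        ext x
        simp only [Finset.mem_union, Finset.mem_filter, hm, hm', Finset.mem_Ioo, min_eq_right h.le,
          max_eq_left h.le, hab]
        by_cases hx : x = t
        · subst hx
          simp [ht]
        · by_cases hxr : x ∈ Set.range a <;> simp only [hxr, hx] <;> grind
      rw [this, Finset.card_union_of_disjoint, pow_add, hbt]
      · rw [Finset.disjoint_left]
        intro x hx hx'
        simp only [Finset.mem_filter, Finset.mem_Ioo, min_eq_right h.le] at hx hx'
        omega
    · have : (Finset.univ.image b).filter (· < t) =
          ((Finset.Ioo (min (a i) t) (max (a i) t)).filter (· ∈ Set.range a)) ∪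
            (Finset.univ.image a).filter (· < a i) := by
        ext x
        simp only [Finset.mem_union, Finset.mem_filter, hm, hm', Finset.mem_Ioo, min_eq_left h.le,
          max_eq_right h.le, hab]
        by_cases hx : x = t
        · subst hx
          simp [ht]
        · by_cases hxr : x ∈ Set.range a <;> simp only [hxr, hx] <;> grind
      rw [this, Finset.card_union_of_disjoint, pow_add, ← mul_assoc, hbt, ← mul_pow]
      · simp
      · rw [Finset.disjoint_left]
        intro x hx hx'
        simp only [Finset.mem_filter, Finset.mem_Ioo, min_eq_left h.le] at hx hx'
        omega
  rw [e1, shiftDet_insertNth, hsgn]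
  conv_rhs => rw [e2]
  rw [shiftDet_insertNth, mul_assoc]

theorem exists_strictMono_range {N : ℕ} {f : Fin N → ℤ} (hf : Function.Injective f) :
    ∃ b : Fin N → ℤ, StrictMono b ∧ Set.range b = Set.range f :=
  ⟨f ∘ Tuple.sort f, (Tuple.monotone_sort f).strictMono_of_injective
    (hf.comp (Tuple.sort f).injective), by
      rw [Set.range_comp, Equiv.range_eq_univ, Set.image_univ]⟩

theorem eq_of_pderiv_eq {p r : MvPolynomial ℕ+ ℂ} (h : ∀ n, pderiv n p = pderiv n r)
    (h0 : constantCoeff p = constantCoeff r) : p = r := by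
  ext d
  by_cases hd : d = 0
  · subst hd
    exact h0
  · obtain ⟨n, hn⟩ := Finsupp.ne_iff.mp hd
    have h1 := congrArg (coeff (d - Finsupp.single n 1)) (h n)
    rw [coeff_pderiv, coeff_pderiv] at h1
    have h2 : d - Finsupp.single n 1 + Finsupp.single n 1 = d := by
      refine tsub_add_cancel_of_le ?_
      simpa [Nat.one_le_iff_ne_zero] using hn
    rw [h2] at h1
    refine mul_right_cancel₀ ?_ h1
    exact Nat.cast_add_one_ne_zero _

/-! ### Constant terms and derivatives of the determinants -/

section Constant

variable {q : ℤ → MvPolynomial ℕ+ ℂ} {N : ℕ}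

theorem constantCoeff_shiftDet (a : Fin N → ℤ) : constantCoeff (shiftDet q a) =
    Matrix.det (Matrix.of fun i j : Fin N => constantCoeff (q ((j : ℤ) - a i))) := by
  rw [shiftDet, RingHom.map_det]
  rfl

/-- An entry of `a` outside `0, …, N - 1` gives a row of polynomials without constant term. -/
theorem mem_of_constantCoeff_shiftDet_ne_zero
    (hq : ∀ i, constantCoeff (q i) = if i = 0 then 1 else 0) {a : Fin N → ℤ}
    (h : constantCoeff (shiftDet q a) ≠ 0) (i : Fin N) : 0 ≤ a i ∧ a i < N := by
  by_contra hi
  refine h ?_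
  rw [constantCoeff_shiftDet]
  refine Matrix.det_eq_zero_of_row_eq_zero i fun j => ?_
  have := j.isLt
  rw [Matrix.of_apply, hq, if_neg (by omega)]

/-- The constant terms form the matrix with a `1` in row `i` and column `a i` and zeros
elsewhere. -/
theorem constantCoeff_shiftDet_of_strictMono
    (hq : ∀ i, constantCoeff (q i) = if i = 0 then 1 else 0) {a : Fin N → ℤ} (ha : StrictMono a) :
    constantCoeff (shiftDet q a) = if ∀ i : Fin N, a i = (i : ℤ) then 1 else 0 := by
  split_ifs with h
  · rw [constantCoeff_shiftDet]
    have : (Matrix.of fun i j : Fin N => constantCoeff (q ((j : ℤ) - a i))) = 1 := by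
      ext1 i j
      simp only [Matrix.of_apply, hq, h, sub_eq_zero, Matrix.one_apply, Nat.cast_inj,
        ← Fin.ext_iff, eq_comm]
    rw [this, Matrix.det_one]
  · by_contra h0
    have hmem := mem_of_constantCoeff_shiftDet_ne_zero hq h0
    let f : Fin N → Fin N := fun i => ⟨(a i).toNat, by have := hmem i; omega⟩
    have hf : StrictMono f := fun i j hij => by
      have h1 := ha hij
      have h2 := hmem i
      have h3 := hmem j
      simp only [f, Fin.lt_def]
      omega
    refine h fun i => ?_
    have hid : f = id := (StrictMono.range_inj hf strictMono_id).mp (by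
      rw [Set.range_id]
      exact (Finite.surjective_of_injective hf.injective).range_eq)
    have h1 := congrArg Fin.val (congrFun hid i)
    have h2 := hmem i
    simp only [f, id] at h1
    omega

end Constant

theorem pderiv_shiftDet_signedE (n : ℕ+) {N : ℕ} (a : Fin N → ℤ) :
    pderiv n (shiftDet signedE a) =
      -∑ i, shiftDet signedE (Function.update a i (a i + (n : ℕ))) := by
  rw [derivation_shiftDet signedE (pderiv n) (n : ℕ) (-1) (fun k => by
    rw [pderiv_signedE, neg_one_mul]), neg_one_mul]

theorem pderiv_shiftDet_completePInt (n : ℕ+) {N : ℕ} (a : Fin N → ℤ) :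
    pderiv n (shiftDet completePInt a) =
      ∑ i, shiftDet completePInt (Function.update a i (a i + (n : ℕ))) := by
  rw [derivation_shiftDet completePInt (pderiv n) (n : ℕ) 1 (fun k => by
    rw [pderiv_completePInt, one_mul]), one_mul]

/-- If two entries of `a` agree, then the terms which change one of these two cancel each other, and
all others vanish. -/
theorem sum_shiftDet_update_eq_zero {A : Type*} [CommRing A] (q : ℤ → A) {N : ℕ} {a : Fin N → ℤ}
    (ha : ¬ Function.Injective a) (n : ℤ) :
    ∑ i, shiftDet q (Function.update a i (a i + n)) = 0 := by
  simp only [Function.Injective, not_forall] at ha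
  obtain ⟨i, j, h, hij⟩ := ha
  rw [← Ne.eq_def] at hij
  rw [Finset.sum_eq_add i j hij]
  · have : Function.update a j (a j + n) =
        Function.update a i (a i + n) ∘ Equiv.swap i j := by
      funext k
      simp only [Function.comp]
      by_cases hki : k = i
      · subst hki
        rw [Equiv.swap_apply_left, Function.update_of_ne hij, Function.update_of_ne hij.symm, h]
      · by_cases hkj : k = j
        · subst hkj
          rw [Equiv.swap_apply_right, Function.update_self, Function.update_self, h]
        · rw [Equiv.swap_apply_of_ne_of_ne hki hkj, Function.update_of_ne hki,
            Function.update_of_ne hkj]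
    rw [this, shiftDet_comp_perm, Equiv.Perm.sign_swap hij]
    simp
  · rintro k - ⟨hki, hkj⟩
    refine shiftDet_eq_zero q fun hinj => hij (hinj ?_)
    rw [Function.update_of_ne (Ne.symm hki), Function.update_of_ne (Ne.symm hkj), h]
  · simp
  · simp

/-- Multiplication by `n x_n` in terms of the determinants. Both sides have the same derivatives
by induction; the constant `n = pderiv n (n x_n)` comes from the `n` largest entries, which
fall off the edge under differentiation. The hypothesis `ha` makes these `n` largest entries equal
to `N - n, …, N - 1`; nothing is required of sequences with a repeated entry, which occur in the
induction and for which both sides vanish. -/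
theorem mul_shiftDet_signedE (n : ℕ+) {N : ℕ} (a : Fin N → ℤ) (haN : ∀ i, a i < N)
    (ha : Function.Injective a → ∀ v : ℤ, (N : ℤ) - (n : ℕ) ≤ v → v < N → v ∈ Set.range a) :
    C ((n : ℕ) : ℂ) * X n * shiftDet signedE a =
      -∑ i, shiftDet signedE (Function.update a i (a i - (n : ℕ))) := by
  induction hs : ∑ i, ((N : ℤ) - a i).toNat using Nat.strong_induction_on generalizing a with
  | _ s ih =>
  by_cases hinj : Function.Injective a
  swap
  · rw [shiftDet_eq_zero _ hinj, mul_zero]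
    simp only [sub_eq_add_neg]
    rw [sum_shiftDet_update_eq_zero _ hinj, neg_zero]
  have hnpos := n.pos
  refine eq_of_pderiv_eq (fun m => ?_) ?_
  · have hmpos := m.pos
    rw [Derivation.leibniz, Derivation.leibniz, pderiv_C, smul_zero, add_zero, map_neg, map_sum,
      pderiv_shiftDet_signedE]
    simp only [pderiv_shiftDet_signedE]
    rw [Finset.sum_neg_distrib, neg_neg, Finset.sum_comm]
    -- raising the entry `k` by `m` commutes with lowering some entry by `n`, except when the raised
    -- entry is `≥ N`: then only the lowering of this same entry can give a nonzero determinant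
    have hU : ∀ k : Fin N, ∑ i, shiftDet signedE (Function.update
        (Function.update a i (a i - (n : ℕ))) k
        (Function.update a i (a i - (n : ℕ)) k + (m : ℕ))) =
        -(C ((n : ℕ) : ℂ) * X n * shiftDet signedE (Function.update a k (a k + (m : ℕ)))) +
          if (N : ℤ) ≤ a k + (m : ℕ) then
            shiftDet signedE (Function.update a k (a k + (m : ℕ) - (n : ℕ))) else 0 := by
      intro k
      have e1 : ∀ i, Function.update (Function.update a i (a i - (n : ℕ))) k
          (Function.update a i (a i - (n : ℕ)) k + (m : ℕ)) =
          Function.update (Function.update a k (a k + (m : ℕ))) i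
            (Function.update a k (a k + (m : ℕ)) i - (n : ℕ)) := by
        intro i
        by_cases hik : i = k
        · subst hik
          simp only [Function.update_self, Function.update_idem]
          congr 1
          ring
        · rw [Function.update_of_ne hik, Function.update_of_ne (Ne.symm hik),
            Function.update_comm hik]
      simp only [e1]
      split_ifs with hk
      · rw [shiftDet_of_ge signedE (fun i => signedE_of_neg) (i := k) (by simpa using hk),
          mul_zero, neg_zero, zero_add, Finset.sum_eq_single k]
        · simp
        · intro i _ hik
          refine shiftDet_of_ge signedE (fun i => signedE_of_neg) (i := k) ?_
          rw [Function.update_of_ne (Ne.symm hik), Function.update_self]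
          exact hk
        · simp
      · rw [add_zero, ih _ _ _ _ _ rfl, neg_neg]
        · rw [← hs]
          refine Finset.sum_lt_sum (fun i _ => ?_) ⟨k, Finset.mem_univ k, ?_⟩
          · by_cases hik : i = k
            · subst hik
              rw [Function.update_self]
              omega
            · rw [Function.update_of_ne hik]
          · rw [Function.update_self]
            omega
        · intro i
          by_cases hik : i = k
          · subst hik
            rw [Function.update_self]
            omega
          · rw [Function.update_of_ne hik]
            exact haN i
        · intro hinj' v hv1 hv2
          obtain ⟨l, hl⟩ := ha hinj v hv1 hv2
          by_cases hlk : l = k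
          · -- the moved entry is one of the `n` largest, hence lands on another entry
            exfalso
            subst hlk
            obtain ⟨l', hl'⟩ := ha hinj (a l + (m : ℕ)) (by omega) (by omega)
            have hne : l' ≠ l := by
              rintro rfl
              omega
            refine hne (hinj' ?_)
            rw [Function.update_self, Function.update_of_ne hne, hl']
          · exact ⟨l, by rw [Function.update_of_ne hlk, hl]⟩
    rw [Finset.sum_congr rfl fun k _ => hU k, Finset.sum_add_distrib, Finset.sum_neg_distrib,
      ← Finset.mul_sum, smul_eq_mul, mul_neg, add_comm, smul_eq_mul, add_comm]
    congr 1
    by_cases hmn : m = n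
    · subst hmn
      have hcard : (Finset.univ.filter fun k => (N : ℤ) ≤ a k + (m : ℕ)).card = m := by
        have : (Finset.univ.filter fun k => (N : ℤ) ≤ a k + (m : ℕ)).image a =
            Finset.Ico ((N : ℤ) - (m : ℕ)) N := by
          ext v
          simp only [Finset.mem_image, Finset.mem_filter, Finset.mem_univ, true_and,
            Finset.mem_Ico]
          constructor
          · rintro ⟨k, hk, rfl⟩
            exact ⟨by omega, haN k⟩
          · rintro ⟨h1, h2⟩
            obtain ⟨k, rfl⟩ := ha hinj v h1 h2
            exact ⟨k, by omega, rfl⟩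
        rw [← Finset.card_image_of_injective _ hinj, this, Int.card_Ico]
        omega
      simp only [add_sub_cancel_right, Function.update_eq_self]
      rw [← Finset.sum_filter, Finset.sum_const, hcard, pderiv_X_self, smul_eq_mul,
        mul_one, nsmul_eq_mul, mul_comm]
      simp
    · rw [pderiv_X_of_ne (Ne.symm hmn), smul_zero, mul_zero]
      symm
      refine Finset.sum_eq_zero fun k _ => ?_
      have hmn' : (m : ℕ) ≠ (n : ℕ) := fun h => hmn (PNat.coe_injective h)
      split_ifs with hk
      · by_cases hv : (N : ℤ) ≤ a k + (m : ℕ) - (n : ℕ)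
        · exact shiftDet_of_ge signedE (fun i => signedE_of_neg) (i := k) (by simpa using hv)
        · obtain ⟨l, hl⟩ := ha hinj (a k + (m : ℕ) - (n : ℕ)) (by omega) (by omega)
          refine shiftDet_eq_zero _ fun hinj' => ?_
          have hlk : l ≠ k := by
            rintro rfl
            omega
          refine hlk (hinj' ?_)
          rw [Function.update_self, Function.update_of_ne hlk, hl]
      · rfl
  · rw [map_mul, map_mul, constantCoeff_X, mul_zero, zero_mul, map_neg, map_sum]
    symm
    rw [neg_eq_zero]
    refine Finset.sum_eq_zero fun i _ => ?_
    -- a nonzero constant term would make the new sequence a permutation of `0, …, N - 1`, so that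
    -- the old value `a i` would occur twice in `a`
    by_contra h0
    have hmem := mem_of_constantCoeff_shiftDet_ne_zero constantCoeff_signedE h0
    have hb : Function.Injective (Function.update a i (a i - (n : ℕ))) := by
      by_contra hb
      rw [shiftDet_eq_zero _ hb, map_zero] at h0
      exact h0 rfl
    let f : Fin N → Fin N := fun j =>
      ⟨(Function.update a i (a i - (n : ℕ)) j).toNat, by have := hmem j; omega⟩
    have hf : Function.Injective f := fun j k hjk => by
      have h1 := congrArg Fin.val hjk
      have h2 := hmem j
      have h3 := hmem k
      simp only [f] at h1
      exact hb (by omega)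
    have hi := hmem i
    rw [Function.update_self] at hi
    have haNi := haN i
    obtain ⟨l, hl⟩ := Finite.surjective_of_injective hf ⟨(a i).toNat, by omega⟩
    have h1 := congrArg Fin.val hl
    have h2 := hmem l
    simp only [f] at h1
    have hli : l ≠ i := by
      rintro rfl
      rw [Function.update_self] at h1 h2
      omega
    rw [Function.update_of_ne hli] at h1 h2
    exact hli (hinj (by omega))

/-! ### Charge zero Maya diagrams -/

/-- Move the black stone at `s` to the free position `t`. -/
def Maya.move (u : Maya) (s t : ℤ) : Maya := (u.insert t).erase s

theorem Maya.mem_move {u : Maya} {s t k : ℤ} :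
    k ∈ (u.move s t).black ↔ (k ∈ u.black ∨ k = t) ∧ k ≠ s := Iff.rfl

/-- The `N` black stones of `u` to the left of `N` stand at the positions `a_0 < a_1 < ⋯`, and all
positions from `N` on are black. -/
structure IsWindow (u : Maya) {N : ℕ} (a : Fin N → ℤ) : Prop where
  strictMono : StrictMono a
  lt : ∀ i, a i < N
  mem_iff : ∀ k, k ∈ u.black ↔ k ∈ Set.range a ∨ (N : ℤ) ≤ k

theorem IsWindow.range_eq {u : Maya} {N : ℕ} {a : Fin N → ℤ} (h : IsWindow u a) :
    Set.range a = {k | k ∈ u.black ∧ k < N} := by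
  ext k
  rw [Set.mem_ofPred_eq, h.mem_iff]
  constructor
  · rintro ⟨i, rfl⟩
    exact ⟨Or.inl ⟨i, rfl⟩, h.lt i⟩
  · rintro ⟨h1 | h1, h2⟩
    · exact h1
    · omega

theorem IsWindow.unique {u : Maya} {N : ℕ} {a b : Fin N → ℤ} (ha : IsWindow u a)
    (hb : IsWindow u b) : a = b :=
  (StrictMono.range_inj ha.strictMono hb.strictMono).mp (by rw [ha.range_eq, hb.range_eq])

/-- The positions of the first `N` black stones of the Maya diagram of `lam`. -/
def colWindow (lam : YoungDiagram) (N : ℕ) : Fin N → ℤ := fun j => (j : ℤ) - lam.colLen j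

theorem colLen_eq_zero_iff {lam : YoungDiagram} {j : ℕ} : lam.colLen j = 0 ↔ lam.rowLen 0 ≤ j := by
  have h : 0 < lam.colLen j ↔ j < lam.rowLen 0 := by
    rw [← YoungDiagram.mem_iff_lt_colLen, ← YoungDiagram.mem_iff_lt_rowLen]
  omega

theorem isWindow_ofYoung (lam : YoungDiagram) {N : ℕ} (hN : lam.rowLen 0 ≤ N) :
    IsWindow (Maya.ofYoung lam) (colWindow lam N) where
  strictMono i j hij := by
    have := lam.colLen_anti i j hij.le
    have h2 : (i : ℕ) < j := hij
    simp only [colWindow]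
    omega
  lt i := by
    have := i.isLt
    simp only [colWindow]
    omega
  mem_iff k := by
    constructor
    · rintro ⟨j, rfl⟩
      by_cases hj : j < N
      · exact Or.inl ⟨⟨j, hj⟩, rfl⟩
      · have : lam.colLen j = 0 := colLen_eq_zero_iff.mpr (by omega)
        simp only [this]
        right
        omega
    · rintro (⟨j, rfl⟩ | hk)
      · exact ⟨j, rfl⟩
      · refine ⟨k.toNat, ?_⟩
        have : lam.colLen k.toNat = 0 := colLen_eq_zero_iff.mpr (by omega)
        simp only [this]
        omega

theorem eq_of_colLen {lam mu : YoungDiagram} (h : ∀ j, lam.colLen j = mu.colLen j) : lam = mu := by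
  ext ⟨i, j⟩
  rw [YoungDiagram.mem_cells, YoungDiagram.mem_cells, YoungDiagram.mem_iff_lt_colLen,
    YoungDiagram.mem_iff_lt_colLen, h]

theorem ofYoung_injective : Function.Injective Maya.ofYoung := by
  intro lam mu h
  refine eq_of_colLen fun j => ?_
  have h1 := isWindow_ofYoung lam (N := lam.rowLen 0 + mu.rowLen 0 + j + 1) (by omega)
  have h2 := isWindow_ofYoung mu (N := lam.rowLen 0 + mu.rowLen 0 + j + 1) (by omega)
  rw [h] at h1
  have := congrFun (h1.unique h2) ⟨j, by omega⟩
  simp only [colWindow] at this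
  omega

theorem ofYoung_bot : Maya.ofYoung ⊥ = Maya.vac := by
  have h0 : ∀ j, (⊥ : YoungDiagram).colLen j = 0 := fun j => by
    by_contra h
    exact YoungDiagram.notMem_bot (0, j)
      (YoungDiagram.mem_iff_lt_colLen.mpr (Nat.pos_of_ne_zero h))
  ext k
  constructor
  · rintro ⟨j, rfl⟩
    simp [Maya.vac, h0]
  · intro hk
    refine ⟨k.toNat, ?_⟩
    have hk' : 0 ≤ k := hk
    simp only [h0]
    omega

theorem card_eq_sum_colLen (lam : YoungDiagram) {N : ℕ} (hN : lam.rowLen 0 ≤ N) :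
    lam.card = ∑ j ∈ Finset.range N, lam.colLen j := by
  unfold YoungDiagram.card
  rw [Finset.card_eq_sum_card_fiberwise (f := fun c => c.2) (t := Finset.range N)]
  · refine Finset.sum_congr rfl fun j _ => ?_
    rw [YoungDiagram.colLen_eq_card]
    rfl
  · rintro ⟨i, j⟩ hc
    have h1 := YoungDiagram.mem_iff_lt_rowLen.mp ((YoungDiagram.mem_cells _).mp hc)
    have := lam.rowLen_anti 0 i (Nat.zero_le i)
    simp only [Finset.coe_range, Set.mem_Iio]
    omega

theorem card_eq_sum_colWindow (lam : YoungDiagram) {N : ℕ} (hN : lam.rowLen 0 ≤ N) :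
    (lam.card : ℤ) = ∑ j : Fin N, ((j : ℤ) - colWindow lam N j) := by
  rw [card_eq_sum_colLen lam hN, ← Fin.sum_univ_eq_sum_range]
  push_cast
  refine Finset.sum_congr rfl fun j _ => ?_
  simp only [colWindow]
  ring

theorem sub_le_sub_of_strictMono {N : ℕ} {a : Fin N → ℤ} (ha : StrictMono a) {i j : Fin N}
    (hij : i ≤ j) : (j : ℤ) - i ≤ a j - a i := by
  obtain ⟨j, hj⟩ := j
  induction j with
  | zero =>
    have : i = ⟨0, hj⟩ := le_antisymm hij (Fin.mk_le_of_le_val (Nat.zero_le _))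
    subst this
    simp
  | succ j ih =>
    rcases eq_or_lt_of_le hij with rfl | h
    · simp
    · have h1 := ih (by omega) (Nat.lt_succ_iff.mp h)
      have h2 : a ⟨j, by omega⟩ < a ⟨j + 1, hj⟩ := ha (Nat.lt_succ_self j)
      simp only at h1 ⊢
      push_cast
      omega

/-- The Maya diagrams with `N` stones to the left of `N`, and only black positions from `N` on, are
those of the Young diagrams with at most `N` columns. -/
theorem IsWindow.exists_young {u : Maya} {N : ℕ} {a : Fin N → ℤ} (h : IsWindow u a) :
    ∃ lam : YoungDiagram, u = Maya.ofYoung lam ∧ lam.rowLen 0 ≤ N ∧ a = colWindow lam N := by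
  have hle : ∀ i : Fin N, a i ≤ i := fun i => by
    have hi := i.isLt
    have := sub_le_sub_of_strictMono h.strictMono
      (i := i) (j := ⟨N - 1, by omega⟩) (Fin.mk_le_mk.mpr (by omega))
    have h2 := h.lt ⟨N - 1, by omega⟩
    simp only at this
    omega
  let c : ℕ → ℕ := fun j => if hj : j < N then ((j : ℤ) - a ⟨j, hj⟩).toNat else 0
  have hanti : Antitone c := by
    intro i j hij
    simp only [c]
    by_cases hj : j < N
    · have hi : i < N := by omega
      rw [dif_pos hj, dif_pos hi]
      have := sub_le_sub_of_strictMono h.strictMono (i := ⟨i, hi⟩) (j := ⟨j, hj⟩) hij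
      simp only at this
      omega
    · rw [dif_neg hj]
      exact Nat.zero_le _
  let lam : YoungDiagram :=
    { cells := (Finset.range (c 0) ×ˢ Finset.range N).filter fun x => x.1 < c x.2
      isLowerSet := by
        rintro ⟨i, j⟩ ⟨i', j'⟩ ⟨hi, hj⟩ hx
        simp only [Finset.coe_filter, Finset.mem_product, Finset.mem_range,
          Set.mem_ofPred_eq] at hx ⊢
        simp only at hi hj
        have := hanti hj
        omega }
  have hcol : ∀ j, lam.colLen j = c j := by
    intro j
    have : ∀ i, i < lam.colLen j ↔ i < c j := by
      intro i
      rw [← YoungDiagram.mem_iff_lt_colLen, ← YoungDiagram.mem_cells]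
      simp only [lam, Finset.mem_filter, Finset.mem_product, Finset.mem_range]
      constructor
      · exact fun h => h.2
      · intro hi
        have h0 := hanti (Nat.zero_le j)
        have hj : j < N := by
          by_contra hj
          simp only [c, dif_neg hj] at hi
          omega
        exact ⟨⟨by omega, hj⟩, hi⟩
    have h1 := this (c j)
    have h2 := this (lam.colLen j)
    omega
  have hrow : lam.rowLen 0 ≤ N := by
    rw [← colLen_eq_zero_iff, hcol]
    simp [c]
  have ha : a = colWindow lam N := by
    funext j
    have hj := hle j
    simp only [colWindow, hcol, c, dif_pos j.isLt, Fin.eta]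
    omega
  refine ⟨lam, ?_, hrow, ha⟩
  ext k
  rw [h.mem_iff, (isWindow_ofYoung lam hrow).mem_iff, ← ha]

/-- Moving the stone `a i` to a free position `t` keeps the window. -/
theorem IsWindow.exists_move {u : Maya} {N : ℕ} {a : Fin N → ℤ} (h : IsWindow u a) (i : Fin N)
    {t : ℤ} (ht : t ∉ u.black) : ∃ b : Fin N → ℤ, IsWindow (u.move (a i) t) b ∧
      (∀ k, k ∈ Set.range b ↔ k = t ∨ (k ∈ Set.range a ∧ k ≠ a i)) ∧
      ∑ j, b j = ∑ j, a j + (t - a i) := by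
  have hta : t ∉ Set.range a := fun h' => ht ((h.mem_iff t).mpr (Or.inl h'))
  have htN : t < N := by
    by_contra h'
    exact ht ((h.mem_iff t).mpr (Or.inr (not_lt.mp h')))
  have hinj : Function.Injective (Function.update a i t) := by
    intro j k hjk
    by_cases hj : j = i <;> by_cases hk : k = i
    · rw [hj, hk]
    · subst hj
      rw [Function.update_self, Function.update_of_ne hk] at hjk
      exact absurd ⟨k, hjk.symm⟩ hta
    · subst hk
      rw [Function.update_self, Function.update_of_ne hj] at hjk
      exact absurd ⟨j, hjk⟩ hta
    · rw [Function.update_of_ne hk, Function.update_of_ne hj] at hjk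
      exact h.strictMono.injective hjk
  have hmem : ∀ k, k ∈ Set.range (Function.update a i t) ↔
      k = t ∨ (k ∈ Set.range a ∧ k ≠ a i) := by
    intro k
    constructor
    · rintro ⟨j, rfl⟩
      by_cases hj : j = i
      · subst hj
        exact Or.inl (Function.update_self _ _ _)
      · rw [Function.update_of_ne hj]
        exact Or.inr ⟨⟨j, rfl⟩, fun h' => hj (h.strictMono.injective h')⟩
    · rintro (rfl | ⟨⟨j, rfl⟩, hj⟩)
      · exact ⟨i, Function.update_self _ _ _⟩
      · exact ⟨j, Function.update_of_ne (by rintro rfl; exact hj rfl) _ _⟩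
  obtain ⟨b, hb, hr⟩ := exists_strictMono_range hinj
  have hmem' : ∀ k, k ∈ Set.range b ↔ k = t ∨ (k ∈ Set.range a ∧ k ≠ a i) := by
    intro k
    rw [hr, hmem]
  refine ⟨b, ⟨hb, fun j => ?_, fun k => ?_⟩, hmem', ?_⟩
  · rcases (hmem' (b j)).mp ⟨j, rfl⟩ with h1 | ⟨⟨k, h1⟩, _⟩
    · rw [h1]
      exact htN
    · rw [← h1]
      exact h.lt k
  · rw [Maya.mem_move, h.mem_iff, hmem']
    have h1 := h.lt i
    have h2 : t ≠ a i := fun h' => hta ⟨i, h'.symm⟩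
    constructor
    · rintro ⟨(h3 | h3) | h3, h4⟩
      · exact Or.inl (Or.inr ⟨h3, h4⟩)
      · exact Or.inr h3
      · exact Or.inl (Or.inl h3)
    · rintro ((h3 | ⟨h3, h4⟩) | h3)
      · exact ⟨Or.inr h3, by rw [h3]; exact h2⟩
      · exact ⟨Or.inl (Or.inl h3), h4⟩
      · exact ⟨Or.inl (Or.inr h3), by omega⟩
  · have e : ∀ f : Fin N → ℤ, Function.Injective f →
        ∑ j, f j = ∑ᶠ k ∈ Set.range f, k := fun f hf => by
      rw [finsum_mem_range hf, finsum_eq_sum_of_fintype]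
    rw [e b hb.injective, hr, ← e _ hinj, Finset.sum_update_of_mem (Finset.mem_univ i),
      Finset.sdiff_singleton_eq_erase,
      ← Finset.add_sum_erase Finset.univ a (Finset.mem_univ i)]
    ring

/-! ### The operators `H_n` on Maya diagrams -/

theorem Maya.finite_left (u : Maya) (p : ℤ) : {k | k ∈ u.black ∧ k < p}.Finite := by
  obtain ⟨a, ha⟩ := u.left_white
  refine (Set.finite_Ico a p).subset fun k hk => ⟨?_, hk.2⟩
  by_contra h
  exact ha k (not_le.mp h) hk.1

open Classical in
theorem Maya.countLeft_of_lt (u : Maya) {p p' : ℤ} (h : p < p') :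
    u.countLeft p' = u.countLeft p + (if p ∈ u.black then 1 else 0) + between u.black p p' := by
  have e : {k | k ∈ u.black ∧ k < p'} = ({k | k ∈ u.black ∧ k < p} ∪ {k | k ∈ u.black ∧ k = p}) ∪
      (((Finset.Ioo (min p p') (max p p')).filter (· ∈ u.black) : Finset ℤ) : Set ℤ) := by
    ext k
    simp only [Set.mem_ofPred_eq, Set.mem_union, Finset.coe_filter, Finset.mem_Ioo,
      min_eq_left h.le, max_eq_right h.le]
    by_cases hk : k ∈ u.black <;> simp only [hk] <;> grind
  have hf := u.finite_left p
  have hf2 : {k | k ∈ u.black ∧ k = p}.Finite :=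
    (Set.finite_singleton p).subset fun k hk => hk.2
  have hd1 : Disjoint {k | k ∈ u.black ∧ k < p} {k | k ∈ u.black ∧ k = p} := by
    rw [Set.disjoint_left]
    rintro k ⟨_, hk⟩ ⟨_, hk'⟩
    omega
  rw [Maya.countLeft, e, Set.ncard_union_eq _ (hf.union hf2) (Finset.finite_toSet _),
    Set.ncard_union_eq hd1 hf hf2, Set.ncard_coe_finset]
  · congr 2
    split_ifs with hp
    · have : {k | k ∈ u.black ∧ k = p} = {p} := by
        ext k
        simp only [Set.mem_ofPred_eq, Set.mem_singleton_iff]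
        exact ⟨fun h => h.2, fun h => ⟨h ▸ hp, h⟩⟩
      rw [this, Set.ncard_singleton]
    · have : {k | k ∈ u.black ∧ k = p} = ∅ := by
        ext k
        simp only [Set.mem_ofPred_eq, Set.mem_empty_iff_false, iff_false]
        rintro ⟨h1, rfl⟩
        exact hp h1
      rw [this, Set.ncard_empty]
  · rw [Set.disjoint_left]
    rintro k (⟨_, hk⟩ | ⟨_, hk⟩) hk'
    all_goals
      simp only [Finset.coe_filter, Finset.mem_Ioo, Set.mem_ofPred_eq, min_eq_left h.le] at hk'
      omega

section

variable (R : Type) [CommRing R]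

open Classical in
/-- The result of moving the stone at `s` to `t`, with the sign that it has in `H_{t-s} |u⟩`. -/
def hop (u : Maya) (s t : ℤ) : Fock R :=
  if s ∈ u.black ∧ t ∉ u.black then (-(-1 : R) ^ between u.black s t) • (u.move s t).ket R else 0

/-- For `s < t` the stone inserted at `t` does not affect the sign with which the stone at `s` is
removed, and for `t < s` it does. In both cases the signs combine to that of `hop`. -/
theorem psi_psiStar_ket (u : Maya) {s t : ℤ} (hst : s ≠ t) :
    (psi R (-1 - s) * psiStar R t) (u.ket R) = hop R u s t := by
  classical
  rw [Module.End.mul_apply]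
  by_cases ht : t ∈ u.black
  · rw [hop, if_neg (fun h => h.2 ht)]
    simp [psiStar, Maya.ket, ht]
  rw [psiStar_ket R t u ht, map_smul]
  have hs' : -1 - (-1 - s) = s := by ring
  by_cases hs : s ∈ u.black
  · have hsi : s ∈ (u.insert t).black := Or.inl hs
    rw [psi_ket R _ _ (by rw [hs']; exact hsi), hs', smul_smul, ← pow_add, hop, if_pos ⟨hs, ht⟩]
    congr 1
    have hbt : between (u.insert t).black s t = between u.black s t := by
      refine between_congr fun k h1 h2 => ?_
      have : k ≠ t := by
        rintro rfl
        rcases le_total s k with h | h <;> simp_all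
      change k ∈ u.black ∨ k = t ↔ _
      simp [this]
    have hti : t ∈ (u.insert t).black := Or.inr rfl
    rcases lt_or_gt_of_ne hst with h | h
    · have e : (u.insert t).countLeft s = u.countLeft s := by
        unfold Maya.countLeft
        congr 1
        ext k
        change (k ∈ u.black ∨ k = t) ∧ k < s ↔ k ∈ u.black ∧ k < s
        constructor
        · rintro ⟨h1 | h1, h2⟩
          · exact ⟨h1, h2⟩
          · omega
        · rintro ⟨h1, h2⟩
          exact ⟨Or.inl h1, h2⟩
      rw [u.countLeft_of_lt h, e, if_pos hs, show u.countLeft s + 1 + between u.black s t +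
        u.countLeft s = 2 * u.countLeft s + between u.black s t + 1 by ring, pow_succ, pow_add,
        pow_mul]
      simp
    · have e : (u.insert t).countLeft t = u.countLeft t := by
        unfold Maya.countLeft
        congr 1
        ext k
        change (k ∈ u.black ∨ k = t) ∧ k < t ↔ k ∈ u.black ∧ k < t
        constructor
        · rintro ⟨h1 | h1, h2⟩
          · exact ⟨h1, h2⟩
          · omega
        · rintro ⟨h1, h2⟩
          exact ⟨Or.inl h1, h2⟩
      rw [(u.insert t).countLeft_of_lt h, e, if_pos hti, between_comm, hbt,
        show u.countLeft t + (u.countLeft t + 1 + between u.black s t) =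
        2 * u.countLeft t + between u.black s t + 1 by ring, pow_succ, pow_add, pow_mul]
      simp
  · have hsi : s ∉ (u.insert t).black := by
      rintro (h | h)
      · exact hs h
      · exact hst h
    rw [hop, if_neg (fun h => hs h.1)]
    simp [psi, Maya.ket, hs', hsi]

theorem hop_apply_self (u : Maya) (s t : ℤ) : hop R u s t u = 0 := by
  classical
  rw [hop]
  split_ifs with h
  · have : u.move s t ≠ u := by
      intro h'
      have := h.1
      rw [← h', Maya.mem_move] at this
      exact this.2 rfl
    rw [Finsupp.smul_apply, Maya.ket, Finsupp.single_eq_of_ne this.symm, smul_zero]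
  · rfl

/-- For `n ≠ 0` the vacuum expectation value that normal ordering subtracts is zero. -/
theorem normalOrdered_ket (u : Maya) {n : ℤ} (hn : n ≠ 0) (s : ℤ) :
    normalOrdered R (-1 - s) (s + n) (u.ket R) = hop R u s (s + n) := by
  have hs : s ≠ s + n := by omega
  rw [normalOrdered, psi_psiStar_ket R _ hs]
  simp only [LinearMap.sub_apply, psi_psiStar_ket R _ hs, braVac,
    Finsupp.lapply_apply, hop_apply_self, zero_smul]
  exact sub_zero _

theorem locSum_ket {R : Type} [CommRing R] {ι : Type} (A : ι → Module.End R (Fock R)) (u : Maya) :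
    locSum A (u.ket R) = ∑ᶠ i, A i (u.ket R) := by
  rw [locSum, Maya.ket, Finsupp.linearCombination_single, one_smul]
  rfl

theorem H_ket (u : Maya) {n : ℤ} (hn : n ≠ 0) : H R n (u.ket R) = ∑ᶠ s, hop R u s (s + n) := by
  rw [H, locSum_ket]
  exact finsum_congr fun s => normalOrdered_ket R u hn s

theorem finite_hop (u : Maya) (n : ℤ) :
    (Function.support fun s => hop R u s (s + n)).Finite := by
  classical
  obtain ⟨b, hb⟩ := u.right_black
  refine (u.finite_left (b - n)).subset fun s hs => ?_
  rw [Function.mem_support, hop] at hs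
  split_ifs at hs with h
  · refine ⟨h.1, ?_⟩
    by_contra h'
    exact h.2 (hb _ (by omega))
  · exact absurd rfl hs

/-- `H_n |u⟩` in terms of the stones in a window that contains all the movable ones. -/
theorem H_ket_of_window {u : Maya} {N : ℕ} {a : Fin N → ℤ} (h : IsWindow u a) {n : ℤ}
    (hn : n ≠ 0) (hN : ∀ s, (N : ℤ) ≤ s → s + n ∈ u.black) :
    H R n (u.ket R) = ∑ i, hop R u (a i) (a i + n) := by
  classical
  rw [H_ket R u hn]
  have hsub : Function.support (fun s => hop R u s (s + n)) ⊆
      ((Finset.univ.image a : Finset ℤ) : Set ℤ) := by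
    intro s hs
    rw [Function.mem_support, hop] at hs
    split_ifs at hs with h'
    · rcases (h.mem_iff s).mp h'.1 with ⟨i, rfl⟩ | h1
      · simp
      · exact absurd (hN s h1) h'.2
    · exact absurd rfl hs
  rw [finsum_eq_sum_of_support_subset _ hsub, Finset.sum_image fun i _ j _ hij =>
    h.strictMono.injective hij]

theorem H_ket_of_pos {u : Maya} {N : ℕ} {a : Fin N → ℤ} (h : IsWindow u a) {n : ℤ}
    (hn : 0 < n) : H R n (u.ket R) = ∑ i, hop R u (a i) (a i + n) :=
  H_ket_of_window R h hn.ne' fun s hs => (h.mem_iff _).mpr (Or.inr (by omega))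

theorem hop_mem {u : Maya} {s t : ℤ} (G : AddSubgroup (Fock R))
    (hG : s ∈ u.black → t ∉ u.black → (u.move s t).ket R ∈ G) : hop R u s t ∈ G := by
  classical
  rw [hop]
  split_ifs with h
  · have := hG h.1 h.2
    rcases neg_one_pow_eq_or R (between u.black s t) with e | e <;> rw [e]
    · simpa using this
    · simpa using this
  · exact G.zero_mem

/-- `H_n` lowers the number of boxes by `n`. -/
theorem H_ket_mem (lam : YoungDiagram) {n : ℤ} (hn : n ≠ 0) (G : AddSubgroup (Fock R))
    (hG : ∀ mu : YoungDiagram, (mu.card : ℤ) + n = lam.card → (Maya.ofYoung mu).ket R ∈ G) :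
    H R n ((Maya.ofYoung lam).ket R) ∈ G := by
  have hN : lam.rowLen 0 ≤ lam.rowLen 0 + n.natAbs := Nat.le_add_right _ _
  have h := isWindow_ofYoung lam hN
  rw [H_ket_of_window R h hn]
  · refine G.sum_mem fun i _ => hop_mem R G fun hs ht => ?_
    obtain ⟨b, hb, _, hsum⟩ := h.exists_move i ht
    obtain ⟨mu, hmu, hmuN, hbmu⟩ := hb.exists_young
    rw [hmu]
    refine hG mu ?_
    rw [card_eq_sum_colWindow lam hN, card_eq_sum_colWindow mu hmuN, ← hbmu,
      Finset.sum_sub_distrib, Finset.sum_sub_distrib, hsum]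
    ring
  · intro s hs
    rw [(isWindow_ofYoung lam le_rfl).mem_iff]
    right
    rw [Nat.cast_add] at hs
    omega

end

/-! ### The vacuum expectation value of `e^{H(x)}` -/

section LowSpan

variable {R : Type} [CommRing R]

variable (R) in
/-- The span of the Maya diagrams of the Young diagrams with less than `m` boxes. On these spaces
the locally finite sums and exponentials of operators that remove boxes are finite sums. -/
def lowSpan (𝕜 : Type) [CommRing 𝕜] [Algebra 𝕜 R] (m : ℕ) : Submodule 𝕜 (Fock R) :=
  Submodule.span 𝕜 {v | ∃ mu : YoungDiagram, mu.card < m ∧ v = (Maya.ofYoung mu).ket R}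

variable {𝕜 : Type} [CommRing 𝕜] [Algebra 𝕜 R]

theorem ket_mem_lowSpan {mu : YoungDiagram} {m : ℕ} (h : mu.card < m) :
    (Maya.ofYoung mu).ket R ∈ lowSpan R 𝕜 m :=
  Submodule.subset_span ⟨mu, h, rfl⟩

theorem lowSpan_mono {m m' : ℕ} (h : m ≤ m') : lowSpan R 𝕜 m ≤ lowSpan R 𝕜 m' :=
  Submodule.span_mono fun _ ⟨mu, h1, h2⟩ => ⟨mu, h1.trans_le h, h2⟩

theorem eq_zero_of_mem_lowSpan {v : Fock R} (hv : v ∈ lowSpan R 𝕜 0) : v = 0 := by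
  have : lowSpan R 𝕜 0 = ⊥ := by
    rw [lowSpan, Submodule.span_eq_bot]
    rintro v ⟨mu, h, _⟩
    exact absurd h (Nat.not_lt_zero _)
  rw [this] at hv
  exact hv

theorem mem_lowSpan_of_ket {A : Module.End R (Fock R)} {m m' : ℕ}
    (h : ∀ mu : YoungDiagram, mu.card < m → A ((Maya.ofYoung mu).ket R) ∈ lowSpan R 𝕜 m')
    {v : Fock R} (hv : v ∈ lowSpan R 𝕜 m) : A v ∈ lowSpan R 𝕜 m' := by
  induction hv using Submodule.span_induction with
  | mem v hv =>
    obtain ⟨mu, h1, rfl⟩ := hv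
    exact h mu h1
  | zero => rw [map_zero]; exact Submodule.zero_mem _
  | add v w _ _ hv hw => rw [map_add]; exact Submodule.add_mem _ hv hw
  | smul c v _ hv => rw [LinearMap.map_smul_of_tower]; exact Submodule.smul_mem _ c hv

theorem H_mem_lowSpan {n : ℕ} (hn : 0 < n) {m : ℕ} {v : Fock R} (hv : v ∈ lowSpan R 𝕜 m) :
    H R n v ∈ lowSpan R 𝕜 (m - n) := by
  refine mem_lowSpan_of_ket (fun lam hlam => ?_) hv
  refine H_ket_mem R lam (by omega) (lowSpan R 𝕜 (m - n)).toAddSubgroup fun mu hmu => ?_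
  exact ket_mem_lowSpan (by omega)

theorem pow_mem_lowSpan {A : Module.End R (Fock R)}
    (h : ∀ (m : ℕ) (v : Fock R), v ∈ lowSpan R 𝕜 m → A v ∈ lowSpan R 𝕜 (m - 1)) {m : ℕ} {v : Fock R}
    (hv : v ∈ lowSpan R 𝕜 m) (k : ℕ) : (A ^ k) v ∈ lowSpan R 𝕜 (m - k) := by
  induction k with
  | zero => exact hv
  | succ k ih =>
    rw [pow_succ', Module.End.mul_apply, ← Nat.sub_sub]
    exact h _ _ ih

theorem pow_apply_eq_zero {A : Module.End R (Fock R)}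
    (h : ∀ (m : ℕ) (v : Fock R), v ∈ lowSpan R 𝕜 m → A v ∈ lowSpan R 𝕜 (m - 1)) {m : ℕ} {v : Fock R}
    (hv : v ∈ lowSpan R 𝕜 m) {k : ℕ} (hk : m ≤ k) : (A ^ k) v = 0 := by
  have := pow_mem_lowSpan h hv k
  rw [Nat.sub_eq_zero_of_le hk] at this
  exact eq_zero_of_mem_lowSpan this

theorem locSum_apply_of_mem_lowSpan {ι : Type} {A : ι → Module.End R (Fock R)} {m : ℕ}
    (s : Finset ι) (hs : ∀ i ∉ s, ∀ v ∈ lowSpan R 𝕜 m, A i v = 0) {v : Fock R}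
    (hv : v ∈ lowSpan R 𝕜 m) : locSum A v = ∑ i ∈ s, A i v := by
  induction hv using Submodule.span_induction with
  | mem v hv =>
    obtain ⟨mu, h1, rfl⟩ := hv
    rw [locSum_ket]
    refine finsum_eq_sum_of_support_subset _ fun i hi => ?_
    by_contra h
    exact hi (hs i h _ (ket_mem_lowSpan h1))
  | zero => simp
  | add v w _ _ hv hw => rw [map_add, hv, hw, ← Finset.sum_add_distrib]; simp
  | smul c v _ hv =>
    rw [LinearMap.map_smul_of_tower, hv, Finset.smul_sum]
    simp only [LinearMap.map_smul_of_tower]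

theorem locExp_apply_of_mem_lowSpan [Algebra ℂ R] {A : Module.End R (Fock R)}
    (h : ∀ (m : ℕ) (v : Fock R), v ∈ lowSpan R 𝕜 m → A v ∈ lowSpan R 𝕜 (m - 1)) {m : ℕ} {v : Fock R}
    (hv : v ∈ lowSpan R 𝕜 m) {K : ℕ} (hK : m ≤ K) :
    locExp A v = ∑ k ∈ Finset.range K, ((Nat.factorial k : ℂ)⁻¹) • (A ^ k) v := by
  rw [locExp, locSum_apply_of_mem_lowSpan (𝕜 := 𝕜) (m := m) (Finset.range K) _ hv]
  · rfl
  · intro k hk v hv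
    rw [LinearMap.smul_apply, pow_apply_eq_zero h hv, smul_zero]
    rw [Finset.mem_range] at hk
    omega

end LowSpan

/-- The ring `ℂ[x₁, x₂, …]`. -/
abbrev Pol : Type := MvPolynomial ℕ+ ℂ

/-- `v ↦ ⟨vac| e^{H(x)} v`. -/
def vev : Fock Pol →ₗ[Pol] Pol := braVac Pol ∘ₗ locExp Hx

theorem Hx_apply {m : ℕ} {v : Fock Pol} (hv : v ∈ lowSpan Pol Pol m) (I : Finset ℕ+)
    (hI : ∀ n : ℕ+, (n : ℕ) ≤ m → n ∈ I) :
    Hx v = ∑ n ∈ I, (X n : Pol) • H Pol (n : ℕ) v := by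
  rw [Hx, locSum_apply_of_mem_lowSpan (𝕜 := Pol) (m := m) I _ hv]
  · rfl
  · intro n hn v hv
    have h1 := H_mem_lowSpan n.pos hv
    have h2 : ¬ (n : ℕ) ≤ m := fun h => hn (hI n h)
    rw [Nat.sub_eq_zero_of_le (by omega)] at h1
    rw [LinearMap.smul_apply, eq_zero_of_mem_lowSpan h1, smul_zero]

theorem exists_finset_pnat (m : ℕ) (J : Finset ℕ+) :
    ∃ I : Finset ℕ+, J ⊆ I ∧ ∀ n : ℕ+, (n : ℕ) ≤ m → n ∈ I := by
  classical
  refine ⟨J ∪ Finset.Icc 1 m.succPNat, Finset.subset_union_left, fun n hn => ?_⟩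
  refine Finset.mem_union_right _ (Finset.mem_Icc.mpr ⟨(one_le (a := n)), ?_⟩)
  rw [← PNat.coe_le_coe, Nat.succPNat_coe]
  omega

theorem Hx_mem_lowSpan {m : ℕ} {v : Fock Pol} (hv : v ∈ lowSpan Pol Pol m) :
    Hx v ∈ lowSpan Pol Pol (m - 1) := by
  obtain ⟨I, -, hI⟩ := exists_finset_pnat m ∅
  rw [Hx_apply hv I hI]
  refine Submodule.sum_mem _ fun n _ => Submodule.smul_mem _ _ ?_
  exact lowSpan_mono (Nat.sub_le_sub_left (one_le (a := n)) m) (H_mem_lowSpan n.pos hv)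

/-- Euler's identity, for the homogeneous components of a polynomial. -/
theorem sum_X_mul_homogeneousComponent_pderiv (p : Pol) (k : ℕ) (I : Finset ℕ+)
    (hI : p.vars ⊆ I) : ∑ n ∈ I, X n * homogeneousComponent k (pderiv n p) =
      ((k + 1 : ℕ) : ℂ) • homogeneousComponent (k + 1) p := by
  classical
  ext e
  rw [coeff_sum, coeff_smul, coeff_homogeneousComponent]
  have h : ∀ n ∈ I, coeff e (X n * homogeneousComponent k (pderiv n p)) =
      if e.degree = k + 1 then coeff e p * (e n : ℂ) else 0 := by
    intro n _
    rw [coeff_X_mul']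
    by_cases hn : n ∈ e.support
    · have hle : Finsupp.single n 1 ≤ e := by
        simpa [Nat.one_le_iff_ne_zero] using hn
      obtain ⟨e', rfl⟩ := exists_add_of_le hle
      rw [if_pos hn, coeff_homogeneousComponent, add_tsub_cancel_left, map_add,
        Finsupp.degree_single, add_comm 1, coeff_pderiv, add_comm e']
      have hiff : (Finsupp.degree e' + 1 = k + 1) ↔ (Finsupp.degree e' = k) := by omega
      simp only [Finsupp.add_apply, Finsupp.single_eq_same, Nat.cast_add, Nat.cast_one,
        hiff, add_comm (Finsupp.single n 1)]
    · rw [if_neg hn]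
      simp only [Finsupp.mem_support_iff, not_not] at hn
      simp [hn]
  rw [Finset.sum_congr rfl h]
  split_ifs with hd
  · rw [← Finset.mul_sum, smul_eq_mul, mul_comm]
    by_cases hp : coeff e p = 0
    · simp [hp]
    · congr 1
      rw [← hd, ← Nat.cast_sum]
      congr 1
      rw [Finsupp.degree_apply]
      refine (Finset.sum_subset (fun n hn => hI ?_) fun n _ hn => by simpa using hn).symm
      exact (mem_vars_iff_mem_support n).mpr ⟨e, mem_support_iff.mpr hp, hn⟩
  · simp

/-- The kets of a set of Young diagrams. -/
def kets (S : Set YoungDiagram) : Set (Fock Pol) := (fun lam => (Maya.ofYoung lam).ket Pol) '' S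

open Classical in
/-- A family of polynomials whose derivatives are given by the operators `H_n` and which has the
right constant terms is `⟨vac| e^{H(x)} |u⟩`: by Euler's identity the homogeneous component of
degree `k` is the matrix element of `H(x)^k / k!`. -/
theorem eq_vev_of_pderiv (S : Set YoungDiagram) (Ψ : Maya → Pol)
    (hS : ∀ lam ∈ S, ∀ n : ℕ+, H Pol (n : ℕ) ((Maya.ofYoung lam).ket Pol) ∈
      Submodule.span ℂ (kets S))
    (hder : ∀ lam ∈ S, ∀ n : ℕ+, pderiv n (Ψ (Maya.ofYoung lam)) =
      Finsupp.linearCombination Pol Ψ (H Pol (n : ℕ) ((Maya.ofYoung lam).ket Pol)))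
    (hconst : ∀ lam ∈ S, constantCoeff (Ψ (Maya.ofYoung lam)) = if lam = ⊥ then 1 else 0) :
    ∀ lam ∈ S, Ψ (Maya.ofYoung lam) = vev ((Maya.ofYoung lam).ket Pol) := by
  classical
  let L : ℕ → Fock Pol →ₗ[Pol] Pol := fun k =>
    Finsupp.linearCombination Pol fun u => homogeneousComponent k (Ψ u)
  have hLket : ∀ k u, L k (Maya.ket Pol u) = homogeneousComponent k (Ψ u) := fun k u => by
    simp only [L, Maya.ket, Finsupp.linearCombination_single, one_smul]
  have h1 : ∀ k, ∀ v ∈ Submodule.span ℂ (kets S),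
      homogeneousComponent k (Finsupp.linearCombination Pol Ψ v) = L k v := by
    intro k v hv
    induction hv using Submodule.span_induction with
    | mem v hv =>
      obtain ⟨lam, _, rfl⟩ := hv
      simp only [hLket]
      simp only [Maya.ket, Finsupp.linearCombination_single, one_smul]
    | zero => simp
    | add v w _ _ hv hw => rw [map_add, map_add, map_add, hv, hw]
    | smul c v _ hv =>
      rw [LinearMap.map_smul_of_tower, map_smul, hv, LinearMap.map_smul_of_tower]
  have hspan : Submodule.span ℂ (kets S) ≤ (Submodule.span Pol (kets S)).restrictScalars ℂ :=
    Submodule.span_le_restrictScalars _ _ _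
  have hstep : ∀ v ∈ Submodule.span Pol (kets S), Hx v ∈ Submodule.span Pol (kets S) ∧
      ∀ k, ((k + 1 : ℕ) : ℂ) • L (k + 1) v = L k (Hx v) := by
    intro v hv
    induction hv using Submodule.span_induction with
    | mem v hv =>
      obtain ⟨lam, hlam, rfl⟩ := hv
      obtain ⟨I, hI1, hI2⟩ := exists_finset_pnat (lam.card + 1) (Ψ (Maya.ofYoung lam)).vars
      have hx := Hx_apply (ket_mem_lowSpan (R := Pol) (𝕜 := Pol) (Nat.lt_succ_self lam.card)) I hI2
      refine ⟨?_, fun k => ?_⟩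
      · simp only [hx]
        exact Submodule.sum_mem _ fun n _ => Submodule.smul_mem _ _ (hspan (hS lam hlam n))
      · simp only [hx, hLket, map_sum, map_smul]
        rw [← sum_X_mul_homogeneousComponent_pderiv _ _ I hI1]
        refine Finset.sum_congr rfl fun n _ => ?_
        rw [hder lam hlam, h1 k _ (hS lam hlam n), smul_eq_mul]
    | zero => exact ⟨by rw [map_zero]; exact Submodule.zero_mem _, fun k => by simp⟩
    | add v w _ _ hv hw =>
      refine ⟨by rw [map_add]; exact Submodule.add_mem _ hv.1 hw.1, fun k => ?_⟩
      rw [map_add, smul_add, hv.2, hw.2, map_add, map_add]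
    | smul c v _ hv =>
      refine ⟨by rw [map_smul]; exact Submodule.smul_mem _ _ hv.1, fun k => ?_⟩
      rw [map_smul, smul_comm, hv.2, map_smul, map_smul]
  have h0 : ∀ v ∈ Submodule.span Pol (kets S), L 0 v = braVac Pol v := by
    intro v hv
    induction hv using Submodule.span_induction with
    | mem v hv =>
      obtain ⟨lam, hlam, rfl⟩ := hv
      simp only [hLket]
      rw [homogeneousComponent_zero, ← constantCoeff_eq, hconst lam hlam, braVac,
        Finsupp.lapply_apply, Maya.ket, Finsupp.single_apply, ← ofYoung_bot]
      simp only [ofYoung_injective.eq_iff]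
      split_ifs <;> simp
    | zero => simp
    | add v w _ _ hv hw => rw [map_add, map_add, hv, hw]
    | smul c v _ hv => rw [map_smul, map_smul, hv]
  have hpow : ∀ k, ∀ v ∈ Submodule.span Pol (kets S),
      L k v = ((Nat.factorial k : ℂ)⁻¹) • braVac Pol ((Hx ^ k) v) := by
    intro k
    induction k with
    | zero =>
      intro v hv
      rw [h0 v hv]
      simp
    | succ k ih =>
      intro v hv
      have hk : ((k + 1 : ℕ) : ℂ) ≠ 0 := Nat.cast_ne_zero.mpr (Nat.succ_ne_zero k)
      rw [← inv_smul_smul₀ hk (L (k + 1) v), (hstep v hv).2, ih _ (hstep v hv).1, smul_smul,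
        Nat.factorial_succ, Nat.cast_mul, mul_inv, pow_succ, Module.End.mul_apply]
  intro lam hlam
  have hmem : (Maya.ofYoung lam).ket Pol ∈ Submodule.span Pol (kets S) :=
    Submodule.subset_span ⟨lam, hlam, rfl⟩
  have hl : (Maya.ofYoung lam).ket Pol ∈ lowSpan Pol Pol (lam.card + 1) :=
    ket_mem_lowSpan (Nat.lt_succ_self _)
  set p := Ψ (Maya.ofYoung lam) with hp
  have hlowH : ∀ (m : ℕ) (v : Fock Pol), v ∈ lowSpan Pol Pol m → Hx v ∈ lowSpan Pol Pol (m - 1) :=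
    fun m v hv => Hx_mem_lowSpan hv
  rw [vev, LinearMap.comp_apply,
    locExp_apply_of_mem_lowSpan hlowH hl (le_max_left _ (p.totalDegree + 1)), map_sum]
  conv_lhs => rw [← sum_homogeneousComponent p]
  rw [Finset.sum_subset (Finset.range_mono (le_max_right (lam.card + 1) (p.totalDegree + 1)))]
  · refine Finset.sum_congr rfl fun k _ => ?_
    rw [LinearMap.map_smul_of_tower, ← hpow k _ hmem, hLket]
  · intro k _ hk
    rw [Finset.mem_range] at hk
    exact homogeneousComponent_eq_zero _ _ (by omega)

/-! ### Determinantal formulas for `⟨vac| e^{H(x)} |lam⟩` -/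

/-- A linear form given on the Maya diagrams with window `N` by the determinants `shiftDet` turns
the motion of a stone into the change of an entry. -/
theorem map_hop {q : ℤ → Pol} (hq : ∀ i < 0, q i = 0) {N : ℕ} (F : Fock Pol →ₗ[Pol] Pol)
    (hF : ∀ (u : Maya) (b : Fin N → ℤ), IsWindow u b → F (u.ket Pol) = shiftDet q b)
    {u : Maya} {a : Fin N → ℤ} (h : IsWindow u a) (i : Fin N) {t : ℤ} (hti : t ≠ a i) :
    F (hop Pol u (a i) t) = -shiftDet q (Function.update a i t) := by
  classical
  have hi : a i ∈ u.black := (h.mem_iff _).mpr (Or.inl ⟨i, rfl⟩)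
  by_cases ht : t ∈ u.black
  · rw [hop, if_neg (fun h' => h'.2 ht), map_zero, zero_eq_neg]
    rcases (h.mem_iff t).mp ht with ⟨j, rfl⟩ | htN
    · refine shiftDet_eq_zero q fun hinj => hti ?_
      have hji : j ≠ i := by
        rintro rfl
        exact hti rfl
      exact absurd (hinj (a₁ := j) (a₂ := i) (by
        rw [Function.update_self, Function.update_of_ne hji])) hji
    · exact shiftDet_of_ge q hq (i := i) (by rwa [Function.update_self])
  · obtain ⟨b, hb, hbr, _⟩ := h.exists_move i ht
    have hta : t ∉ Set.range a := fun h' => ht ((h.mem_iff t).mpr (Or.inl h'))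
    have htN : t < N := by
      by_contra h'
      exact ht ((h.mem_iff t).mpr (Or.inr (not_lt.mp h')))
    rw [hop, if_pos ⟨hi, ht⟩, map_smul, hF _ b hb,
      shiftDet_update q h.strictMono hb.strictMono i hta hbr, smul_eq_mul, neg_mul]
    congr 3
    refine between_congr fun k _ hk => ?_
    have := h.lt i
    have hkN : k < N := hk.trans (max_lt this htN)
    rw [h.mem_iff]
    constructor
    · rintro (h1 | h1)
      · exact h1
      · omega
    · exact Or.inl

open Classical in
/-- The determinant `shiftDet` at the window `N` of a Maya diagram. -/
def windowDet (q : ℤ → Pol) (N : ℕ) (u : Maya) : Pol :=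
  if h : ∃ a : Fin N → ℤ, IsWindow u a then shiftDet q h.choose else 0

theorem windowDet_eq (q : ℤ → Pol) {N : ℕ} {u : Maya} {a : Fin N → ℤ} (h : IsWindow u a) :
    windowDet q N u = shiftDet q a := by
  have hex : ∃ a : Fin N → ℤ, IsWindow u a := ⟨a, h⟩
  rw [windowDet, dif_pos hex, hex.choose_spec.unique h]

theorem linearCombination_windowDet (q : ℤ → Pol) {N : ℕ} (u : Maya) (b : Fin N → ℤ)
    (h : IsWindow u b) :
    Finsupp.linearCombination Pol (windowDet q N) (u.ket Pol) = shiftDet q b := by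
  rw [Maya.ket, Finsupp.linearCombination_single, one_smul, windowDet_eq q h]

theorem colWindow_eq_iff {lam : YoungDiagram} {N : ℕ} (hN : lam.rowLen 0 ≤ N) :
    (∀ i : Fin N, colWindow lam N i = (i : ℤ)) ↔ lam = ⊥ := by
  have h0 : ∀ j, (⊥ : YoungDiagram).colLen j = 0 := fun j => by
    by_contra h
    exact YoungDiagram.notMem_bot (0, j)
      (YoungDiagram.mem_iff_lt_colLen.mpr (Nat.pos_of_ne_zero h))
  constructor
  · intro h
    refine eq_of_colLen fun j => ?_
    rw [h0]
    by_cases hj : j < N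
    · have := h ⟨j, hj⟩
      simp only [colWindow] at this
      omega
    · exact colLen_eq_zero_iff.mpr (by omega)
  · rintro rfl i
    simp [colWindow, h0]

/-- The dual Jacobi–Trudi formula: `⟨vac| e^{H(x)} |u⟩` is a determinant in the signed elementary
symmetric polynomials. -/
theorem vev_of_window {N : ℕ} (u : Maya) (b : Fin N → ℤ) (h : IsWindow u b) :
    vev (u.ket Pol) = shiftDet signedE b := by
  classical
  obtain ⟨lam, rfl, hlam, rfl⟩ := h.exists_young
  have key := eq_vev_of_pderiv {lam | lam.rowLen 0 ≤ N} (windowDet signedE N) ?_ ?_ ?_ lam hlam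
  · rw [← key, windowDet_eq signedE h]
  · intro mu hmu n
    have hw := isWindow_ofYoung mu hmu
    rw [H_ket_of_pos Pol hw (by exact_mod_cast n.pos)]
    refine Submodule.sum_mem _ fun i _ =>
      hop_mem Pol (Submodule.span ℂ (kets _)).toAddSubgroup fun _ ht => ?_
    obtain ⟨b, hb, -, -⟩ := hw.exists_move i ht
    obtain ⟨nu, hnu, hnuN, -⟩ := hb.exists_young
    rw [hnu]
    exact Submodule.subset_span ⟨nu, hnuN, rfl⟩
  · intro mu hmu n
    have hw := isWindow_ofYoung mu hmu
    have := n.pos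
    rw [H_ket_of_pos Pol hw (by exact_mod_cast n.pos), windowDet_eq signedE hw,
      pderiv_shiftDet_signedE, map_sum, ← Finset.sum_neg_distrib]
    refine Finset.sum_congr rfl fun i _ => ?_
    rw [map_hop (fun _ => signedE_of_neg) _ (linearCombination_windowDet signedE) hw i (by omega)]
  · intro mu hmu
    have hw := isWindow_ofYoung mu hmu
    rw [windowDet_eq signedE hw,
      constantCoeff_shiftDet_of_strictMono constantCoeff_signedE hw.strictMono]
    simp only [colWindow_eq_iff hmu]

theorem vev_ofYoung {lam : YoungDiagram} {N : ℕ} (hN : lam.rowLen 0 ≤ N) :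
    vev ((Maya.ofYoung lam).ket Pol) = shiftDet signedE (colWindow lam N) :=
  vev_of_window _ _ (isWindow_ofYoung lam hN)

/-- Under the Boson-Fermion correspondence `H_{-n}` is multiplication by `n x_n`. -/
theorem vev_H_neg (lam : YoungDiagram) (n : ℕ+) :
    vev (H Pol (-(n : ℕ)) ((Maya.ofYoung lam).ket Pol)) =
      C ((n : ℕ) : ℂ) * X n * vev ((Maya.ofYoung lam).ket Pol) := by
  have hn := n.pos
  have hN : lam.rowLen 0 ≤ lam.rowLen 0 + n := Nat.le_add_right _ _
  have hw := isWindow_ofYoung lam hN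
  have htop : ∀ v : ℤ, (lam.rowLen 0 : ℤ) ≤ v → v ∈ (Maya.ofYoung lam).black := fun v hv =>
    ((isWindow_ofYoung lam le_rfl).mem_iff v).mpr (Or.inr hv)
  rw [H_ket_of_window Pol hw (by omega) (fun s hs => htop _ (by rw [Nat.cast_add] at hs; omega)),
    map_sum, vev_of_window _ _ hw, mul_shiftDet_signedE n _ hw.lt, ← Finset.sum_neg_distrib]
  · refine Finset.sum_congr rfl fun i _ => ?_
    rw [map_hop (fun _ => signedE_of_neg) _ vev_of_window hw i (by omega), ← sub_eq_add_neg]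
  · intro _ v hv1 hv2
    rw [hw.range_eq]
    exact ⟨htop v (by rw [Nat.cast_add] at hv1; omega), hv2⟩

theorem exists_young_move (lam : YoungDiagram) {s t : ℤ} (hs : s ∈ (Maya.ofYoung lam).black)
    (ht : t ∉ (Maya.ofYoung lam).black) : ∃ mu : YoungDiagram,
      (Maya.ofYoung lam).move s t = Maya.ofYoung mu ∧ (mu.card : ℤ) + (t - s) = lam.card := by
  have hN : lam.rowLen 0 ≤ lam.rowLen 0 + (s.toNat + 1) := Nat.le_add_right _ _
  have h := isWindow_ofYoung lam hN
  rcases (h.mem_iff s).mp hs with ⟨i, hi⟩ | h'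
  · have hmv := h.exists_move i ht
    rw [hi] at hmv
    obtain ⟨b, hb, _, hsum⟩ := hmv
    obtain ⟨mu, hmu, hmuN, hbmu⟩ := hb.exists_young
    refine ⟨mu, hmu, ?_⟩
    rw [card_eq_sum_colWindow lam hN, card_eq_sum_colWindow mu hmuN, ← hbmu,
      Finset.sum_sub_distrib, Finset.sum_sub_distrib, hsum]
    ring
  · omega

/-- The conjugate Maya diagram: reflection combined with the exchange of black and white. -/
def Maya.conj (u : Maya) : Maya where
  black := {k | -1 - k ∉ u.black}
  left_white := by
    obtain ⟨b, hb⟩ := u.right_black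
    exact ⟨-b, fun k hk h => h (hb _ (by omega))⟩
  right_black := by
    obtain ⟨a, ha⟩ := u.left_white
    exact ⟨-a, fun k hk => ha _ (by omega)⟩

theorem Maya.mem_conj {u : Maya} {k : ℤ} : k ∈ u.conj.black ↔ -1 - k ∉ u.black := Iff.rfl

theorem conj_ofYoung (lam : YoungDiagram) :
    (Maya.ofYoung lam).conj = Maya.ofYoung lam.transpose := by
  have hmem : ∀ i j : ℕ, j < lam.rowLen i ↔ i < lam.colLen j := fun i j => by
    rw [← YoungDiagram.mem_iff_lt_rowLen, ← YoungDiagram.mem_iff_lt_colLen]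
  ext k
  rw [Maya.mem_conj]
  constructor
  · intro hk
    have hex : ∃ j : ℕ, k ≤ (j : ℤ) - lam.rowLen j := by
      refine ⟨k.toNat + lam.rowLen 0, ?_⟩
      have := lam.rowLen_anti 0 (k.toNat + lam.rowLen 0) (Nat.zero_le _)
      push_cast
      omega
    classical
    have hj := Nat.find_spec hex
    have hj' := fun i => Nat.find_min hex (m := i)
    set j := Nat.find hex
    refine ⟨j, ?_⟩
    by_contra hne
    simp only [YoungDiagram.colLen_transpose] at hne
    refine hk ⟨((j : ℤ) - 1 - k).toNat, ?_⟩
    have h1 := hmem j ((j : ℤ) - 1 - k).toNat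
    have h2 := hmem (j - 1) ((j : ℤ) - 1 - k).toNat
    simp only
    rcases Nat.eq_zero_or_pos j with h0 | h0
    · omega
    · have h3 := hj' (j - 1) (by omega)
      omega
  · rintro ⟨j, rfl⟩ ⟨i, hi⟩
    have := hmem j i
    simp only [YoungDiagram.colLen_transpose] at hi
    omega

theorem Maya.conj_move (u : Maya) {s t : ℤ} (hst : s ≠ t) :
    (u.move s t).conj = u.conj.move (-1 - t) (-1 - s) := by
  ext k
  rw [Maya.mem_conj, Maya.mem_move, Maya.mem_move, Maya.mem_conj]
  have e1 : -1 - k = t ↔ k = -1 - t := by omega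
  have e2 : -1 - k = s ↔ k = -1 - s := by omega
  have e3 : k = -1 - s → k ≠ -1 - t := by omega
  rw [e1, Ne, e2]
  tauto

theorem between_conj (u : Maya) {s t : ℤ} (hst : s < t) :
    ((between u.black s t + between u.conj.black (-1 - t) (-1 - s) : ℕ) : ℤ) = t - s - 1 := by
  classical
  have e : (Finset.Ioo (min (-1 - t) (-1 - s)) (max (-1 - t) (-1 - s))).filter
      (· ∈ u.conj.black) =
      ((Finset.Ioo (min s t) (max s t)).filter (¬ · ∈ u.black)).image fun k => -1 - k := by
    ext k
    simp only [Finset.mem_filter, Finset.mem_Ioo, Finset.mem_image, Maya.mem_conj,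
      min_eq_left hst.le, max_eq_right hst.le,
      min_eq_left (show -1 - t ≤ -1 - s by omega), max_eq_right (show -1 - t ≤ -1 - s by omega)]
    constructor
    · rintro ⟨⟨h1, h2⟩, h3⟩
      exact ⟨-1 - k, ⟨⟨by omega, by omega⟩, h3⟩, by omega⟩
    · rintro ⟨k, ⟨⟨h1, h2⟩, h3⟩, rfl⟩
      refine ⟨⟨by omega, by omega⟩, ?_⟩
      rwa [show -1 - (-1 - k) = k by ring]
  have h2 : between u.conj.black (-1 - t) (-1 - s) =
      ((Finset.Ioo (min s t) (max s t)).filter (¬ · ∈ u.black)).card := by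
    rw [← Finset.card_image_of_injective _ (f := fun k : ℤ => -1 - k) (fun a b h => by
      simp only at h
      omega), ← e]
    unfold between
    congr!
  have h1 : between u.black s t = ((Finset.Ioo (min s t) (max s t)).filter (· ∈ u.black)).card := by
    unfold between
    congr!
  rw [h1, h2, Finset.card_filter_add_card_filter_not, Int.card_Ioo, min_eq_left hst.le,
    max_eq_right hst.le]
  omega

open Classical in
/-- The polynomial of `lam`, as a function of its Maya diagram, in terms of the rows. -/
def rowDet (N : ℕ) (u : Maya) : Pol :=
  if h : ∃ lam, u = Maya.ofYoung lam then
    (-1) ^ h.choose.card * windowDet completePInt N u.conj else 0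

theorem rowDet_ofYoung (N : ℕ) (lam : YoungDiagram) : rowDet N (Maya.ofYoung lam) =
    (-1) ^ lam.card * windowDet completePInt N (Maya.ofYoung lam).conj := by
  have hex : ∃ mu, Maya.ofYoung lam = Maya.ofYoung mu := ⟨lam, rfl⟩
  rw [rowDet, dif_pos hex, ofYoung_injective hex.choose_spec.symm]

/-- Conjugation replaces the move of a stone from `s` to `t` by that from `-1 - t` to `-1 - s`, and
the stones passed on the way by the empty positions passed. -/
theorem linearCombination_rowDet_hop (N : ℕ) (lam : YoungDiagram) {s t : ℤ} (hst : s < t) :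
    Finsupp.linearCombination Pol (rowDet N) (hop Pol (Maya.ofYoung lam) s t) =
      -(-1) ^ lam.card * Finsupp.linearCombination Pol (windowDet completePInt N)
        (hop Pol (Maya.ofYoung lam).conj (-1 - t) (-1 - s)) := by
  classical
  by_cases h : s ∈ (Maya.ofYoung lam).black ∧ t ∉ (Maya.ofYoung lam).black
  · obtain ⟨mu, hmu, hcard⟩ := exists_young_move lam h.1 h.2
    have h' : -1 - t ∈ (Maya.ofYoung lam).conj.black ∧
        -1 - s ∉ (Maya.ofYoung lam).conj.black := by
      rw [Maya.mem_conj, Maya.mem_conj, show -1 - (-1 - t) = t by ring,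
        show -1 - (-1 - s) = s by ring, not_not]
      exact ⟨h.2, h.1⟩
    have hbt := between_conj (Maya.ofYoung lam) hst
    rw [hop, hop, if_pos h, if_pos h', map_smul, map_smul, Maya.ket, Maya.ket,
      Finsupp.linearCombination_single, Finsupp.linearCombination_single, one_smul, one_smul, hmu,
      rowDet_ofYoung, ← hmu, Maya.conj_move _ hst.ne, smul_eq_mul, smul_eq_mul, ← mul_assoc,
      ← mul_assoc]
    congr 1
    rw [neg_mul, ← pow_add, neg_mul_neg, ← pow_add]
    -- the `t - s - 1` positions between `s` and `t` are black or white, and the move removes `t -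
    -- s` boxes, so that the two signs are opposite
    have e : lam.card + between (Maya.ofYoung lam).conj.black (-1 - t) (-1 - s) +
        2 * (between (Maya.ofYoung lam).black s t) + 1 =
        between (Maya.ofYoung lam).black s t + mu.card + 2 * (t - s).toNat := by omega
    have e2 : (-1 : Pol) ^ (lam.card + between (Maya.ofYoung lam).conj.black (-1 - t) (-1 - s) +
        2 * (between (Maya.ofYoung lam).black s t) + 1) =
        (-1) ^ (between (Maya.ofYoung lam).black s t + mu.card + 2 * (t - s).toNat) := by rw [e]
    rw [pow_succ, pow_add _ _ (2 * _), pow_mul, pow_add _ _ (2 * _), pow_mul (-1 : Pol) 2] at e2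
    simp only [neg_one_sq, one_pow, mul_one, mul_neg] at e2
    rw [← e2, neg_neg]
  · have h' : ¬ (-1 - t ∈ (Maya.ofYoung lam).conj.black ∧
        -1 - s ∉ (Maya.ofYoung lam).conj.black) := by
      rw [Maya.mem_conj, Maya.mem_conj, show -1 - (-1 - t) = t by ring,
        show -1 - (-1 - s) = s by ring, not_not]
      exact fun h' => h ⟨h'.2, h'.1⟩
    rw [hop, hop, if_neg h, if_neg h', map_zero, map_zero, mul_zero]

theorem linearCombination_rowDet_H (N : ℕ) (lam : YoungDiagram) (n : ℕ+) :
    Finsupp.linearCombination Pol (rowDet N) (H Pol (n : ℕ) ((Maya.ofYoung lam).ket Pol)) =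
      -(-1) ^ lam.card * Finsupp.linearCombination Pol (windowDet completePInt N)
        (H Pol (n : ℕ) ((Maya.ofYoung lam).conj.ket Pol)) := by
  have hn := n.pos
  have hn0 : ((n : ℕ) : ℤ) ≠ 0 := by omega
  have hfin := finite_hop Pol (Maya.ofYoung lam).conj ((n : ℕ) : ℤ)
  let e : ℤ ≃ ℤ :=
    { toFun := fun s => -1 - (s + (n : ℕ))
      invFun := fun s => -1 - (s + (n : ℕ))
      left_inv := fun s => by ring
      right_inv := fun s => by ring }
  rw [H_ket Pol _ hn0, H_ket Pol _ hn0, ← finsum_comp_equiv e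
    (f := fun s => hop Pol (Maya.ofYoung lam).conj s (s + ((n : ℕ) : ℤ)))]
  have hfin' : (Function.support fun s => hop Pol (Maya.ofYoung lam).conj (e s)
      (e s + ((n : ℕ) : ℤ))).Finite := by
    have := hfin.preimage (e.injective.injOn)
    exact this
  rw [map_finsum _ (finite_hop Pol _ _), map_finsum _ hfin', mul_finsum]
  refine finsum_congr fun s => ?_
  rw [linearCombination_rowDet_hop N lam (by omega)]
  congr 4
  simp only [e, Equiv.coe_fn_mk]
  ring

/-- The Jacobi–Trudi formula: `⟨vac| e^{H(x)} |u⟩` is, up to sign, a determinant in the complete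
symmetric polynomials. -/
theorem vev_ofYoung_eq_rows (lam : YoungDiagram) {N : ℕ} (hN : lam.colLen 0 ≤ N) :
    vev ((Maya.ofYoung lam).ket Pol) =
      (-1) ^ lam.card * shiftDet completePInt (colWindow lam.transpose N) := by
  classical
  have hw : ∀ mu : YoungDiagram, mu.colLen 0 ≤ N →
      IsWindow (Maya.ofYoung mu).conj (colWindow mu.transpose N) := fun mu hmu => by
    rw [conj_ofYoung]
    exact isWindow_ofYoung _ (by rwa [YoungDiagram.rowLen_transpose])
  rw [← eq_vev_of_pderiv {lam | lam.colLen 0 ≤ N} (rowDet N) ?_ ?_ ?_ lam hN, rowDet_ofYoung,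
    windowDet_eq _ (hw lam hN)]
  · intro mu hmu n
    have hn := n.pos
    rw [H_ket Pol _ (by omega)]
    refine finsum_induction (p := fun v => v ∈ Submodule.span ℂ (kets {lam | lam.colLen 0 ≤ N}))
      (Submodule.zero_mem _) (fun v w hv hw => Submodule.add_mem _ hv hw) fun s => ?_
    refine hop_mem Pol (Submodule.span ℂ (kets _)).toAddSubgroup fun hs ht => ?_
    obtain ⟨nu, hnu, -⟩ := exists_young_move mu hs ht
    rw [hnu]
    refine Submodule.subset_span ⟨nu, ?_, rfl⟩
    have hge : ∀ k ∈ (Maya.ofYoung mu).black, -(N : ℤ) ≤ k := by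
      rintro _ ⟨j, rfl⟩
      have h1 := mu.colLen_anti 0 j (Nat.zero_le j)
      have h2 : mu.colLen 0 ≤ N := hmu
      simp only
      omega
    have h0 : ((0 : ℕ) : ℤ) - nu.colLen 0 ∈ (Maya.ofYoung nu).black := ⟨0, rfl⟩
    have h1 := hge s hs
    rw [← hnu, Maya.mem_move] at h0
    change nu.colLen 0 ≤ N
    rcases h0.1 with h2 | h2
    · have := hge _ h2
      omega
    · omega
  · intro mu hmu n
    have hn := n.pos
    rw [linearCombination_rowDet_H, H_ket_of_pos Pol (hw mu hmu) (by omega), rowDet_ofYoung,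
      windowDet_eq _ (hw mu hmu)]
    have hsgn : ∀ p : Pol, pderiv n ((-1) ^ mu.card * p) = (-1) ^ mu.card * pderiv n p := by
      intro p
      rcases neg_one_pow_eq_or Pol mu.card with e | e <;> rw [e] <;> simp
    rw [hsgn, pderiv_shiftDet_completePInt, map_sum, neg_mul, ← mul_neg, ← Finset.sum_neg_distrib]
    congr 1
    refine Finset.sum_congr rfl fun i _ => ?_
    rw [map_hop (fun _ => completePInt_of_neg) _ (linearCombination_windowDet completePInt)
      (hw mu hmu) i (by omega), neg_neg]
  · intro mu hmu
    rw [rowDet_ofYoung, windowDet_eq _ (hw mu hmu), map_mul,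
      constantCoeff_shiftDet_of_strictMono constantCoeff_completePInt (hw mu hmu).strictMono]
    simp only [colWindow_eq_iff (lam := mu.transpose) (N := N) (by
      rwa [YoungDiagram.rowLen_transpose])]
    have hbot : mu.transpose = ⊥ ↔ mu = ⊥ := by
      rw [YoungDiagram.transpose_eq_iff_eq_transpose]
      have : (⊥ : YoungDiagram).transpose = ⊥ := by
        ext c
        rw [YoungDiagram.mem_cells, YoungDiagram.mem_transpose, YoungDiagram.mem_cells]
        simp
      rw [this]
    rw [hbot]
    split_ifs with h
    · subst h
      simp [YoungDiagram.card]
    · rw [mul_zero]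

/-- The Boson-Fermion correspondence maps `|lam⟩` to the polynomial `P_lam`. -/
theorem vev_ketYoung (lam : YoungDiagram) : vev (ketYoung Pol lam) = polyP lam := by
  rw [ketYoung, map_smul, vev_ofYoung_eq_rows lam le_rfl, smul_eq_mul, ← mul_assoc, ← mul_pow]
  simp only [mul_neg, mul_one, neg_neg, one_pow, one_mul]
  rw [shiftDet, polyP]
  congr 1
  ext1 i j
  simp only [Matrix.of_apply, colWindow, YoungDiagram.colLen_transpose]
  congr 1
  ring

/-! ### Adding a variable to the alphabet -/

/-- Newton's recursion for the signed elementary symmetric polynomials. -/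
theorem signedE_newton (k : ℕ) : (k : Pol) * signedE k =
    -∑ m ∈ Finset.range k, ((m : Pol) + 1) * X m.succPNat * signedE ((k : ℤ) - 1 - m) := by
  cases k with
  | zero => simp
  | succ k =>
    have h := congrArg (aeval (fun m : ℕ+ => (-X m : Pol))) (completeP_succ k)
    have hs : ∀ j : ℕ, aeval (fun m : ℕ+ => (-X m : Pol)) (completeP j) = signedE j := fun j => by
      rw [signedE, completePInt, if_neg (by omega), Int.toNat_natCast]
    rw [map_mul, map_sum, hs, map_add, map_natCast, map_one] at h
    rw [Nat.cast_succ, h, ← Finset.sum_neg_distrib]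
    refine Finset.sum_congr rfl fun m hm => ?_
    rw [Finset.mem_range] at hm
    have e : (((k + 1 : ℕ) : ℤ) - 1 - m) = ((k - m : ℕ) : ℤ) := by omega
    rw [e, ← hs, map_mul, map_mul, map_add, map_natCast, map_one, aeval_X]
    ring

/-- The power series `x_n ↦ p_n / n` in the first `M` variables. -/
def toSymmFin (M : ℕ) : Pol →ₐ[ℂ] MvPowerSeries ℕ ℂ :=
  aeval fun n : ℕ+ => ((n : ℕ) : ℂ)⁻¹ • ∑ k ∈ Finset.range M, (MvPowerSeries.X k) ^ (n : ℕ)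

theorem toSymmFin_newton (M k : ℕ) : (k : MvPowerSeries ℕ ℂ) * toSymmFin M (signedE k) =
    -∑ m ∈ Finset.range k, (∑ l ∈ Finset.range M, (MvPowerSeries.X l) ^ (m + 1)) *
      toSymmFin M (signedE ((k : ℤ) - 1 - m)) := by
  have h := congrArg (toSymmFin M) (signedE_newton k)
  rw [map_mul, map_natCast, map_neg, map_sum] at h
  rw [h]
  congr 1
  refine Finset.sum_congr rfl fun m _ => ?_
  rw [map_mul, map_mul, map_add, map_natCast, map_one]
  congr 1
  rw [toSymmFin, aeval_X, Nat.succPNat_coe, Nat.succ_eq_add_one]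
  have : ((m : MvPowerSeries ℕ ℂ) + 1) = ((m + 1 : ℕ) : ℂ) • (1 : MvPowerSeries ℕ ℂ) := by
    rw [← Algebra.algebraMap_eq_smul_one, map_natCast, Nat.cast_succ]
  rw [this, smul_one_mul, smul_inv_smul₀]
  exact Nat.cast_ne_zero.mpr (Nat.succ_ne_zero m)

/-- A further variable `z` multiplies the generating function `∏_l (1 - x_l t)` of the signed
elementary symmetric polynomials by `1 - z t`. -/
theorem toSymmFin_succ_signedE (M : ℕ) (i : ℤ) : toSymmFin (M + 1) (signedE i) =
    toSymmFin M (signedE i) - MvPowerSeries.X M * toSymmFin M (signedE (i - 1)) := by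
  rcases lt_or_ge i 0 with hi | hi
  · rw [signedE_of_neg hi, signedE_of_neg (by omega)]
    simp
  obtain ⟨k, rfl⟩ := Int.eq_ofNat_of_zero_le hi
  clear hi
  induction k using Nat.strong_induction_on with
  | _ k ih =>
  cases k with
  | zero =>
    rw [signedE_of_neg (i := ((0 : ℕ) : ℤ) - 1) (by norm_num)]
    have : signedE ((0 : ℕ) : ℤ) = 1 := by
      rw [signedE, completePInt, if_neg (by norm_num)]
      simp [completeP_zero]
    rw [this]
    simp
  | succ k =>
    have : CharZero (MvPowerSeries ℕ ℂ) :=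
      charZero_of_injective_algebraMap (algebraMap ℂ (MvPowerSeries ℕ ℂ)).injective
    have hk : ((k + 1 : ℕ) : MvPowerSeries ℕ ℂ) ≠ 0 := Nat.cast_ne_zero.mpr (Nat.succ_ne_zero k)
    refine mul_left_cancel₀ hk ?_
    set z : MvPowerSeries ℕ ℂ := MvPowerSeries.X M with hz
    let f : ℤ → MvPowerSeries ℕ ℂ := fun i => toSymmFin M (signedE i)
    have hfneg : ∀ i < 0, f i = 0 := fun i hi => by simp only [f, signedE_of_neg hi, map_zero]
    rw [toSymmFin_newton, mul_sub, toSymmFin_newton]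
    -- the powers of the new variable `z` telescope in the sum over `m`
    have e1 : ∀ m ∈ Finset.range (k + 1),
        (∑ l ∈ Finset.range (M + 1), (MvPowerSeries.X l : MvPowerSeries ℕ ℂ) ^ (m + 1)) *
          toSymmFin (M + 1) (signedE (((k + 1 : ℕ) : ℤ) - 1 - m)) =
        (∑ l ∈ Finset.range M, (MvPowerSeries.X l : MvPowerSeries ℕ ℂ) ^ (m + 1)) *
          f (((k + 1 : ℕ) : ℤ) - 1 - m) -
        z * ((∑ l ∈ Finset.range M, (MvPowerSeries.X l : MvPowerSeries ℕ ℂ) ^ (m + 1)) *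
          f ((k : ℤ) - 1 - m)) +
        (z ^ (m + 1) * f ((k : ℤ) - m) - z ^ (m + 1 + 1) * f ((k : ℤ) - (m + 1 : ℕ))) := by
      intro m hm
      rw [Finset.mem_range] at hm
      have e : ((k + 1 : ℕ) : ℤ) - 1 - m = ((k - m : ℕ) : ℤ) := by omega
      have e' : ((k - m : ℕ) : ℤ) - 1 = (k : ℤ) - 1 - m := by omega
      have e'' : (k : ℤ) - (m + 1 : ℕ) = (k : ℤ) - 1 - m := by push_cast; ring
      have e3 : (k : ℤ) - m = ((k - m : ℕ) : ℤ) := by omega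
      rw [e, ih (k - m) (by omega), Finset.sum_range_succ, e', e'', e3]
      simp only [f]
      ring
    rw [Finset.sum_congr rfl e1, Finset.sum_add_distrib, Finset.sum_sub_distrib, ← Finset.mul_sum,
      Finset.sum_range_sub' (fun m => z ^ (m + 1) * f ((k : ℤ) - m)),
      hfneg ((k : ℤ) - (k + 1 : ℕ)) (by push_cast; omega), Finset.sum_range_succ (fun m =>
        (∑ l ∈ Finset.range M, (MvPowerSeries.X l : MvPowerSeries ℕ ℂ) ^ (m + 1)) *
          f ((k : ℤ) - 1 - m)), hfneg ((k : ℤ) - 1 - k) (by omega)]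
    have hn := toSymmFin_newton M k
    have e2 : ((k + 1 : ℕ) : ℤ) - 1 = k := by push_cast; ring
    rw [e2]
    simp only [f] at *
    rw [eq_neg_iff_add_eq_zero] at hn
    have : (((k + 1 : ℕ) : MvPowerSeries ℕ ℂ)) = k + 1 := Nat.cast_succ k
    rw [this]
    simp only [Nat.cast_zero, sub_zero, mul_zero, add_zero, zero_add, pow_one]
    linear_combination z * hn

/-- Expansion of the determinant by multilinearity; `s` is the set of rows from which the second
summand of `q' i = q i - z q (i - 1)` is taken. -/
theorem shiftDet_add_mul {A : Type*} [CommRing A] (q q' : ℤ → A) (z : A)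
    (hq : ∀ i, q' i = q i - z * q (i - 1)) {N : ℕ} (a : Fin N → ℤ) :
    shiftDet q' a = ∑ s : Finset (Fin N),
      (-z) ^ s.card * shiftDet q (fun i => a i + if i ∈ s then 1 else 0) := by
  have h := (Matrix.detRowAlternating (n := Fin N) (R := A)).map_add_univ
    (fun (i j : Fin N) => -z * q ((j : ℤ) - (a i + 1))) (fun (i j : Fin N) => q ((j : ℤ) - a i))
  have e : ((fun (i j : Fin N) => -z * q ((j : ℤ) - (a i + 1))) +
      fun (i j : Fin N) => q ((j : ℤ) - a i)) =
      Matrix.of fun i j : Fin N => q' ((j : ℤ) - a i) := by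
    funext i j
    simp only [Pi.add_apply, Matrix.of_apply, hq, sub_add_eq_sub_sub]
    ring
  rw [shiftDet]
  refine (congrArg _ e.symm).trans (h.trans (Finset.sum_congr rfl fun s _ => ?_))
  have e2 : s.piecewise (fun i (j : Fin N) => -z * q ((j : ℤ) - (a i + 1)))
      (fun i j => q ((j : ℤ) - a i)) = Matrix.of fun i j : Fin N => (if i ∈ s then -z else 1) *
        (Matrix.of fun i j : Fin N => q ((j : ℤ) - (a i + if i ∈ s then 1 else 0))) i j := by
    funext i j
    by_cases hi : i ∈ s <;> simp [hi]
  rw [e2]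
  refine (Matrix.det_mul_column _ _).trans ?_
  rw [Finset.prod_ite_mem, Finset.univ_inter, Finset.prod_const]
  rfl

theorem map_shiftDet {A B : Type*} [CommRing A] [CommRing B] (f : A →+* B) (q : ℤ → A) {N : ℕ}
    (a : Fin N → ℤ) : f (shiftDet q a) = shiftDet (fun i => f (q i)) a := by
  rw [shiftDet, RingHom.map_det]
  rfl

theorem coeff_toSymmFin_eq_zero (M : ℕ) (p : Pol) {d : ℕ →₀ ℕ} {k : ℕ} (hk : M ≤ k)
    (hd : d k ≠ 0) : MvPowerSeries.coeff d (toSymmFin M p) = 0 := by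
  induction p using MvPolynomial.induction_on generalizing d with
  | C c =>
    rw [toSymmFin, aeval_C, MvPowerSeries.algebraMap_apply, MvPowerSeries.coeff_C, if_neg]
    rintro rfl
    exact hd rfl
  | add p q hp hq => rw [map_add, map_add, hp hd, hq hd, add_zero]
  | mul_X p n hp =>
    rw [map_mul, MvPowerSeries.coeff_mul]
    refine Finset.sum_eq_zero fun x hx => ?_
    rw [Finset.HasAntidiagonal.mem_antidiagonal] at hx
    by_cases h1 : x.1 k = 0
    · have h2 : x.2 k ≠ 0 := by
        intro h2
        rw [← hx, Finsupp.add_apply, h1, h2] at hd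
        exact hd rfl
      have : MvPowerSeries.coeff x.2 (toSymmFin M (X n)) = 0 := by
        rw [toSymmFin, aeval_X, map_smul, map_sum, Finset.sum_eq_zero, smul_zero]
        intro l hl
        rw [Finset.mem_range] at hl
        rw [MvPowerSeries.coeff_X_pow, if_neg]
        intro h
        rw [h, Finsupp.single_apply, if_neg (by omega)] at h2
        exact h2 rfl
      rw [this, mul_zero]
    · rw [hp h1, zero_mul]

/-- `toSymm` and `toSymmFin M` agree on the monomials in the first `M` variables. -/
theorem coeff_toSymm (M : ℕ) (p : Pol) {d : ℕ →₀ ℕ} (hd : ∀ k, M ≤ k → d k = 0) :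
    MvPowerSeries.coeff d (toSymm p) = MvPowerSeries.coeff d (toSymmFin M p) := by
  classical
  induction p using MvPolynomial.induction_on generalizing d with
  | C c => rw [toSymm, toSymmFin, aeval_C, aeval_C]
  | add p q hp hq => rw [map_add, map_add, map_add, map_add, hp hd, hq hd]
  | mul_X p n hp =>
    rw [map_mul toSymm, map_mul (toSymmFin M), MvPowerSeries.coeff_mul, MvPowerSeries.coeff_mul]
    refine Finset.sum_congr rfl fun x hx => ?_
    rw [Finset.HasAntidiagonal.mem_antidiagonal] at hx
    have h1 : ∀ k, M ≤ k → x.1 k = 0 := fun k hk => by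
      have := hd k hk
      rw [← hx, Finsupp.add_apply] at this
      omega
    have h2 : ∀ k, M ≤ k → x.2 k = 0 := fun k hk => by
      have := hd k hk
      rw [← hx, Finsupp.add_apply] at this
      omega
    rw [hp h1]
    congr 1
    rw [toSymm, toSymmFin, aeval_X, aeval_X, map_smul, map_smul, map_sum]
    congr 1
    simp only [MvPowerSeries.coeff_X_pow]
    change (if ∃ k : ℕ, x.2 = Finsupp.single k (n : ℕ) then (1 : ℂ) else 0) = _
    have hn := n.pos
    split_ifs with h
    · obtain ⟨k, hk⟩ := h
      have hkM : k < M := by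
        by_contra h'
        have := h2 k (by omega)
        rw [hk, Finsupp.single_eq_same] at this
        omega
      rw [Finset.sum_eq_single k, if_pos hk]
      · intro l _ hl
        rw [if_neg]
        intro h'
        rw [hk] at h'
        exact hl (Finsupp.single_left_injective hn.ne' h').symm
      · intro h'
        exact absurd (Finset.mem_range.mpr hkM) h'
    · refine (Finset.sum_eq_zero fun l _ => if_neg fun h' => h ⟨l, h'⟩).symm

theorem coeff_X_pow_mul_toSymmFin (M r : ℕ) (p : Pol) (d : ℕ →₀ ℕ) :
    MvPowerSeries.coeff d ((MvPowerSeries.X M) ^ r * toSymmFin M p) =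
      if d M = r then MvPowerSeries.coeff (d.erase M) (toSymmFin M p) else 0 := by
  classical
  rw [MvPowerSeries.X_pow_eq, MvPowerSeries.coeff_monomial_mul]
  have hle : Finsupp.single M r ≤ d ↔ r ≤ d M := by simp
  simp only [hle, one_mul]
  rcases lt_trichotomy (d M) r with h | h | h
  · rw [if_neg (by omega), if_neg (by omega)]
  · rw [if_pos (by omega), if_pos h]
    congr 2
    ext k
    by_cases hk : k = M
    · subst hk
      simp [h]
    · rw [Finsupp.tsub_apply, Finsupp.single_apply, if_neg (Ne.symm hk), Finsupp.erase_ne hk]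
      rfl
  · rw [if_pos (by omega), if_neg (by omega)]
    refine coeff_toSymmFin_eq_zero M p le_rfl ?_
    rw [Finsupp.tsub_apply, Finsupp.single_eq_same]
    omega

/-! ### Schur functions as vacuum expectation values -/

open Classical in
/-- The diagrams obtained from `lam` by removing a horizontal strip of `r` boxes. -/
def strips (lam : YoungDiagram) (r : ℕ) : Finset YoungDiagram :=
  (finite_young (lam.card - r)).toFinset.filter fun nu => nu.card + r = lam.card ∧
    ∀ j, nu.colLen j ≤ lam.colLen j ∧ lam.colLen j ≤ nu.colLen j + 1

theorem mem_strips {lam nu : YoungDiagram} {r : ℕ} : nu ∈ strips lam r ↔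
    nu.card + r = lam.card ∧ ∀ j, nu.colLen j ≤ lam.colLen j ∧ lam.colLen j ≤ nu.colLen j + 1 := by
  classical
  rw [strips, Finset.mem_filter, Set.Finite.mem_toFinset, Set.mem_ofPred_eq]
  constructor
  · exact fun h => h.2
  · exact fun h => ⟨by omega, h⟩

theorem content_entry_ne_zero {mu : YoungDiagram} (T : SemistandardYoungTableau mu) {i j : ℕ}
    (h : (i, j) ∈ mu) : content T (T i j) ≠ 0 := by
  rw [content_apply]
  refine (Finset.card_pos.mpr ⟨(i, j), ?_⟩).ne'
  rw [Finset.mem_filter]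
  exact ⟨(YoungDiagram.mem_cells _).mpr h, rfl⟩

open Classical in
/-- Fill the boxes of a horizontal strip `lam / nu` with the entry `M`, which exceeds all entries of
the given tableau of shape `nu`. -/
def fillStrip {lam nu : YoungDiagram} {M : ℕ}
    (h : ∀ j, nu.colLen j ≤ lam.colLen j ∧ lam.colLen j ≤ nu.colLen j + 1)
    (T : SemistandardYoungTableau nu) (hT : ∀ i j, (i, j) ∈ nu → T i j < M) :
    SemistandardYoungTableau lam where
  entry i j := if (i, j) ∈ nu then T i j else if (i, j) ∈ lam then M else 0
  row_weak' {i j1 j2} hj h2 := by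
    by_cases h3 : (i, j2) ∈ nu
    · rw [if_pos h3, if_pos (nu.up_left_mem le_rfl hj.le h3)]
      exact T.row_weak hj h3
    · rw [if_neg h3, if_pos h2]
      split_ifs with h4
      · exact (hT _ _ h4).le
      · exact le_rfl
      · exact Nat.zero_le _
  col_strict' {i1 i2 j} hi h2 := by
    by_cases h3 : (i2, j) ∈ nu
    · rw [if_pos h3, if_pos (nu.up_left_mem hi.le le_rfl h3)]
      exact T.col_strict hi h3
    · have h4 : (i1, j) ∈ nu := by
        rw [YoungDiagram.mem_iff_lt_colLen] at h2 h3 ⊢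
        have := (h j).2
        omega
      rw [if_neg h3, if_pos h2, if_pos h4]
      exact hT _ _ h4
  zeros' {i j} h2 := by
    have h3 : (i, j) ∉ nu := by
      rw [YoungDiagram.mem_iff_lt_colLen] at h2 ⊢
      have := (h j).1
      omega
    rw [if_neg h3, if_neg h2]

open Classical in
theorem fillStrip_apply {lam nu : YoungDiagram} {M : ℕ}
    (h : ∀ j, nu.colLen j ≤ lam.colLen j ∧ lam.colLen j ≤ nu.colLen j + 1)
    (T : SemistandardYoungTableau nu) (hT : ∀ i j, (i, j) ∈ nu → T i j < M) (i j : ℕ) :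
    fillStrip h T hT i j = if (i, j) ∈ nu then T i j else if (i, j) ∈ lam then M else 0 := rfl

theorem le_of_colLen_le {lam nu : YoungDiagram} (h : ∀ j, nu.colLen j ≤ lam.colLen j) :
    nu.cells ⊆ lam.cells := by
  rintro ⟨i, j⟩ hc
  rw [YoungDiagram.mem_cells, YoungDiagram.mem_iff_lt_colLen] at hc ⊢
  exact hc.trans_le (h j)

theorem content_fillStrip {lam nu : YoungDiagram} {M : ℕ}
    (h : ∀ j, nu.colLen j ≤ lam.colLen j ∧ lam.colLen j ≤ nu.colLen j + 1)
    (T : SemistandardYoungTableau nu) (hT : ∀ i j, (i, j) ∈ nu → T i j < M) :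
    content (fillStrip h T hT) = content T + Finsupp.single M (lam.card - nu.card) := by
  classical
  have hsub := le_of_colLen_le fun j => (h j).1
  unfold content
  rw [← Finset.sum_sdiff hsub, add_comm]
  congr 1
  · refine Finset.sum_congr rfl fun c hc => ?_
    rw [fillStrip_apply, if_pos ((YoungDiagram.mem_cells _).mp hc)]
  · have : ∀ c ∈ lam.cells \ nu.cells,
        Finsupp.single (fillStrip h T hT c.1 c.2) 1 = Finsupp.single M 1 := by
      intro c hc
      rw [Finset.mem_sdiff, YoungDiagram.mem_cells, YoungDiagram.mem_cells] at hc
      rw [fillStrip_apply, if_neg hc.2, if_pos hc.1]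
    rw [Finset.sum_congr rfl this, Finset.sum_const, Finset.card_sdiff_of_subset hsub]
    simp [YoungDiagram.card]

/-- Removing the largest entry of the alphabet from a tableau. -/
theorem card_tableaux (lam : YoungDiagram) (M : ℕ) {d : ℕ →₀ ℕ} (hd : ∀ k, M < k → d k = 0) :
    Nat.card {T : SemistandardYoungTableau lam // content T = d} =
      ∑ nu ∈ strips lam (d M),
        Nat.card {T : SemistandardYoungTableau nu // content T = d.erase M} := by
  classical
  have hlt : ∀ {nu : YoungDiagram} (T : SemistandardYoungTableau nu), content T = d.erase M →
      ∀ i j, (i, j) ∈ nu → T i j < M := by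
    intro nu T hT i j hij
    have h1 := content_entry_ne_zero T hij
    rw [hT] at h1
    by_contra h2
    rcases Nat.eq_or_lt_of_le (not_lt.mp h2) with h3 | h3
    · rw [← h3, Finsupp.erase_same] at h1
      exact h1 rfl
    · rw [Finsupp.erase_ne h3.ne', hd _ h3] at h1
      exact h1 rfl
  have hfin : ∀ nu : strips lam (d M),
      Finite {T : SemistandardYoungTableau nu.1 // content T = d.erase M} :=
    fun nu => finite_tableaux _ _
  rw [← Finset.sum_coe_sort, ← Nat.card_sigma]
  symm
  have hstrip := fun nu : strips lam (d M) => mem_strips.mp nu.2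
  let f : (Σ nu : strips lam (d M),
      {T : SemistandardYoungTableau nu.1 // content T = d.erase M}) →
      {T : SemistandardYoungTableau lam // content T = d} := fun x =>
    ⟨fillStrip (hstrip x.1).2 x.2.1 (hlt x.2.1 x.2.2), by
      rw [content_fillStrip, x.2.2]
      have h1 := (hstrip x.1).1
      have h2 : lam.card - x.1.1.card = d M := by omega
      rw [h2, Finsupp.erase_add_single]⟩
  refine Nat.card_eq_of_bijective f ⟨?_, ?_⟩
  · rintro ⟨⟨nu, hnu⟩, ⟨T, hT⟩⟩ ⟨⟨nu', hnu'⟩, ⟨T', hT'⟩⟩ h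
    have h1 : ∀ i j, fillStrip (mem_strips.mp hnu).2 T (hlt T hT) i j =
        fillStrip (mem_strips.mp hnu').2 T' (hlt T' hT') i j := fun i j =>
      congrFun (congrFun (congrArg (fun x : SemistandardYoungTableau lam => (x : ℕ → ℕ → ℕ))
        (congrArg Subtype.val h)) i) j
    simp only [fillStrip_apply] at h1
    have hsub : nu.cells ⊆ lam.cells := le_of_colLen_le fun j => ((mem_strips.mp hnu).2 j).1
    have hsub' : nu'.cells ⊆ lam.cells := le_of_colLen_le fun j => ((mem_strips.mp hnu').2 j).1
    have hnn : nu = nu' := by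
      ext ⟨i, j⟩
      have h2 := h1 i j
      constructor
      · intro hc
        by_contra hc'
        rw [if_pos ((YoungDiagram.mem_cells _).mp hc),
          if_neg (fun h => hc' ((YoungDiagram.mem_cells _).mpr h)),
          if_pos ((YoungDiagram.mem_cells _).mp (hsub hc))] at h2
        exact (hlt T hT i j ((YoungDiagram.mem_cells _).mp hc)).ne h2
      · intro hc
        by_contra hc'
        rw [if_pos ((YoungDiagram.mem_cells _).mp hc),
          if_neg (fun h => hc' ((YoungDiagram.mem_cells _).mpr h)),
          if_pos ((YoungDiagram.mem_cells _).mp (hsub' hc))] at h2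
        exact (hlt T' hT' i j ((YoungDiagram.mem_cells _).mp hc)).ne h2.symm
    subst hnn
    have hTT : T = T' := by
      ext i j
      by_cases hc : (i, j) ∈ nu
      · simpa [hc] using h1 i j
      · rw [T.zeros hc, T'.zeros hc]
    subst hTT
    rfl
  · rintro ⟨T, hT⟩
    have hle : ∀ i j, (i, j) ∈ lam → T i j ≤ M := by
      intro i j hij
      have h1 := content_entry_ne_zero T hij
      rw [hT] at h1
      by_contra h2
      exact h1 (hd _ (not_le.mp h2))
    let nu : YoungDiagram :=
      { cells := lam.cells.filter fun c => T c.1 c.2 < M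
        isLowerSet := by
          rintro ⟨i, j⟩ ⟨i', j'⟩ ⟨hi, hj⟩ hx
          simp only [Finset.coe_filter, YoungDiagram.mem_cells, Set.mem_ofPred_eq] at hx ⊢
          simp only at hi hj
          have h1 := lam.up_left_mem hi hj hx.1
          have h2 := T.col_weak hi (lam.up_left_mem le_rfl hj hx.1)
          have h3 := T.row_weak_of_le hj hx.1
          exact ⟨h1, (h2.trans h3).trans_lt hx.2⟩ }
    have hmem : ∀ i j, (i, j) ∈ nu ↔ (i, j) ∈ lam ∧ T i j < M := by
      intro i j
      rw [← YoungDiagram.mem_cells]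
      simp only [nu, Finset.mem_filter, YoungDiagram.mem_cells]
    have hcol : ∀ j, nu.colLen j ≤ lam.colLen j ∧ lam.colLen j ≤ nu.colLen j + 1 := by
      intro j
      constructor
      · by_contra hc
        have h1 : (lam.colLen j, j) ∈ nu := YoungDiagram.mem_iff_lt_colLen.mpr (not_le.mp hc)
        have h2 := YoungDiagram.mem_iff_lt_colLen.mp ((hmem _ _).mp h1).1
        omega
      · by_contra hc
        have h1 : (nu.colLen j + 1, j) ∈ lam := YoungDiagram.mem_iff_lt_colLen.mpr (not_le.mp hc)
        have h2 := T.col_strict (Nat.lt_add_one (nu.colLen j)) h1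
        have h3 := hle _ _ h1
        have h4 : (nu.colLen j, j) ∈ nu :=
          (hmem _ _).mpr ⟨lam.up_left_mem (Nat.le_succ _) le_rfl h1, by omega⟩
        have h5 := YoungDiagram.mem_iff_lt_colLen.mp h4
        omega
    let T' : SemistandardYoungTableau nu :=
      { entry := fun i j => if (i, j) ∈ nu then T i j else 0
        row_weak' := fun {i j1 j2} hj h2 => by
          rw [if_pos h2, if_pos (nu.up_left_mem le_rfl hj.le h2)]
          exact T.row_weak hj ((hmem _ _).mp h2).1
        col_strict' := fun {i1 i2 j} hi h2 => by
          rw [if_pos h2, if_pos (nu.up_left_mem hi.le le_rfl h2)]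
          exact T.col_strict hi ((hmem _ _).mp h2).1
        zeros' := fun {i j} h2 => if_neg h2 }
    have hT' : ∀ i j, T' i j = if (i, j) ∈ nu then T i j else 0 := fun _ _ => rfl
    have hT'lt : ∀ i j, (i, j) ∈ nu → T' i j < M := fun i j hij => by
      rw [hT', if_pos hij]
      exact ((hmem _ _).mp hij).2
    have hfill : fillStrip hcol T' hT'lt = T := by
      ext i j
      rw [fillStrip_apply, hT']
      by_cases h1 : (i, j) ∈ nu
      · rw [if_pos h1, if_pos h1]
      · rw [if_neg h1]
        by_cases h2 : (i, j) ∈ lam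
        · rw [if_pos h2]
          have h3 := hle _ _ h2
          by_contra h4
          exact h1 ((hmem _ _).mpr ⟨h2, by omega⟩)
        · rw [if_neg h2, T.zeros h2]
    have hc := content_fillStrip hcol T' hT'lt
    rw [hfill, hT] at hc
    have hc0 : content T' M = 0 := by
      rw [content_apply, Finset.card_eq_zero, Finset.filter_eq_empty_iff]
      rintro ⟨i, j⟩ hij
      exact (hT'lt i j ((YoungDiagram.mem_cells _).mp hij)).ne
    have hsub : nu.card ≤ lam.card := Finset.card_le_card (Finset.filter_subset _ _)
    have hdM : d M = lam.card - nu.card := by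
      rw [hc, Finsupp.add_apply, hc0, Finsupp.single_eq_same, zero_add]
    have hce : content T' = d.erase M := by
      ext k
      by_cases hk : k = M
      · subst hk
        rw [hc0, Finsupp.erase_same]
      · rw [Finsupp.erase_ne hk, hc, Finsupp.add_apply, Finsupp.single_apply, if_neg (Ne.symm hk),
          add_zero]
    exact ⟨⟨⟨nu, mem_strips.mpr ⟨by omega, hcol⟩⟩, ⟨T', hce⟩⟩, Subtype.ext hfill⟩

/-- In `M` variables the Schur function is the matrix element `⟨vac| e^{H(x)} |lam⟩`. Upon adding a
variable, both sides turn into the same sum over the horizontal strips in `lam`: the semistandard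
tableaux by `card_tableaux`, and the determinants by `shiftDet_add_mul`, where `s` becomes the set
of columns that meet the strip. -/
theorem coeff_schur_eq (M : ℕ) : ∀ (lam : YoungDiagram) (d : ℕ →₀ ℕ), (∀ k, M ≤ k → d k = 0) →
    MvPowerSeries.coeff d (schur lam) = (-1) ^ lam.card *
      MvPowerSeries.coeff d (toSymmFin M (vev ((Maya.ofYoung lam).ket Pol))) := by
  classical
  induction M with
  | zero =>
    intro lam d hd
    obtain rfl : d = 0 := by
      ext k
      exact hd k (Nat.zero_le k)
    have h0 : ∀ p : Pol, MvPowerSeries.coeff 0 (toSymmFin 0 p) = constantCoeff p := by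
      intro p
      have : toSymmFin 0 = (aeval fun _ => 0 : Pol →ₐ[ℂ] MvPowerSeries ℕ ℂ) := by
        simp [toSymmFin]
      rw [this, aeval_zero', MvPowerSeries.algebraMap_apply]
      simp
    have hw := isWindow_ofYoung lam le_rfl
    rw [h0, vev_of_window _ _ hw,
      constantCoeff_shiftDet_of_strictMono constantCoeff_signedE hw.strictMono]
    simp only [colWindow_eq_iff (lam := lam) le_rfl]
    split_ifs with h
    · subst h
      rw [coeff_schur]
      have hu : ∀ T : SemistandardYoungTableau ⊥, content T = 0 := fun T => by simp [content]
      have : Nat.card {T : SemistandardYoungTableau ⊥ // content T = 0} = 1 := by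
        rw [Nat.card_eq_one_iff_unique]
        refine ⟨⟨fun a b => Subtype.ext ?_⟩,
          ⟨⟨SemistandardYoungTableau.highestWeight ⊥, hu _⟩⟩⟩
        ext i j
        rw [a.1.zeros (YoungDiagram.notMem_bot _), b.1.zeros (YoungDiagram.notMem_bot _)]
      rw [this]
      simp [YoungDiagram.card]
    · rw [mul_zero]
      by_contra h1
      obtain ⟨T, hT⟩ := exists_of_coeff_schur_ne_zero h1
      have h2 := degree_content T
      rw [hT] at h2
      refine h ?_
      have h3 : lam.cells = ∅ := Finset.card_eq_zero.mp (by simpa using h2.symm)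
      ext c
      rw [h3]
      simp
  | succ M ih =>
    intro lam d hd
    have hd' : ∀ k, M ≤ k → (d.erase M) k = 0 := fun k hk => by
      rcases Nat.eq_or_lt_of_le hk with rfl | h
      · exact Finsupp.erase_same
      · rw [Finsupp.erase_ne h.ne', hd k h]
    set N := lam.rowLen 0 with hN
    set a := colWindow lam N with ha
    have hexp : toSymmFin (M + 1) (vev ((Maya.ofYoung lam).ket Pol)) = ∑ s : Finset (Fin N),
        (-MvPowerSeries.X M) ^ s.card * toSymmFin M
          (shiftDet signedE (fun i => a i + if i ∈ s then 1 else 0)) := by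
      rw [vev_ofYoung (N := N) le_rfl]
      refine (map_shiftDet (toSymmFin (M + 1)).toRingHom _ _).trans ?_
      refine (shiftDet_add_mul (fun i => toSymmFin M (signedE i)) _ (MvPowerSeries.X M)
        (fun i => toSymmFin_succ_signedE M i) a).trans ?_
      refine Finset.sum_congr rfl fun s _ => ?_
      congr 1
      exact (map_shiftDet (toSymmFin M).toRingHom _ _).symm
    have hterm : ∀ s : Finset (Fin N), MvPowerSeries.coeff d ((-MvPowerSeries.X M) ^ s.card *
        toSymmFin M (shiftDet signedE (fun i => a i + if i ∈ s then 1 else 0))) =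
        if d M = s.card then (-1) ^ s.card * MvPowerSeries.coeff (d.erase M) (toSymmFin M
          (shiftDet signedE (fun i => a i + if i ∈ s then 1 else 0))) else 0 := by
      intro s
      have hC : ∀ f : MvPowerSeries ℕ ℂ, MvPowerSeries.coeff d ((-1) ^ s.card * f) =
          (-1) ^ s.card * MvPowerSeries.coeff d f := by
        intro f
        rcases Nat.even_or_odd s.card with e | e <;> simp [e.neg_one_pow]
      rw [neg_pow, mul_assoc, ← mul_ite_zero, ← coeff_X_pow_mul_toSymmFin, hC]
    rw [hexp, map_sum, Finset.sum_congr rfl fun s _ => hterm s, coeff_schur,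
      card_tableaux lam M (fun k hk => hd k hk), Nat.cast_sum, Finset.mul_sum]
    set σ : YoungDiagram → Finset (Fin N) := fun nu =>
      Finset.univ.filter fun j : Fin N => nu.colLen j < lam.colLen j with hσ
    -- `σ nu` is the set of columns in which `nu` is shorter than `lam`
    have hlam0 : ∀ j, N ≤ j → lam.colLen j = 0 := fun j hj => colLen_eq_zero_iff.mpr hj
    have hcolσ : ∀ nu, (∀ j, nu.colLen j ≤ lam.colLen j ∧ lam.colLen j ≤ nu.colLen j + 1) →
        ∀ j : Fin N, lam.colLen j = nu.colLen j + if j ∈ σ nu then 1 else 0 := by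
      intro nu hnu j
      have := hnu j
      simp only [hσ, Finset.mem_filter, Finset.mem_univ, true_and]
      split_ifs <;> omega
    have hwin : ∀ nu, (∀ j, nu.colLen j ≤ lam.colLen j ∧ lam.colLen j ≤ nu.colLen j + 1) →
        colWindow nu N = fun i => a i + if i ∈ σ nu then 1 else 0 := by
      intro nu hnu
      funext j
      have := hcolσ nu hnu j
      simp only [ha, colWindow]
      split_ifs at this ⊢ <;> omega
    have hrow : ∀ nu : YoungDiagram,
        (∀ j, nu.colLen j ≤ lam.colLen j ∧ lam.colLen j ≤ nu.colLen j + 1) →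
        nu.rowLen 0 ≤ N := by
      intro nu hnu
      rw [← colLen_eq_zero_iff]
      have := (hnu N).1
      have := hlam0 N le_rfl
      omega
    have hcardσ : ∀ nu, (∀ j, nu.colLen j ≤ lam.colLen j ∧ lam.colLen j ≤ nu.colLen j + 1) →
        lam.card = nu.card + (σ nu).card := by
      intro nu hnu
      rw [card_eq_sum_colLen lam (N := N) le_rfl, card_eq_sum_colLen nu (hrow nu hnu),
        Finset.sum_range, Finset.sum_range, Finset.sum_congr rfl fun j _ => hcolσ nu hnu j,
        Finset.sum_add_distrib]
      simp
    refine Finset.sum_of_injOn σ ?_ ?_ ?_ ?_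
    · intro nu hnu nu' hnu' h
      have h1 := (mem_strips.mp (Finset.mem_coe.mp hnu)).2
      have h2 := (mem_strips.mp (Finset.mem_coe.mp hnu')).2
      refine eq_of_colLen fun j => ?_
      by_cases hj : j < N
      · have e1 := hcolσ nu h1 ⟨j, hj⟩
        have e2 := hcolσ nu' h2 ⟨j, hj⟩
        rw [h] at e1
        simp only at e1 e2
        omega
      · have e1 := (h1 j).1
        have e2 := (h2 j).1
        have := hlam0 j (not_lt.mp hj)
        omega
    · intro nu _
      exact Finset.mem_coe.mpr (Finset.mem_univ _)
    · intro s _ hs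
      split_ifs with hds
      swap
      · rw [mul_zero]
      set b : Fin N → ℤ := fun i => a i + if i ∈ s then 1 else 0 with hb
      -- a nonzero determinant belongs to a Young diagram, obtained from `lam` by removing a strip
      suffices h : shiftDet signedE b = 0 by rw [h, map_zero, map_zero, mul_zero, mul_zero]
      by_contra hne
      have hinj : Function.Injective b := by
        by_contra h
        exact hne (shiftDet_eq_zero _ h)
      have hlt : ∀ i, b i < N := fun i => by
        by_contra h
        exact hne (shiftDet_of_ge _ (fun i hi => signedE_of_neg hi) (not_lt.mp h))
      have hmono : StrictMono b := by
        refine Monotone.strictMono_of_injective (fun i j hij => ?_) hinj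
        rcases hij.eq_or_lt with rfl | h
        · exact le_rfl
        · have := (isWindow_ofYoung lam (N := N) le_rfl).strictMono h
          simp only [hb, ha]
          split_ifs <;> omega
      let u : Maya :=
        { black := {k | k ∈ Set.range b ∨ (N : ℤ) ≤ k}
          left_white := by
            obtain ⟨x, hx⟩ := (Set.finite_range b).bddBelow
            refine ⟨min x N, fun k hk => ?_⟩
            rintro (h | h)
            · exact absurd (hx h) (not_le.mpr (hk.trans_le (min_le_left _ _)))
            · exact absurd h (not_le.mpr (hk.trans_le (min_le_right _ _)))
          right_black := ⟨N, fun k hk => Or.inr hk⟩ }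
      have hu : IsWindow u b := ⟨hmono, hlt, fun k => Iff.rfl⟩
      obtain ⟨nu, -, hnuN, hbnu⟩ := hu.exists_young
      have hcol : ∀ j : Fin N, lam.colLen j = nu.colLen j + if j ∈ s then 1 else 0 := by
        intro j
        have := congrFun hbnu j
        simp only [hb, ha, colWindow] at this
        split_ifs at this ⊢ <;> omega
      have hcol' : ∀ j, nu.colLen j ≤ lam.colLen j ∧ lam.colLen j ≤ nu.colLen j + 1 := by
        intro j
        by_cases hj : j < N
        · have := hcol ⟨j, hj⟩
          simp only at this
          split_ifs at this <;> omega
        · have h1 := hlam0 j (not_lt.mp hj)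
          have h2 : nu.colLen j = 0 := colLen_eq_zero_iff.mpr (hnuN.trans (not_lt.mp hj))
          omega
      have hσs : σ nu = s := by
        ext j
        have := hcol j
        simp only [hσ, Finset.mem_filter, Finset.mem_univ, true_and]
        split_ifs at this with h <;> simp only [h, iff_true, iff_false] <;> omega
      refine hs ⟨nu, Finset.mem_coe.mpr (mem_strips.mpr ⟨?_, hcol'⟩), hσs⟩
      rw [hcardσ nu hcol', hσs, hds]
    · intro nu hnu
      obtain ⟨h1, h2⟩ := mem_strips.mp hnu
      have h3 := hcardσ nu h2
      have h4 : d M = (σ nu).card := by omega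
      rw [if_pos h4, ← coeff_schur, ih nu _ hd', vev_ofYoung (hrow nu h2), hwin nu h2, ← mul_assoc,
        h3, pow_add, mul_assoc ((-1 : ℂ) ^ nu.card), ← mul_pow, neg_one_mul, neg_neg, one_pow,
        mul_one]

theorem toSymm_vev_ketYoung (lam : YoungDiagram) :
    toSymm (vev (ketYoung Pol lam)) = schur lam := by
  ext d
  obtain ⟨M, hM⟩ : ∃ M, ∀ k, M ≤ k → d k = 0 := by
    refine ⟨d.support.sup id + 1, fun k hk => ?_⟩
    by_contra h
    have := Finset.le_sup (f := id) (Finsupp.mem_support_iff.mpr h)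
    simp only [id_eq] at this
    omega
  rw [coeff_schur_eq M lam d hM, coeff_toSymm M _ hM, ketYoung, map_smul, smul_eq_mul]
  have : ((-1 : Pol) ^ lam.card) = C ((-1) ^ lam.card) := by simp
  rw [this, ← smul_eq_C_mul, map_smul, MvPowerSeries.coeff_smul]

/-- The polynomial `P_lam` is the Schur function, expressed by the power sums. -/
theorem toSymm_polyP (lam : YoungDiagram) : toSymm (polyP lam) = schur lam := by
  rw [← vev_ketYoung, toSymm_vev_ketYoung]

/-! ### Operators on the Fock space adjoint to multiplication by symmetric functions -/

section Transpose

variable (R : Type) [CommRing R]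

theorem Maya.move_move {u : Maya} {s t : ℤ} (hs : s ∈ u.black) (ht : t ∉ u.black) :
    (u.move s t).move t s = u := by
  ext k
  rw [Maya.mem_move, Maya.mem_move]
  by_cases h1 : k = s
  · subst h1
    simp only [hs, true_and, or_true, iff_true]
    rintro rfl
    exact ht hs
  · by_cases h2 : k = t
    · subst h2
      simp [ht]
    · simp [h1, h2]

/-- The matrix of `hop s t` is the transpose of the matrix of `hop t s`. -/
theorem hop_transpose (u w : Maya) (s t : ℤ) : hop R u s t w = hop R w t s u := by
  classical
  have key : ∀ u w : Maya, s ∈ u.black → t ∉ u.black → u.move s t = w →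
      hop R u s t w = hop R w t s u := by
    intro u w hs ht h
    have hst : s ≠ t := fun h => ht (h ▸ hs)
    have hb : between u.black s t = between w.black t s := by
      rw [between_comm w.black]
      refine between_congr fun k h1 h2 => ?_
      have h3 : k ≠ s := by
        rintro rfl
        rcases le_total k t with h | h
        · rw [min_eq_left h] at h1; exact lt_irrefl _ h1
        · rw [max_eq_left h] at h2; exact lt_irrefl _ h2
      have h4 : k ≠ t := by
        rintro rfl
        rcases le_total s k with h | h
        · rw [max_eq_right h] at h2; exact lt_irrefl _ h2
        · rw [min_eq_right h] at h1; exact lt_irrefl _ h1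
      rw [← h, Maya.mem_move]
      simp [h3, h4]
    have ht' : t ∈ w.black := by
      rw [← h, Maya.mem_move]
      exact ⟨Or.inr rfl, hst.symm⟩
    have hs' : s ∉ w.black := by
      rw [← h, Maya.mem_move]
      exact fun h => h.2 rfl
    have h' : w.move t s = u := by rw [← h, Maya.move_move hs ht]
    rw [hop, hop, if_pos ⟨hs, ht⟩, if_pos ⟨ht', hs'⟩, h, h', hb, Finsupp.smul_apply,
      Finsupp.smul_apply, Maya.ket, Maya.ket, Finsupp.single_eq_same, Finsupp.single_eq_same]
  have hz : ∀ (u w : Maya) (s t : ℤ), ¬ (s ∈ u.black ∧ t ∉ u.black ∧ u.move s t = w) →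
      hop R u s t w = 0 := by
    intro u w s t h
    rw [hop]
    split_ifs with h1
    · rw [Finsupp.smul_apply, Maya.ket, Finsupp.single_apply, if_neg fun e => h ⟨h1.1, h1.2, e⟩,
        smul_zero]
    · rfl
  by_cases h : s ∈ u.black ∧ t ∉ u.black ∧ u.move s t = w
  · exact key u w h.1 h.2.1 h.2.2
  · rw [hz u w s t h, hz w u t s]
    rintro ⟨h1, h2, h3⟩
    refine h ⟨?_, ?_, ?_⟩
    · rw [← h3, Maya.mem_move]
      exact ⟨Or.inr rfl, fun e => h2 (e ▸ h1)⟩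
    · rw [← h3, Maya.mem_move]
      exact fun h => h.2 rfl
    · rw [← h3, Maya.move_move h1 h2]

/-- The matrix of `H_{-n}` is the transpose of the matrix of `H_n`. -/
theorem H_transpose (u w : Maya) {n : ℤ} (hn : n ≠ 0) :
    H R n (u.ket R) w = H R (-n) (w.ket R) u := by
  have hap : ∀ (u w : Maya) (n : ℤ), (∑ᶠ s, hop R u s (s + n)) w = ∑ᶠ s, hop R u s (s + n) w :=
    fun u w n => AddMonoidHom.map_finsum (Finsupp.applyAddHom w) (finite_hop R u n)
  rw [H_ket R u hn, H_ket R w (neg_ne_zero.mpr hn), hap, hap,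
    ← finsum_comp_equiv (Equiv.addRight n) (f := fun s => hop R w s (s + -n) u)]
  refine finsum_congr fun s => ?_
  simp only [Equiv.coe_addRight, add_neg_cancel_right]
  exact hop_transpose R u w s (s + n)

end Transpose

/-- The complex span of the Maya diagrams of charge zero. -/
def youngSpan : Submodule ℂ (Fock Pol) :=
  Submodule.span ℂ (Set.range fun mu : YoungDiagram => (Maya.ofYoung mu).ket Pol)

theorem ket_mem_youngSpan (mu : YoungDiagram) : (Maya.ofYoung mu).ket Pol ∈ youngSpan :=
  Submodule.subset_span ⟨mu, rfl⟩

theorem ketYoung_eq (mu : YoungDiagram) :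
    ketYoung Pol mu = ((-1 : ℂ) ^ mu.card) • (Maya.ofYoung mu).ket Pol := by
  rw [ketYoung]
  rcases Nat.even_or_odd mu.card with e | e <;> simp [e.neg_one_pow]

theorem ketYoung_mem_youngSpan (mu : YoungDiagram) : ketYoung Pol mu ∈ youngSpan := by
  rw [ketYoung_eq]
  exact Submodule.smul_mem _ _ (ket_mem_youngSpan mu)

theorem lowSpan_le_youngSpan (m : ℕ) : lowSpan Pol ℂ m ≤ youngSpan :=
  Submodule.span_mono fun _ ⟨mu, _, h⟩ => ⟨mu, h.symm⟩

theorem exists_mem_lowSpan {v : Fock Pol} (hv : v ∈ youngSpan) : ∃ m, v ∈ lowSpan Pol ℂ m := by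
  induction hv using Submodule.span_induction with
  | mem v hv =>
    obtain ⟨mu, rfl⟩ := hv
    exact ⟨_, ket_mem_lowSpan (Nat.lt_succ_self _)⟩
  | zero => exact ⟨0, Submodule.zero_mem _⟩
  | add v w _ _ hv hw =>
    obtain ⟨m, hm⟩ := hv
    obtain ⟨m', hm'⟩ := hw
    exact ⟨max m m', Submodule.add_mem _ (lowSpan_mono (le_max_left _ _) hm)
      (lowSpan_mono (le_max_right _ _) hm')⟩
  | smul c v _ hv =>
    obtain ⟨m, hm⟩ := hv
    exact ⟨m, Submodule.smul_mem _ _ hm⟩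

theorem mem_youngSpan_of_lowSpan {A : Module.End Pol (Fock Pol)}
    (h : ∀ (m : ℕ) (v : Fock Pol), v ∈ lowSpan Pol ℂ m → A v ∈ lowSpan Pol ℂ m) {v : Fock Pol}
    (hv : v ∈ youngSpan) : A v ∈ youngSpan := by
  obtain ⟨m, hm⟩ := exists_mem_lowSpan hv
  exact lowSpan_le_youngSpan m (h m v hm)

/-- The coordinate at `|mu⟩` of a vector of the complex Fock space (for a vector with polynomial
coefficients, the constant term of its coordinate). -/
def coord (mu : YoungDiagram) : Fock Pol →ₗ[ℂ] ℂ where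
  toFun v := (-1) ^ mu.card * constantCoeff (v (Maya.ofYoung mu))
  map_add' v w := by rw [Finsupp.add_apply, map_add, mul_add]
  map_smul' c v := by
    rw [Finsupp.smul_apply, smul_eq_C_mul, map_mul, constantCoeff_C, RingHom.id_apply, smul_eq_mul]
    ring

theorem coord_apply (mu : YoungDiagram) (v : Fock Pol) :
    coord mu v = (-1) ^ mu.card * constantCoeff (v (Maya.ofYoung mu)) := rfl

open Classical in
theorem coord_ketYoung (mu lam : YoungDiagram) :
    coord mu (ketYoung Pol lam) = if lam = mu then 1 else 0 := by
  rw [ketYoung_eq, map_smul, coord_apply, Maya.ket, Finsupp.single_apply]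
  simp only [ofYoung_injective.eq_iff]
  split_ifs with h
  · rw [h, map_one, mul_one, smul_eq_mul, ← mul_pow, neg_one_mul, neg_neg, one_pow]
  · simp

theorem ext_coord {v w : Fock Pol} (hv : v ∈ youngSpan) (hw : w ∈ youngSpan)
    (h : ∀ mu, coord mu v = coord mu w) : v = w := by
  have key : ∀ v ∈ youngSpan, ∀ u, v u = C (constantCoeff (v u)) ∧
      (u ∉ Set.range Maya.ofYoung → v u = 0) := by
    classical
    intro v hv u
    induction hv using Submodule.span_induction with
    | mem v hv =>
      obtain ⟨mu, rfl⟩ := hv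
      simp only [Maya.ket, Finsupp.single_apply]
      split_ifs with h
      · exact ⟨by simp, fun h' => absurd ⟨mu, h⟩ h'⟩
      · simp
    | zero => simp
    | add v w _ _ hv hw =>
      rw [Finsupp.add_apply, map_add, map_add, ← hv.1, ← hw.1]
      exact ⟨rfl, fun hu => by rw [hv.2 hu, hw.2 hu, add_zero]⟩
    | smul c v _ hv =>
      rw [Finsupp.smul_apply, smul_eq_C_mul, map_mul, map_mul, constantCoeff_C, ← hv.1]
      exact ⟨rfl, fun hu => by rw [hv.2 hu, mul_zero]⟩
  ext1 u
  by_cases hu : u ∈ Set.range Maya.ofYoung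
  · obtain ⟨mu, rfl⟩ := hu
    have h1 := h mu
    rw [coord_apply, coord_apply] at h1
    have h2 := mul_left_cancel₀ (pow_ne_zero _ (neg_ne_zero.mpr one_ne_zero)) h1
    rw [(key v hv _).1, h2, ← (key w hw _).1]
  · rw [(key v hv u).2 hu, (key w hw u).2 hu]

theorem card_of_coeff_schur_ne_zero {d : ℕ →₀ ℕ} {mu : YoungDiagram}
    (h : MvPowerSeries.coeff d (schur mu) ≠ 0) : mu.card = d.degree := by
  obtain ⟨T, rfl⟩ := exists_of_coeff_schur_ne_zero h
  exact (degree_content T).symm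

/-- The diagrams with `n` boxes. -/
def youngOfCard (n : ℕ) : Finset YoungDiagram := (finite_young n).toFinset

theorem mem_youngOfCard {n : ℕ} {mu : YoungDiagram} : mu ∈ youngOfCard n ↔ mu.card = n :=
  (finite_young n).mem_toFinset

theorem sum_mul_coeff_schur (c : YoungDiagram → ℂ) (d : ℕ →₀ ℕ) :
    ∑ᶠ mu, c mu * MvPowerSeries.coeff d (schur mu) =
      ∑ mu ∈ youngOfCard d.degree, c mu * MvPowerSeries.coeff d (schur mu) := by
  refine finsum_eq_sum_of_support_subset _ fun mu hmu => ?_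
  exact Finset.mem_coe.mpr (mem_youngOfCard.mpr
    (card_of_coeff_schur_ne_zero (right_ne_zero_of_mul hmu)))

/-- On the complex Fock space, the map `v ↦ ⟨vac| e^{H(x)} v` sends `|mu⟩` to the Schur function
`S_mu`. -/
theorem coeff_toSymm_vev {v : Fock Pol} (hv : v ∈ youngSpan) (d : ℕ →₀ ℕ) :
    MvPowerSeries.coeff d (toSymm (vev v)) =
      ∑ mu ∈ youngOfCard d.degree, coord mu v * MvPowerSeries.coeff d (schur mu) := by
  classical
  induction hv using Submodule.span_induction with
  | mem v hv =>
    obtain ⟨lam, rfl⟩ := hv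
    have hk : (Maya.ofYoung lam).ket Pol = ((-1 : ℂ) ^ lam.card) • ketYoung Pol lam := by
      rw [ketYoung_eq, smul_smul, ← mul_pow, neg_one_mul, neg_neg, one_pow, one_smul]
    simp only [hk]
    rw [LinearMap.map_smul_of_tower, map_smul, toSymm_vev_ketYoung, MvPowerSeries.coeff_smul]
    simp only [map_smul, coord_ketYoung, smul_eq_mul, mul_ite, mul_one, mul_zero, ite_mul, zero_mul]
    rw [Finset.sum_ite_eq]
    split_ifs with h
    · rfl
    · by_contra hne
      exact h (mem_youngOfCard.mpr (card_of_coeff_schur_ne_zero (right_ne_zero_of_mul hne)))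
  | zero => simp
  | add v w _ _ hv hw =>
    simp only [map_add, hv, hw, add_mul, Finset.sum_add_distrib]
  | smul c v _ hv =>
    rw [LinearMap.map_smul_of_tower, map_smul, MvPowerSeries.coeff_smul, hv, Finset.mul_sum]
    simp only [map_smul, smul_eq_mul, mul_assoc]

/-- The coefficient of `x^d` in the reproducing kernel `∑_lam S_lam(x) |lam⟩`. -/
def kernel (d : ℕ →₀ ℕ) : Fock Pol :=
  ∑ lam ∈ youngOfCard d.degree, MvPowerSeries.coeff d (schur lam) • ketYoung Pol lam

theorem kernel_mem_lowSpan (d : ℕ →₀ ℕ) : kernel d ∈ lowSpan Pol ℂ (d.degree + 1) := by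
  refine Submodule.sum_mem _ fun lam hlam => Submodule.smul_mem _ _ ?_
  rw [ketYoung_eq]
  refine Submodule.smul_mem _ _ (ket_mem_lowSpan ?_)
  rw [mem_youngOfCard.mp hlam]
  exact Nat.lt_succ_self _

theorem kernel_mem_youngSpan (d : ℕ →₀ ℕ) : kernel d ∈ youngSpan :=
  lowSpan_le_youngSpan _ (kernel_mem_lowSpan d)

theorem apply_kernel (A : Module.End Pol (Fock Pol)) (d : ℕ →₀ ℕ) : A (kernel d) =
    ∑ lam ∈ youngOfCard d.degree, MvPowerSeries.coeff d (schur lam) • A (ketYoung Pol lam) := by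
  rw [kernel, map_sum]
  exact Finset.sum_congr rfl fun lam _ => LinearMap.map_smul_of_tower _ _ _

theorem coord_kernel (mu : YoungDiagram) (d : ℕ →₀ ℕ) :
    coord mu (kernel d) = MvPowerSeries.coeff d (schur mu) := by
  classical
  rw [kernel, map_sum]
  simp only [map_smul, coord_ketYoung, smul_eq_mul, mul_ite, mul_one, mul_zero]
  rw [Finset.sum_ite_eq']
  split_ifs with h
  · rfl
  · by_contra hne
    exact h (mem_youngOfCard.mpr (card_of_coeff_schur_ne_zero (Ne.symm hne)))

/-- The operator `A` is adjoint to multiplication by the symmetric function `g`: for every `mu` the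
generating function `∑_lam S_lam ⟨mu| A |lam⟩` is `g S_mu`. The condition is stated for each
coefficient, by means of the reproducing kernel. -/
structure IsSkew (A : Module.End Pol (Fock Pol)) (g : MvPowerSeries ℕ ℂ) : Prop where
  mem : ∀ v ∈ youngSpan, A v ∈ youngSpan
  coord_eq : ∀ (d : ℕ →₀ ℕ) (mu : YoungDiagram),
    coord mu (A (kernel d)) = MvPowerSeries.coeff d (g * schur mu)

namespace IsSkew

variable {A B : Module.End Pol (Fock Pol)} {g h : MvPowerSeries ℕ ℂ}

/-- On the reproducing kernel `A` acts as multiplication of the variable part by `g`. -/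
theorem apply_kernel (hA : IsSkew A g) (d : ℕ →₀ ℕ) : A (kernel d) =
    ∑ x ∈ Finset.HasAntidiagonal.antidiagonal d, MvPowerSeries.coeff x.1 g • kernel x.2 := by
  classical
  refine ext_coord (hA.mem _ (kernel_mem_youngSpan d)) ?_ fun mu => ?_
  · exact Submodule.sum_mem _ fun x _ => Submodule.smul_mem _ _ (kernel_mem_youngSpan _)
  · rw [hA.coord_eq, MvPowerSeries.coeff_mul, map_sum]
    refine Finset.sum_congr rfl fun x _ => ?_
    rw [map_smul, coord_kernel, smul_eq_mul]

theorem one : IsSkew 1 1 where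
  mem _ hv := hv
  coord_eq d mu := by rw [one_mul, ← coord_kernel]; rfl

theorem mul (hA : IsSkew A g) (hB : IsSkew B h) : IsSkew (A * B) (g * h) where
  mem v hv := hA.mem _ (hB.mem v hv)
  coord_eq d mu := by
    classical
    rw [Module.End.mul_apply, hB.apply_kernel, map_sum, map_sum, mul_comm g, mul_assoc,
      MvPowerSeries.coeff_mul]
    refine Finset.sum_congr rfl fun x _ => ?_
    rw [LinearMap.map_smul_of_tower, map_smul, hA.coord_eq, smul_eq_mul]

theorem add (hA : IsSkew A g) (hB : IsSkew B h) : IsSkew (A + B) (g + h) where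
  mem v hv := Submodule.add_mem _ (hA.mem v hv) (hB.mem v hv)
  coord_eq d mu := by
    rw [LinearMap.add_apply, map_add, hA.coord_eq, hB.coord_eq, add_mul, map_add]

theorem zero : IsSkew 0 0 where
  mem _ _ := Submodule.zero_mem _
  coord_eq d mu := by simp

theorem smul (c : ℂ) (hA : IsSkew A g) : IsSkew (c • A) (c • g) where
  mem v hv := Submodule.smul_mem _ _ (hA.mem v hv)
  coord_eq d mu := by
    rw [LinearMap.smul_apply, map_smul, hA.coord_eq, smul_mul_assoc, MvPowerSeries.coeff_smul,
      smul_eq_mul]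

theorem neg (hA : IsSkew A g) : IsSkew (-A) (-g) := by
  have := hA.smul (-1)
  rw [neg_one_smul ℂ g] at this
  have e : (-1 : ℂ) • A = -A := LinearMap.ext fun v => by
    rw [LinearMap.smul_apply, LinearMap.neg_apply, neg_one_smul]
  rwa [e] at this

theorem pow (hA : IsSkew A g) (k : ℕ) : IsSkew (A ^ k) (g ^ k) := by
  induction k with
  | zero => rw [pow_zero, pow_zero]; exact one
  | succ k ih => rw [pow_succ, pow_succ]; exact ih.mul hA

theorem sum {ι : Type} (s : Finset ι) {A : ι → Module.End Pol (Fock Pol)}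
    {g : ι → MvPowerSeries ℕ ℂ} (h : ∀ i ∈ s, IsSkew (A i) (g i)) :
    IsSkew (∑ i ∈ s, A i) (∑ i ∈ s, g i) := by
  classical
  induction s using Finset.induction_on with
  | empty => exact zero
  | insert i s hi ih =>
    rw [Finset.sum_insert hi, Finset.sum_insert hi]
    exact (h i (Finset.mem_insert_self i s)).add
      (ih fun j hj => h j (Finset.mem_insert_of_mem hj))

theorem list_prod {ι : Type} (l : List ι) {A : ι → Module.End Pol (Fock Pol)}
    {g : ι → MvPowerSeries ℕ ℂ} (h : ∀ i ∈ l, IsSkew (A i) (g i)) :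
    IsSkew (l.map A).prod (l.map g).prod := by
  induction l with
  | nil => exact one
  | cons i l ih =>
    rw [List.map_cons, List.map_cons, List.prod_cons, List.prod_cons]
    exact (h i List.mem_cons_self).mul (ih fun j hj => h j (List.mem_cons_of_mem i hj))

end IsSkew

theorem coeff_mul_congr {d : ℕ →₀ ℕ} {g g' : MvPowerSeries ℕ ℂ}
    (h : ∀ e ≤ d, MvPowerSeries.coeff e g = MvPowerSeries.coeff e g') (f : MvPowerSeries ℕ ℂ) :
    MvPowerSeries.coeff d (g * f) = MvPowerSeries.coeff d (g' * f) := by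
  classical
  rw [MvPowerSeries.coeff_mul, MvPowerSeries.coeff_mul]
  refine Finset.sum_congr rfl fun x hx => ?_
  rw [h _ (Finset.HasAntidiagonal.mem_antidiagonal.mp hx ▸ le_self_add)]

/-- An operator is adjoint to multiplication by `g` if it is so up to any given degree. -/
theorem IsSkew.of_truncation {A : Module.End Pol (Fock Pol)} {g : MvPowerSeries ℕ ℂ}
    (hmem : ∀ v ∈ youngSpan, A v ∈ youngSpan)
    (h : ∀ d : ℕ →₀ ℕ, ∃ (B : Module.End Pol (Fock Pol)) (g' : MvPowerSeries ℕ ℂ), IsSkew B g' ∧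
      A (kernel d) = B (kernel d) ∧
      ∀ e ≤ d, MvPowerSeries.coeff e g = MvPowerSeries.coeff e g') : IsSkew A g where
  mem := hmem
  coord_eq d mu := by
    obtain ⟨B, g', h1, h2, h3⟩ := h d
    rw [h2, h1.coord_eq, coeff_mul_congr h3]

theorem toSymm_X (n : ℕ+) : toSymm (C ((n : ℕ) : ℂ) * X n) = powerSum n := by
  rw [← smul_eq_C_mul, map_smul, toSymm, aeval_X, smul_smul,
    mul_inv_cancel₀ (Nat.cast_ne_zero.mpr n.ne_zero), one_smul]

/-- The operator `H_n` is adjoint to multiplication by the power sum `p_n`, because its transpose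
`H_{-n}` is multiplication by `n x_n` under the Boson-Fermion correspondence. -/
theorem isSkew_H (n : ℕ+) : IsSkew (H Pol (n : ℕ)) (powerSum n) where
  mem v hv := mem_youngSpan_of_lowSpan (fun m v hv =>
    lowSpan_mono (Nat.sub_le m n) (H_mem_lowSpan n.pos hv)) hv
  coord_eq d mu := by
    have hn : ((n : ℕ) : ℤ) ≠ 0 := by exact_mod_cast n.ne_zero
    have hmem : H Pol (-(n : ℕ)) (ketYoung Pol mu) ∈ youngSpan := by
      rw [ketYoung_eq, LinearMap.map_smul_of_tower]
      exact Submodule.smul_mem _ _ (H_ket_mem Pol mu (neg_ne_zero.mpr hn) youngSpan.toAddSubgroup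
        fun nu _ => ket_mem_youngSpan nu)
    have hvev : vev (H Pol (-(n : ℕ)) (ketYoung Pol mu)) =
        C ((n : ℕ) : ℂ) * X n * vev (ketYoung Pol mu) := by
      rw [ketYoung_eq, LinearMap.map_smul_of_tower, LinearMap.map_smul_of_tower, vev_H_neg,
        LinearMap.map_smul_of_tower, mul_smul_comm]
    rw [← toSymm_vev_ketYoung mu, ← toSymm_X, ← map_mul toSymm, ← hvev, coeff_toSymm_vev hmem,
      PiSym.apply_kernel, map_sum]
    refine Finset.sum_congr rfl fun lam _ => ?_
    rw [map_smul, smul_eq_mul, mul_comm]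
    congr 1
    rw [ketYoung_eq, ketYoung_eq, LinearMap.map_smul_of_tower, LinearMap.map_smul_of_tower,
      LinearMap.map_smul_of_tower, LinearMap.map_smul_of_tower, coord_apply, coord_apply,
      H_transpose Pol _ _ hn, smul_eq_mul,
      smul_eq_mul]
    ring

/-! ### Operators adjoint to plethysms -/

theorem exists_eq_nsmul_or {n : ℕ} (d : ℕ →₀ ℕ) :
    (∃ m : ℕ →₀ ℕ, d = n • m) ∨ ∃ i, ¬ n ∣ d i := by
  by_cases h : ∀ i, n ∣ d i
  · refine Or.inl ⟨d.mapRange (· / n) (Nat.zero_div n), ?_⟩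
    ext i
    rw [Finsupp.smul_apply, Finsupp.mapRange_apply, smul_eq_mul, Nat.mul_div_cancel' (h i)]
  · exact Or.inr (not_forall.mp h)

open Classical in
theorem coeff_powerSum (n : ℕ+) (d : ℕ →₀ ℕ) : MvPowerSeries.coeff d (powerSum n) =
    if ∃ k : ℕ, d = Finsupp.single k (n : ℕ) then 1 else 0 := rfl

theorem expand_powerSum (i n : ℕ+) :
    MvPowerSeries.expand n n.ne_zero (powerSum i) = powerSum (i * n) := by
  classical
  ext d
  rcases exists_eq_nsmul_or (n := n) d with ⟨m, rfl⟩ | ⟨j, hj⟩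
  · rw [MvPowerSeries.coeff_expand_smul, coeff_powerSum, coeff_powerSum]
    congr 1
    refine propext (exists_congr fun k => ?_)
    have : Finsupp.single k ((i * n : ℕ+) : ℕ) = (n : ℕ) • Finsupp.single k (i : ℕ) := by
      rw [Finsupp.smul_single, PNat.mul_coe, smul_eq_mul, mul_comm]
    rw [this]
    refine ⟨fun h => by rw [h], fun h => ?_⟩
    ext x
    have := DFunLike.congr_fun h x
    exact Nat.eq_of_mul_eq_mul_left n.pos this
  · rw [MvPowerSeries.coeff_expand_of_not_dvd _ _ _ hj, coeff_powerSum, if_neg]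
    rintro ⟨k, rfl⟩
    refine hj ?_
    rw [Finsupp.single_apply]
    split_ifs
    · exact Dvd.intro_left _ (PNat.mul_coe i n).symm
    · exact dvd_zero _

/-- The operator `P(H_n)` is adjoint to multiplication by the plethysm of `p_n` with the symmetric
function `P`. -/
theorem isSkew_evalH (P : Pol) (n : ℕ+) :
    IsSkew (evalH Pol P n) (MvPowerSeries.expand n n.ne_zero (toSymm P)) := by
  classical
  let g : ℕ+ → MvPowerSeries ℕ ℂ := fun i => ((i : ℕ) : ℂ)⁻¹ • powerSum (i * n)
  have h1 : (MvPowerSeries.expand n n.ne_zero).comp toSymm = aeval g := by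
    ext i
    simp only [AlgHom.comp_apply, toSymm, aeval_X, map_smul, expand_powerSum, g]
  have h2 : MvPowerSeries.expand n n.ne_zero (toSymm P) = ∑ d ∈ P.support, P.coeff d •
      ((d.support.sort (· ≤ ·)).map fun i : ℕ+ => g i ^ d i).prod := by
    rw [← AlgHom.comp_apply, h1, aeval_def, eval₂_eq]
    refine Finset.sum_congr rfl fun d _ => ?_
    rw [Algebra.smul_def]
    congr 1
    rw [← List.prod_toFinset _ (Finset.sort_nodup _ _), Finset.sort_toFinset]
  rw [h2, evalH]
  refine IsSkew.sum _ fun d _ => IsSkew.smul _ (IsSkew.list_prod _ fun i _ => IsSkew.pow ?_ _)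
  exact (isSkew_H (i * n)).smul _

theorem list_prod_mem_lowSpan {ι : Type} {n : ℕ} {A : ι → Module.End Pol (Fock Pol)} (l : List ι)
    (hl : l ≠ [])
    (h : ∀ i ∈ l, ∀ (m : ℕ) (v : Fock Pol), v ∈ lowSpan Pol ℂ m → A i v ∈ lowSpan Pol ℂ (m - n))
    {m : ℕ} {v : Fock Pol} (hv : v ∈ lowSpan Pol ℂ m) :
    (l.map A).prod v ∈ lowSpan Pol ℂ (m - n) := by
  induction l with
  | nil => exact absurd rfl hl
  | cons i l ih =>
    rw [List.map_cons, List.prod_cons, Module.End.mul_apply]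
    rcases eq_or_ne l [] with rfl | hl'
    · exact h i List.mem_cons_self m v hv
    · exact lowSpan_mono (Nat.sub_le _ _) (h i List.mem_cons_self _ _
        (ih hl' fun j hj => h j (List.mem_cons_of_mem i hj)))

/-- `P(H_n)` removes at least `n` boxes if `P` has no constant term. -/
theorem evalH_mem_lowSpan {P : Pol} (hP : constantCoeff P = 0) (n : ℕ+) {m : ℕ} {v : Fock Pol}
    (hv : v ∈ lowSpan Pol ℂ m) : evalH Pol P n v ∈ lowSpan Pol ℂ (m - n) := by
  rw [evalH, LinearMap.sum_apply]
  refine Submodule.sum_mem _ fun d hd => ?_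
  rw [LinearMap.smul_apply]
  refine Submodule.smul_mem _ _ (list_prod_mem_lowSpan _ ?_ ?_ hv)
  · intro h
    have h0 : d = 0 := by
      rw [← Finsupp.support_eq_empty, ← Finset.sort_toFinset d.support (· ≤ ·), h]
      rfl
    rw [h0, mem_support_iff] at hd
    exact hd hP
  · intro i hi m v hv
    have hi' : d i ≠ 0 := Finsupp.mem_support_iff.mp ((Finset.mem_sort _).mp hi)
    have hlow : ∀ (m : ℕ) (v : Fock Pol), v ∈ lowSpan Pol ℂ m →
        (((i : ℕ) : ℂ)⁻¹ • H Pol ((i * n : ℕ+) : ℕ)) v ∈ lowSpan Pol ℂ (m - n) := by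
      intro m v hv
      rw [LinearMap.smul_apply]
      refine Submodule.smul_mem _ _ (lowSpan_mono ?_ (H_mem_lowSpan (i * n).pos hv))
      rw [PNat.mul_coe]
      exact Nat.sub_le_sub_left (Nat.le_mul_of_pos_left _ i.pos) m
    obtain ⟨k, hk⟩ := Nat.exists_eq_succ_of_ne_zero hi'
    rw [hk]
    have := list_prod_mem_lowSpan (n := n) (List.replicate (k + 1) ())
      (A := fun _ => ((i : ℕ) : ℂ)⁻¹ • H Pol ((i * n : ℕ+) : ℕ)) (by simp) (fun _ _ => hlow) hv
    rwa [List.map_replicate, List.prod_replicate] at this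

theorem coeff_expand_eq_zero {n : ℕ+} {f : MvPowerSeries ℕ ℂ} (hf : MvPowerSeries.coeff 0 f = 0)
    {d : ℕ →₀ ℕ} (hd : d.degree < n) :
    MvPowerSeries.coeff d (MvPowerSeries.expand n n.ne_zero f) = 0 := by
  rcases exists_eq_nsmul_or (n := n) d with ⟨m, rfl⟩ | ⟨j, hj⟩
  · rw [MvPowerSeries.coeff_expand_smul]
    have : m = 0 := by
      rw [map_nsmul, smul_eq_mul] at hd
      rw [← Finsupp.degree_eq_zero_iff]
      by_contra h
      have := Nat.le_mul_of_pos_right (n : ℕ) (Nat.pos_of_ne_zero h)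
      omega
    rw [this, hf]
  · exact MvPowerSeries.coeff_expand_of_not_dvd _ _ _ hj

/-- `∑_{n ≥ 1} (1/n) f(x_1^n, x_2^n, …)`, for a series `f` without constant term. -/
def sumExpand (f : MvPowerSeries ℕ ℂ) : MvPowerSeries ℕ ℂ := fun d =>
  ∑ n ∈ Finset.Icc 1 d.degree.succPNat,
    ((n : ℕ) : ℂ)⁻¹ * MvPowerSeries.coeff d (MvPowerSeries.expand n n.ne_zero f)

/-- In degree `d` only the terms with `n ≤ |d|` contribute. -/
theorem coeff_sumExpand {f : MvPowerSeries ℕ ℂ} (hf : MvPowerSeries.coeff 0 f = 0) {d : ℕ →₀ ℕ}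
    {I : Finset ℕ+} (hI : ∀ n : ℕ+, (n : ℕ) ≤ d.degree → n ∈ I) :
    MvPowerSeries.coeff d (sumExpand f) = MvPowerSeries.coeff d
      (∑ n ∈ I, ((n : ℕ) : ℂ)⁻¹ • MvPowerSeries.expand n n.ne_zero f) := by
  classical
  have hdef : MvPowerSeries.coeff d (sumExpand f) = ∑ n ∈ Finset.Icc 1 d.degree.succPNat,
      ((n : ℕ) : ℂ)⁻¹ * MvPowerSeries.coeff d (MvPowerSeries.expand n n.ne_zero f) := rfl
  rw [map_sum, hdef]
  have hz : ∀ n : ℕ+, ¬ (n : ℕ) ≤ d.degree →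
      MvPowerSeries.coeff d (MvPowerSeries.expand n n.ne_zero f) = 0 := fun n hn =>
    coeff_expand_eq_zero hf (not_le.mp hn)
  have hfil : ∀ J : Finset ℕ+, (∀ n : ℕ+, (n : ℕ) ≤ d.degree → n ∈ J) →
      ∑ n ∈ J, ((n : ℕ) : ℂ)⁻¹ * MvPowerSeries.coeff d (MvPowerSeries.expand n n.ne_zero f) =
      ∑ n ∈ J.filter (fun n : ℕ+ => (n : ℕ) ≤ d.degree),
        ((n : ℕ) : ℂ)⁻¹ * MvPowerSeries.coeff d (MvPowerSeries.expand n n.ne_zero f) := by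
    intro J _
    rw [Finset.sum_filter_of_ne]
    intro n _ hne
    by_contra h
    exact hne (by rw [hz n h, mul_zero])
  have hIcc : ∀ n : ℕ+, (n : ℕ) ≤ d.degree → n ∈ Finset.Icc 1 d.degree.succPNat := fun n hn => by
    refine Finset.mem_Icc.mpr ⟨one_le, ?_⟩
    rw [← PNat.coe_le_coe, Nat.succPNat_coe]
    omega
  simp only [MvPowerSeries.coeff_smul]
  rw [hfil _ hIcc, hfil I hI]
  refine Finset.sum_congr ?_ fun _ _ => rfl
  ext n
  simp only [Finset.mem_filter]
  exact ⟨fun h => ⟨hI n h.2, h.2⟩, fun h => ⟨hIcc n h.2, h.2⟩⟩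

/-- The operator `∑_{n ≥ 1} (1/n) P(H_n)`, in the exponent of `L_π^⊥`. -/
def sumEvalH (P : Pol) : Module.End Pol (Fock Pol) :=
  locSum fun n : ℕ+ => ((n : ℕ) : ℂ)⁻¹ • evalH Pol P n

theorem sumEvalH_apply {P : Pol} (hP : constantCoeff P = 0) {m : ℕ} {v : Fock Pol}
    (hv : v ∈ lowSpan Pol ℂ m) {I : Finset ℕ+} (hI : ∀ n : ℕ+, (n : ℕ) ≤ m → n ∈ I) :
    sumEvalH P v = (∑ n ∈ I, ((n : ℕ) : ℂ)⁻¹ • evalH Pol P n) v := by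
  rw [sumEvalH, locSum_apply_of_mem_lowSpan (𝕜 := ℂ) I _ hv, LinearMap.sum_apply]
  intro n hn v hv
  have h1 := evalH_mem_lowSpan hP n hv
  have h2 : ¬ (n : ℕ) ≤ m := fun h => hn (hI n h)
  rw [Nat.sub_eq_zero_of_le (by omega)] at h1
  rw [LinearMap.smul_apply, eq_zero_of_mem_lowSpan h1, smul_zero]

theorem sumEvalH_mem_lowSpan {P : Pol} (hP : constantCoeff P = 0) {m : ℕ} {v : Fock Pol}
    (hv : v ∈ lowSpan Pol ℂ m) : sumEvalH P v ∈ lowSpan Pol ℂ (m - 1) := by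
  obtain ⟨I, -, hI⟩ := exists_finset_pnat m ∅
  rw [sumEvalH_apply hP hv hI, LinearMap.sum_apply]
  refine Submodule.sum_mem _ fun n _ => ?_
  rw [LinearMap.smul_apply]
  exact Submodule.smul_mem _ _
    (lowSpan_mono (Nat.sub_le_sub_left n.pos m) (evalH_mem_lowSpan hP n hv))

theorem degree_le_of_le {d e : ℕ →₀ ℕ} (h : e ≤ d) : e.degree ≤ d.degree := by
  obtain ⟨c, rfl⟩ := exists_add_of_le h
  rw [map_add]
  exact Nat.le_add_right _ _

/-- The power sums have no constant term, so that `toSymm` preserves constant terms. -/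
theorem constantCoeff_eq_zero_of_toSymm {P : Pol} (hP : MvPowerSeries.coeff 0 (toSymm P) = 0) :
    constantCoeff P = 0 := by
  have h : ((MvPowerSeries.constantCoeff (σ := ℕ) (R := ℂ)).comp toSymm.toRingHom) =
      (constantCoeff : Pol →+* ℂ) := by
    ext i
    · simp [MvPowerSeries.algebraMap_apply]
    · have : MvPowerSeries.constantCoeff (powerSum i) = 0 := by
        rw [← MvPowerSeries.coeff_zero_eq_constantCoeff_apply, coeff_powerSum, if_neg]
        rintro ⟨k, hk⟩
        have := DFunLike.congr_fun hk k
        rw [Finsupp.single_eq_same] at this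
        exact i.ne_zero this.symm
      simp [toSymm, this]
  rw [← h]
  rwa [MvPowerSeries.coeff_zero_eq_constantCoeff_apply] at hP

theorem isSkew_sumEvalH {P : Pol} (hP : MvPowerSeries.coeff 0 (toSymm P) = 0) :
    IsSkew (sumEvalH P) (sumExpand (toSymm P)) := by
  have hP' := constantCoeff_eq_zero_of_toSymm hP
  refine IsSkew.of_truncation (fun v hv => mem_youngSpan_of_lowSpan (fun m v hv =>
    lowSpan_mono (Nat.sub_le m 1) (sumEvalH_mem_lowSpan hP' hv)) hv) fun d => ?_
  obtain ⟨I, -, hI⟩ := exists_finset_pnat (d.degree + 1) ∅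
  refine ⟨_, _, IsSkew.sum I fun n _ => (isSkew_evalH P n).smul _,
    sumEvalH_apply hP' (kernel_mem_lowSpan d) hI, fun e he => ?_⟩
  refine coeff_sumExpand hP fun n hn => hI n ?_
  have := degree_le_of_le he
  omega

/-- The exponential of a power series without constant term: in degree `d` only the powers up to
`|d|` contribute. -/
def expSeries (f : MvPowerSeries ℕ ℂ) : MvPowerSeries ℕ ℂ := fun d =>
  MvPowerSeries.coeff d (∑ k ∈ Finset.range (d.degree + 1), ((Nat.factorial k : ℂ)⁻¹) • f ^ k)

theorem coeff_pow_eq_zero {f : MvPowerSeries ℕ ℂ} (hf : MvPowerSeries.coeff 0 f = 0) {k : ℕ} :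
    ∀ {d : ℕ →₀ ℕ}, d.degree < k → MvPowerSeries.coeff d (f ^ k) = 0 := by
  classical
  induction k with
  | zero => exact fun h => absurd h (Nat.not_lt_zero _)
  | succ k ih =>
    intro d hd
    rw [pow_succ', MvPowerSeries.coeff_mul]
    refine Finset.sum_eq_zero fun x hx => ?_
    by_cases h0 : x.1 = 0
    · rw [h0, hf, zero_mul]
    · rw [ih, mul_zero]
      have h1 := congrArg Finsupp.degree (Finset.HasAntidiagonal.mem_antidiagonal.mp hx)
      rw [map_add] at h1
      have h2 : x.1.degree ≠ 0 := fun h => h0 ((Finsupp.degree_eq_zero_iff _).mp h)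
      omega

theorem coeff_expSeries {f : MvPowerSeries ℕ ℂ} (hf : MvPowerSeries.coeff 0 f = 0) {d : ℕ →₀ ℕ}
    {K : ℕ} (hK : d.degree < K) : MvPowerSeries.coeff d (expSeries f) =
      MvPowerSeries.coeff d (∑ k ∈ Finset.range K, ((Nat.factorial k : ℂ)⁻¹) • f ^ k) := by
  have hdef : MvPowerSeries.coeff d (expSeries f) = MvPowerSeries.coeff d
      (∑ k ∈ Finset.range (d.degree + 1), ((Nat.factorial k : ℂ)⁻¹) • f ^ k) := rfl
  rw [hdef, map_sum, map_sum]
  refine Finset.sum_subset (Finset.range_mono hK) fun k _ hk => ?_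
  rw [Finset.mem_range] at hk
  rw [MvPowerSeries.coeff_smul, coeff_pow_eq_zero hf (by omega), mul_zero]

theorem IsSkew.locExp {A : Module.End Pol (Fock Pol)} {g : MvPowerSeries ℕ ℂ} (h : IsSkew A g)
    (hA : ∀ (m : ℕ) (v : Fock Pol), v ∈ lowSpan Pol ℂ m → A v ∈ lowSpan Pol ℂ (m - 1))
    (hg : MvPowerSeries.coeff 0 g = 0) : IsSkew (locExp A) (expSeries g) := by
  refine IsSkew.of_truncation (fun v hv => ?_) fun d => ?_
  · obtain ⟨m, hm⟩ := exists_mem_lowSpan hv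
    rw [locExp_apply_of_mem_lowSpan hA hm le_rfl]
    exact Submodule.sum_mem _ fun k _ => Submodule.smul_mem _ _ ((h.pow k).mem v hv)
  · refine ⟨_, _, IsSkew.sum (Finset.range (d.degree + 1)) fun k _ =>
      (h.pow k).smul ((Nat.factorial k : ℂ)⁻¹), ?_, fun e he => ?_⟩
    · rw [locExp_apply_of_mem_lowSpan hA (kernel_mem_lowSpan d) le_rfl, LinearMap.sum_apply]
      rfl
    · exact coeff_expSeries hg (Nat.lt_succ_of_le (degree_le_of_le he))

/-! ### The series `L_π` as an exponential -/

/-- The operator `x^d ↦ |d| x^d` on power series. -/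
def eulerFun (f : MvPowerSeries ℕ ℂ) : MvPowerSeries ℕ ℂ := fun d =>
  (d.degree : ℂ) * MvPowerSeries.coeff d f

theorem coeff_eulerFun (f : MvPowerSeries ℕ ℂ) (d : ℕ →₀ ℕ) :
    MvPowerSeries.coeff d (eulerFun f) = (d.degree : ℂ) * MvPowerSeries.coeff d f := rfl

/-- The Euler derivation `x^d ↦ |d| x^d` of power series. -/
def eulerDer : Derivation ℂ (MvPowerSeries ℕ ℂ) (MvPowerSeries ℕ ℂ) :=
  Derivation.mk'
    { toFun := eulerFun
      map_add' := fun f g => MvPowerSeries.ext fun d => mul_add (d.degree : ℂ) _ _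
      map_smul' := fun c f => MvPowerSeries.ext fun d => mul_left_comm (d.degree : ℂ) c _ }
    fun f g => by
      classical
      ext d
      change MvPowerSeries.coeff d (eulerFun (f * g)) =
        MvPowerSeries.coeff d (f * eulerFun g + g * eulerFun f)
      rw [mul_comm g, map_add, coeff_eulerFun, MvPowerSeries.coeff_mul, MvPowerSeries.coeff_mul,
        MvPowerSeries.coeff_mul, ← Finset.sum_add_distrib, Finset.mul_sum]
      refine Finset.sum_congr rfl fun x hx => ?_
      have hd : (d.degree : ℂ) = x.1.degree + x.2.degree := by
        rw [← Finset.HasAntidiagonal.mem_antidiagonal.mp hx, map_add, Nat.cast_add]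
      rw [hd, coeff_eulerFun, coeff_eulerFun]
      ring

theorem coeff_eulerDer (f : MvPowerSeries ℕ ℂ) (d : ℕ →₀ ℕ) :
    MvPowerSeries.coeff d (eulerDer f) = (d.degree : ℂ) * MvPowerSeries.coeff d f := rfl

/-- A solution `f` of the differential equation `E f = g f`, for the Euler derivation `E`, is
determined by its constant term. -/
theorem eq_of_eulerDer {f f' g : MvPowerSeries ℕ ℂ} (hg : MvPowerSeries.coeff 0 g = 0)
    (h0 : MvPowerSeries.coeff 0 f = MvPowerSeries.coeff 0 f') (hf : eulerDer f = g * f)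
    (hf' : eulerDer f' = g * f') : f = f' := by
  classical
  have key : ∀ (n : ℕ) (d : ℕ →₀ ℕ), d.degree = n →
      MvPowerSeries.coeff d f = MvPowerSeries.coeff d f' := by
    intro n
    induction n using Nat.strong_induction_on with
    | _ n ih =>
      intro d hd
      rcases eq_or_ne d 0 with rfl | hd0
      · exact h0
      have hne : (d.degree : ℂ) ≠ 0 :=
        Nat.cast_ne_zero.mpr fun h => hd0 ((Finsupp.degree_eq_zero_iff d).mp h)
      refine mul_left_cancel₀ hne ?_
      rw [← coeff_eulerDer, ← coeff_eulerDer, hf, hf', MvPowerSeries.coeff_mul,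
        MvPowerSeries.coeff_mul]
      refine Finset.sum_congr rfl fun x hx => ?_
      rcases eq_or_ne x.1 0 with h | h
      · rw [h, hg, zero_mul, zero_mul]
      · have h1 := congrArg Finsupp.degree (Finset.HasAntidiagonal.mem_antidiagonal.mp hx)
        rw [map_add] at h1
        have h2 : x.1.degree ≠ 0 := fun h' => h ((Finsupp.degree_eq_zero_iff _).mp h')
        rw [ih x.2.degree (by omega) x.2 rfl]
  ext d
  exact key _ d rfl

/-- The chain rule for the exponential series. -/
theorem eulerDer_expSeries {f : MvPowerSeries ℕ ℂ} (hf : MvPowerSeries.coeff 0 f = 0) :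
    eulerDer (expSeries f) = eulerDer f * expSeries f := by
  ext d
  have hD : eulerDer (∑ k ∈ Finset.range (d.degree + 1 + 1), ((Nat.factorial k : ℂ)⁻¹) • f ^ k) =
      (∑ k ∈ Finset.range (d.degree + 1), ((Nat.factorial k : ℂ)⁻¹) • f ^ k) * eulerDer f := by
    rw [map_sum, Finset.sum_range_succ', Finset.sum_mul, pow_zero, eulerDer.map_smul,
      Derivation.map_one_eq_zero, smul_zero, add_zero]
    refine Finset.sum_congr rfl fun k _ => ?_
    rw [eulerDer.map_smul, Derivation.leibniz_pow, Nat.add_sub_cancel, ← Nat.cast_smul_eq_nsmul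
      ℂ, smul_smul, smul_mul_assoc, smul_eq_mul, Nat.factorial_succ,
      Nat.cast_mul, mul_inv_rev, mul_assoc,
      inv_mul_cancel₀ (Nat.cast_ne_zero.mpr (Nat.succ_ne_zero k)), mul_one]
  rw [coeff_eulerDer, coeff_expSeries hf (K := d.degree + 1 + 1) (by omega), ← coeff_eulerDer, hD,
    mul_comm (eulerDer f)]
  exact coeff_mul_congr (fun e he =>
    (coeff_expSeries hf (Nat.lt_succ_of_le (degree_le_of_le he))).symm) _

theorem coeff_zero_schur {π : YoungDiagram} (hπ : π ≠ ⊥) :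
    MvPowerSeries.coeff 0 (schur π) = 0 := by
  by_contra h
  have h1 := card_of_coeff_schur_ne_zero h
  rw [map_zero] at h1
  refine hπ (YoungDiagram.ext ?_)
  rw [Finset.card_eq_zero.mp h1, YoungDiagram.cells_bot]

theorem finite_tableaux_le (π : YoungDiagram) (d : ℕ →₀ ℕ) :
    {T : SemistandardYoungTableau π | content T ≤ d}.Finite := by
  classical
  refine ((Finset.Iic d).finite_toSet.biUnion (t := fun e =>
    {T : SemistandardYoungTableau π | content T = e}) fun e _ => ?_).subset fun T hT => ?_
  · exact Set.finite_coe_iff.mp (finite_tableaux π e)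
  · exact Set.mem_biUnion (Finset.mem_coe.mpr (Finset.mem_Iic.mpr hT)) rfl

/-- The tableaux whose monomial divides `x^d`. -/
def tableauxLE (π : YoungDiagram) (d : ℕ →₀ ℕ) : Finset (SemistandardYoungTableau π) :=
  (finite_tableaux_le π d).toFinset

theorem mem_tableauxLE {π : YoungDiagram} {d : ℕ →₀ ℕ} {T : SemistandardYoungTableau π} :
    T ∈ tableauxLE π d ↔ content T ≤ d := (finite_tableaux_le π d).mem_toFinset

/-- The monomial `x^T` of a tableau. -/
def tableauMonomial {π : YoungDiagram} (T : SemistandardYoungTableau π) : MvPowerSeries ℕ ℂ :=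
  MvPowerSeries.monomial (content T) 1

theorem tableauMonomial_pow {π : YoungDiagram} (T : SemistandardYoungTableau π) (k : ℕ) :
    tableauMonomial T ^ k = MvPowerSeries.monomial (k • content T) 1 := by
  rw [tableauMonomial, MvPowerSeries.monomial_pow, one_pow]

/-- Up to degree `d` the series `L_π` is a finite product. -/
theorem coeff_lSeries {π : YoungDiagram} (hπ : π ≠ ⊥) {d e : ℕ →₀ ℕ} (he : e ≤ d) :
    MvPowerSeries.coeff e (lSeries π) =
      MvPowerSeries.coeff e (∏ T ∈ tableauxLE π d, (1 - tableauMonomial T)) := by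
  classical
  have hdef : MvPowerSeries.coeff e (lSeries π) =
      ∑ᶠ A : {A : Finset (SemistandardYoungTableau π) // ∑ T ∈ A, content T = e},
        (-1 : ℂ) ^ A.val.card := congrFun (if_neg hπ) e
  have hset : {A : Finset (SemistandardYoungTableau π) | ∑ T ∈ A, content T = e} =
      (((tableauxLE π d).powerset.filter fun A => ∑ T ∈ A, content T = e :
        Finset (Finset (SemistandardYoungTableau π))) : Set _) := by
    ext A
    simp only [Set.mem_ofPred_eq, Finset.coe_filter, Finset.mem_powerset]
    refine ⟨fun h => ⟨fun T hT => ?_, h⟩, fun h => h.2⟩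
    exact mem_tableauxLE.mpr ((Finset.single_le_sum (f := content) (fun _ _ => zero_le) hT).trans
      (h.le.trans he))
  have hfin : ∑ᶠ A : {A : Finset (SemistandardYoungTableau π) // ∑ T ∈ A, content T = e},
      (-1 : ℂ) ^ A.val.card = ∑ A ∈ (tableauxLE π d).powerset.filter
        (fun A => ∑ T ∈ A, content T = e), (-1 : ℂ) ^ A.card := by
    rw [← finsum_mem_coe_finset, ← hset]
    exact finsum_set_coe_eq_finsum_mem (f := fun A : Finset (SemistandardYoungTableau π) =>
      (-1 : ℂ) ^ A.card) {A | ∑ T ∈ A, content T = e}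
  have hprod : ∏ T ∈ tableauxLE π d, (1 - tableauMonomial T) =
      ∑ A ∈ (tableauxLE π d).powerset,
        ((-1 : ℂ) ^ A.card) • MvPowerSeries.monomial (∑ T ∈ A, content T) (1 : ℂ) := by
    simp only [sub_eq_add_neg]
    rw [Finset.prod_one_add]
    refine Finset.sum_congr rfl fun A _ => ?_
    have h1 : ∀ A : Finset (SemistandardYoungTableau π), ∏ T ∈ A, tableauMonomial T =
        MvPowerSeries.monomial (∑ T ∈ A, content T) (1 : ℂ) := by
      intro A
      induction A using Finset.induction_on with
      | empty => simp [MvPowerSeries.monomial_zero_one]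
      | insert T A hT ih =>
        rw [Finset.prod_insert hT, Finset.sum_insert hT, ih, tableauMonomial,
          MvPowerSeries.monomial_mul_monomial, one_mul]
    rw [Finset.prod_neg, h1]
    rcases Nat.even_or_odd A.card with h | h <;> simp [h.neg_one_pow]
  rw [hdef, hfin, hprod, map_sum, Finset.sum_filter]
  refine Finset.sum_congr rfl fun A _ => ?_
  rw [MvPowerSeries.coeff_smul, MvPowerSeries.coeff_monomial]
  simp only [eq_comm (a := e)]
  split_ifs <;> simp

/-- A truncation of the geometric series `x^T / (1 - x^T)`. -/
def geomTrunc {π : YoungDiagram} (N : ℕ) (T : SemistandardYoungTableau π) : MvPowerSeries ℕ ℂ :=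
  ∑ k ∈ Finset.range N, tableauMonomial T ^ (k + 1)

theorem geomTrunc_mul {π : YoungDiagram} (N : ℕ) (T : SemistandardYoungTableau π) :
    tableauMonomial T =
      geomTrunc N T * (1 - tableauMonomial T) + tableauMonomial T ^ (N + 1) := by
  have := geom_sum_mul_neg (tableauMonomial T) N
  have h2 : geomTrunc N T = (∑ k ∈ Finset.range N, tableauMonomial T ^ k) * tableauMonomial T := by
    rw [geomTrunc, Finset.sum_mul]
    exact Finset.sum_congr rfl fun k _ => pow_succ _ _
  rw [h2, mul_right_comm, this, pow_succ]
  ring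

theorem card_pos_of_ne_bot {π : YoungDiagram} (hπ : π ≠ ⊥) : 0 < π.card := by
  refine Nat.pos_of_ne_zero fun h => hπ (YoungDiagram.ext ?_)
  rw [Finset.card_eq_zero.mp h, YoungDiagram.cells_bot]

/-- The logarithmic derivative of the product `L_π` is a sum of geometric series. -/
theorem coeff_eulerDer_lSeries {π : YoungDiagram} (hπ : π ≠ ⊥) (d : ℕ →₀ ℕ) :
    MvPowerSeries.coeff d (eulerDer (lSeries π)) = -MvPowerSeries.coeff d
      (((π.card : ℂ) • ∑ T ∈ tableauxLE π d, geomTrunc d.degree T) * lSeries π) := by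
  classical
  set F := tableauxLE π d
  set P := ∏ T ∈ F, (1 - tableauMonomial T) with hP
  have hmon : ∀ T : SemistandardYoungTableau π,
      eulerDer (1 - tableauMonomial T) = -((π.card : ℂ) • tableauMonomial T) := by
    intro T
    rw [map_sub, Derivation.map_one_eq_zero, zero_sub]
    congr 1
    ext e
    rw [coeff_eulerDer, MvPowerSeries.coeff_smul, tableauMonomial, MvPowerSeries.coeff_monomial]
    split_ifs with h
    · rw [h, degree_content]
    · rw [mul_zero, mul_zero]
  have hT : ∀ T ∈ F, MvPowerSeries.coeff d ((∏ T' ∈ F.erase T, (1 - tableauMonomial T')) *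
      eulerDer (1 - tableauMonomial T)) =
      -((π.card : ℂ) * MvPowerSeries.coeff d (geomTrunc d.degree T * P)) := by
    intro T hT
    have h1 : (∏ T' ∈ F.erase T, (1 - tableauMonomial T')) * (1 - tableauMonomial T) = P :=
      Finset.prod_erase_mul _ _ hT
    -- `x^T` has positive degree, so the remainder of the geometric series has degree greater than
    -- `|d|`
    have hz : MvPowerSeries.coeff d ((∏ T' ∈ F.erase T, (1 - tableauMonomial T')) *
        tableauMonomial T ^ (d.degree + 1)) = 0 := by
      rw [tableauMonomial_pow, MvPowerSeries.coeff_mul_monomial, if_neg]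
      intro hle
      have h2 := degree_le_of_le hle
      rw [map_nsmul, degree_content, smul_eq_mul] at h2
      have := Nat.le_mul_of_pos_right (d.degree + 1) (card_pos_of_ne_bot hπ)
      omega
    have h3 : (∏ T' ∈ F.erase T, (1 - tableauMonomial T')) * tableauMonomial T =
        geomTrunc d.degree T * P + (∏ T' ∈ F.erase T, (1 - tableauMonomial T')) *
          tableauMonomial T ^ (d.degree + 1) := by
      conv_lhs => rw [geomTrunc_mul d.degree T]
      rw [← h1]
      ring
    rw [hmon, mul_neg, mul_smul_comm, map_neg, MvPowerSeries.coeff_smul, h3, map_add, hz, add_zero]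
  have e1 : MvPowerSeries.coeff d (eulerDer (lSeries π)) = MvPowerSeries.coeff d (eulerDer P) := by
    rw [coeff_eulerDer, coeff_eulerDer, coeff_lSeries hπ le_rfl]
  have e2 : ∀ g, MvPowerSeries.coeff d (g * lSeries π) = MvPowerSeries.coeff d (g * P) := by
    intro g
    rw [mul_comm, mul_comm g]
    exact coeff_mul_congr (fun e he => coeff_lSeries hπ he) g
  rw [e1, e2, hP, derivation_prod, map_sum, smul_mul_assoc, MvPowerSeries.coeff_smul,
    Finset.sum_mul, map_sum, Finset.mul_sum, ← Finset.sum_neg_distrib]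
  refine Finset.sum_congr rfl fun T h => ?_
  rw [Finset.prod_update_of_mem h, Finset.sdiff_singleton_eq_erase, mul_comm, hT T h]

theorem coeff_expand_schur {π : YoungDiagram} {d e : ℕ →₀ ℕ} (he : e ≤ d) (n : ℕ+) :
    MvPowerSeries.coeff e (MvPowerSeries.expand n n.ne_zero (schur π)) =
      ∑ T ∈ tableauxLE π d, MvPowerSeries.coeff e (tableauMonomial T ^ (n : ℕ)) := by
  classical
  simp only [tableauMonomial_pow, MvPowerSeries.coeff_monomial]
  rcases exists_eq_nsmul_or (n := n) e with ⟨m, rfl⟩ | ⟨j, hj⟩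
  · have hinj : ∀ T : SemistandardYoungTableau π,
        (n : ℕ) • m = (n : ℕ) • content T ↔ content T = m := by
      refine fun T => ⟨fun h => ?_, fun h => by rw [h]⟩
      ext x
      exact (Nat.eq_of_mul_eq_mul_left n.pos (DFunLike.congr_fun h x)).symm
    have hm : m ≤ d := le_trans (fun x => Nat.le_mul_of_pos_left (m x) n.pos) he
    simp only [hinj]
    rw [MvPowerSeries.coeff_expand_smul, coeff_schur, ← Finset.sum_filter, Finset.sum_const,
      nsmul_eq_mul, mul_one, Nat.subtype_card]
    intro T
    rw [Finset.mem_filter, mem_tableauxLE]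
    exact ⟨fun h => h.2, fun h => ⟨h.le.trans hm, h⟩⟩
  · rw [MvPowerSeries.coeff_expand_of_not_dvd _ _ _ hj]
    refine (Finset.sum_eq_zero fun T _ => if_neg ?_).symm
    rintro rfl
    exact hj ⟨content T j, rfl⟩

/-- Up to degree `d`, the term `(1/n) S_π(x_1^n, x_2^n, …)` has the monomials `x^{nT} / n`, which
the Euler derivation multiplies by `n |π|`. -/
theorem coeff_eulerDer_sumExpand {π : YoungDiagram} (hπ : π ≠ ⊥) {d e : ℕ →₀ ℕ} (he : e ≤ d) :
    MvPowerSeries.coeff e (eulerDer (sumExpand (schur π))) = MvPowerSeries.coeff e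
      ((π.card : ℂ) • ∑ T ∈ tableauxLE π d, geomTrunc d.degree T) := by
  classical
  have hI : ∀ n : ℕ+, (n : ℕ) ≤ e.degree → n ∈ (Finset.range d.degree).image Nat.succPNat := by
    intro n hn
    have := degree_le_of_le he
    have hp := n.pos
    refine Finset.mem_image.mpr ⟨n.natPred, Finset.mem_range.mpr ?_, PNat.succPNat_natPred n⟩
    rw [PNat.natPred]
    omega
  rw [coeff_eulerDer, coeff_sumExpand (coeff_zero_schur hπ) hI, map_sum,
    Finset.sum_image fun a _ b _ h => Nat.succPNat_injective h, MvPowerSeries.coeff_smul, map_sum,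
    Finset.mul_sum, Finset.mul_sum]
  simp only [geomTrunc, map_sum, MvPowerSeries.coeff_smul, coeff_expand_schur he, Finset.mul_sum]
  rw [Finset.sum_comm]
  refine Finset.sum_congr rfl fun T _ => Finset.sum_congr rfl fun k _ => ?_
  rw [Nat.succPNat_coe, tableauMonomial_pow, MvPowerSeries.coeff_monomial]
  split_ifs with h
  · have hk : ((k.succ : ℕ) : ℂ) ≠ 0 := Nat.cast_ne_zero.mpr (Nat.succ_ne_zero k)
    rw [h, map_nsmul, degree_content, smul_eq_mul, Nat.cast_mul]
    field_simp
  · simp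

/-- `L_π = exp(-∑_{n ≥ 1} (1/n) S_π(x_1^n, x_2^n, …))`. -/
theorem expSeries_eq_lSeries {π : YoungDiagram} (hπ : π ≠ ⊥) :
    expSeries (-sumExpand (schur π)) = lSeries π := by
  have h0 : MvPowerSeries.coeff 0 (-sumExpand (schur π)) = 0 := by
    have h1 := coeff_sumExpand (coeff_zero_schur hπ) (d := 0) (I := ∅) fun n hn =>
      absurd hn (by rw [map_zero]; exact not_le.mpr n.pos)
    rw [map_neg, h1, Finset.sum_empty, map_zero, neg_zero]
  refine eq_of_eulerDer (g := eulerDer (-sumExpand (schur π))) ?_ ?_ (eulerDer_expSeries h0) ?_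
  · rw [coeff_eulerDer, h0, mul_zero]
  · have he : tableauxLE π 0 = ∅ := by
      refine Finset.eq_empty_of_forall_notMem fun T hT => ?_
      have h1 := degree_le_of_le (mem_tableauxLE.mp hT)
      rw [degree_content, map_zero] at h1
      exact (card_pos_of_ne_bot hπ).not_ge h1
    rw [coeff_lSeries hπ le_rfl, he, Finset.prod_empty,
      coeff_expSeries h0 (K := 1) (by rw [map_zero]; exact one_pos)]
    simp
  · ext d
    rw [coeff_eulerDer_lSeries hπ, map_neg, neg_mul, map_neg]
    congr 1
    exact coeff_mul_congr (fun e he => (coeff_eulerDer_sumExpand hπ he).symm) _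

/-! ### The operator `L_π^⊥` -/

theorem isSkew_lPerpOp (π : YoungDiagram) : IsSkew (lPerpOp Pol π) (lSeries π) := by
  by_cases hπ : π = ⊥
  · have h : lSeries π = 1 := if_pos hπ
    rw [lPerpOp, if_pos hπ, h]
    exact IsSkew.one
  have h0 : MvPowerSeries.coeff 0 (toSymm (polyP π)) = 0 := by
    rw [toSymm_polyP, coeff_zero_schur hπ]
  have h1 := isSkew_sumEvalH h0
  rw [toSymm_polyP] at h1
  rw [lPerpOp, if_neg hπ, ← expSeries_eq_lSeries hπ]
  refine IsSkew.locExp h1.neg (fun m v hv => ?_) ?_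
  · rw [LinearMap.neg_apply]
    exact Submodule.neg_mem _ (sumEvalH_mem_lowSpan (constantCoeff_eq_zero_of_toSymm h0) hv)
  · have h2 := coeff_sumExpand (coeff_zero_schur hπ) (d := 0) (I := ∅) fun n hn =>
      absurd hn (by rw [map_zero]; exact not_le.mpr n.pos)
    rw [map_neg, h2, Finset.sum_empty, map_zero, neg_zero]

open Classical in
theorem schurCoeff_schur (lam : YoungDiagram) : schurCoeff (schur lam) = Pi.single lam 1 := by
  refine schurCoeff_eq fun d => ?_
  rw [finsum_eq_single _ lam, Pi.single_eq_same, one_mul]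
  intro mu hmu
  rw [Pi.single_eq_of_ne hmu, zero_mul]

/-- The matrix coefficients of an operator adjoint to multiplication by `g` are the scalar products
`⟨S_lam, g S_mu⟩`. -/
theorem IsSkew.hall_eq {A : Module.End Pol (Fock Pol)} {g : MvPowerSeries ℕ ℂ} (h : IsSkew A g)
    (lam mu : YoungDiagram) :
    hall (schur lam) (g * schur mu) = coord mu (A (ketYoung Pol lam)) := by
  classical
  have h1 : schurCoeff (g * schur mu) = fun lam => coord mu (A (ketYoung Pol lam)) := by
    refine schurCoeff_eq fun d => ?_
    rw [sum_mul_coeff_schur, ← h.coord_eq, PiSym.apply_kernel, map_sum]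
    refine Finset.sum_congr rfl fun nu _ => ?_
    rw [map_smul, smul_eq_mul, mul_comm]
  rw [hall, schurCoeff_schur, h1, finsum_eq_single _ lam, Pi.single_eq_same, one_mul]
  intro nu hnu
  rw [Pi.single_eq_of_ne hnu, zero_mul]

theorem IsSkew.skew_schur {A : Module.End Pol (Fock Pol)} {g : MvPowerSeries ℕ ℂ} (h : IsSkew A g)
    (lam : YoungDiagram) : skew g (schur lam) = toSymm (vev (A (ketYoung Pol lam))) := by
  ext d
  have hdef : MvPowerSeries.coeff d (skew g (schur lam)) =
      ∑ᶠ mu, hall (schur lam) (g * schur mu) * MvPowerSeries.coeff d (schur mu) := rfl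
  rw [hdef, sum_mul_coeff_schur, coeff_toSymm_vev (h.mem _ (ketYoung_mem_youngSpan lam))]
  exact Finset.sum_congr rfl fun mu _ => by rw [h.hall_eq]

end PiSym

end

theorem mainTheorem3 (π lam : YoungDiagram) :
    PiSym.piSchur π lam = PiSym.toSymm (PiSym.matrixElement π lam) :=
  (PiSym.isSkew_lPerpOp π).skew_schur lam
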